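/- Let $d\ge 3$ and $N=2^{\lfloor (d+1)/2\rfloor}$, and let $\alpha_1,\dots,\alpha_d,\beta$ be Dirac matrices, i.e. Hermitian $N\times N$ matrices with $\alpha_j\alpha_k+\alpha_k\alpha_j=2\delta_{jk}\mathbb I$, $\alpha_j\beta+\beta\alpha_j=0$, $\beta^2=\mathbb I$. Write $L^2=L^2(\mathbb R^d;\mathbb C^N)$, $H^1=H^1(\mathbb R^d;\mathbb C^N)$, $\|\cdot\|$ for the $L^2$ norm, and $\nabla_A=\nabla-iA$. Let $A\in L^2_{\rm loc}(\mathbb R^d;\mathbb R^d)$ be a vector potential whose magnetic field $B=(B_{jk})$, $B_{jk}=\partial_jA_k-\partial_kA_j$ in the sense of distributions, is in $L^2_{\rm loc}$, and assume that $H_0(A)=-i\boldsymbol\alpha\cdot\nabla_A$ is self-adjoint in $L^2$ with domain $H^1$. Let $v_{\rm el}\in L^1_{\rm loc}(\mathbb R^d;\mathbb R)$ be such that $v_{\rm el}\in C^\infty(\mathbb R^d\setminus\{0\})$ and $v_{\rm el}$ is bounded outside any ball containing the origin, put $V_{\rm el}=v_{\rm el}\,\mathbb I$, and assume that $V_{\rm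 el}$ is $H_0(A)$-bounded in the following sense: there are $a,b>0$ with $a\le 1$ such that $\|V_{\rm el}\psi\|^2\le a\|H_0(A)\psi\|^2+b\|\psi\|^2$ for every $\psi\in H^1$. Let $H_0(A,V_{\rm el})=-i\boldsymbol\alpha\cdot\nabla_A+V_{\rm el}$ be the massless Dirac operator in $L^2$ with domain $H^1$. Assume that there are constants $\varepsilon_1,\varepsilon_2\ge 0$ with $$\Big(\frac{4d-7}{d-2}\Big)\varepsilon_1+2\varepsilon_2+\varepsilon_2^2<1$$ such that, for every $\psi\in H^1$, $$\int_{\mathbb R^d}|x|^2|B|^2|\psi|^2\,dx\le\varepsilon_1^2\|\nabla_A\psi\|^2,\qquad \int_{\mathbb R^d}|x|^2|\nabla v_{\rm el}|^2|\psi|^2\,dx\le\varepsilon_2^2\|\nabla_A\psi\|^2,$$ where $|B(x)|$ is the operator norm of the matrix $B(x)$ with respect to the Euclidean norm, and $\nabla v_{\rm el}$ is the classical gradient on $\mathbb R^d\setminus\{0\}$. Then $H_0(A,V_{\rm el})$ has no eigenvalues: $\sigma_p(H_0(A,V_{\rm el}))=\varnothing$. -/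

import Mathlib

open MeasureTheory
open scoped ContDiff

noncomputable section

/-- The Euclidean space `ℝ^d`. -/
abbrev Space (d : ℕ) : Type := EuclideanSpace ℝ (Fin d)

/-- The number `N = 2 ^ ⌊(d + 1) / 2⌋` of components of a spinor in dimension `d`
(the division of natural numbers is the rounded down one). -/
abbrev spinorDim (d : ℕ) : ℕ := 2 ^ ((d + 1) / 2)

/-- The space `ℂ^N` with its Euclidean norm. -/
abbrev Spinor (d : ℕ) : Type := EuclideanSpace ℂ (Fin (spinorDim d))

/-- Complex `N × N` matrices. -/
abbrev SpinMatrix (d : ℕ) : Type := Matrix (Fin (spinorDim d)) (Fin (spinorDim d)) ℂ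

/-- The Hilbert space `L²(ℝ^d; ℂ^N)`. -/
abbrev SpinorL2 (d : ℕ) : Type := Lp (Spinor d) 2 (volume : Measure (Space d))

/-- The action of a matrix on a spinor. -/
abbrev SpinMatrix.act {d : ℕ} (M : SpinMatrix d) : Spinor d →L[ℂ] Spinor d :=
  Matrix.toEuclideanCLM (𝕜 := ℂ) M

/-- `α₁, …, α_d, β` are Dirac matrices: Hermitian `N × N` matrices which square to the identity
and anticommute pairwise. -/
structure IsDiracMatrices {d : ℕ} (α : Fin d → SpinMatrix d) (β : SpinMatrix d) : Prop where
  hermitian_alpha : ∀ j, (α j).IsHermitian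
  hermitian_beta : β.IsHermitian
  anticomm_alpha : ∀ j k, α j * α k + α k * α j = if j = k then 2 else 0
  anticomm_beta : ∀ j, α j * β + β * α j = 0
  beta_sq : β * β = 1

/-- The classical partial derivative `∂_j φ`. -/
abbrev partialDeriv {d : ℕ} (j : Fin d) (φ : Space d → ℝ) (x : Space d) : ℝ :=
  fderiv ℝ φ x (EuclideanSpace.single j 1)

/-- `f` belongs to `L^p_loc(ℝ^d)`. -/
def MemLpLoc {d : ℕ} {F : Type*} [NormedAddCommGroup F] (f : Space d → F) (p : ENNReal) : Prop :=
  ∀ K : Set (Space d), IsCompact K → MemLp f p (volume.restrict K)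

/-- `g` is the `j`-th weak (distributional) partial derivative of `f`. It is used for locally
integrable `f` and `g` only. -/
def HasWeakPartialDeriv {d : ℕ} {F : Type*} [NormedAddCommGroup F] [NormedSpace ℝ F]
    (j : Fin d) (f g : Space d → F) : Prop :=
  ∀ φ : Space d → ℝ, ContDiff ℝ ∞ φ → HasCompactSupport φ →
    ∫ x, partialDeriv j φ x • f x = -∫ x, φ x • g x

/-- A test function times an `L²` function is integrable. -/
theorem integrable_test_smul {d : ℕ} (f : SpinorL2 d) {φ : Space d → ℝ} (hφ : Continuous φ)
    (hc : HasCompactSupport φ) : Integrable (fun x => φ x • f x) :=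
  ((Lp.memLp f).locallyIntegrable one_le_two).integrable_smul_left_of_hasCompactSupport hφ hc

theorem continuous_partialDeriv {d : ℕ} (j : Fin d) {φ : Space d → ℝ} (hφ : ContDiff ℝ ∞ φ) :
    Continuous (partialDeriv j φ) :=
  (hφ.continuous_fderiv (by simp)).clm_apply continuous_const

theorem hasCompactSupport_partialDeriv {d : ℕ} (j : Fin d) {φ : Space d → ℝ}
    (hc : HasCompactSupport φ) : HasCompactSupport (partialDeriv j φ) :=
  hc.fderiv_apply ℝ _

theorem HasWeakPartialDeriv.add_L2 {d : ℕ} {j : Fin d} {f₁ f₂ g₁ g₂ : SpinorL2 d}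
    (h₁ : HasWeakPartialDeriv j f₁ g₁) (h₂ : HasWeakPartialDeriv j f₂ g₂) :
    HasWeakPartialDeriv j (f₁ + f₂ : SpinorL2 d) (g₁ + g₂ : SpinorL2 d) := by
  intro φ hφ hc
  have e₁ : ∫ x, partialDeriv j φ x • (f₁ + f₂ : SpinorL2 d) x
      = ∫ x, (partialDeriv j φ x • f₁ x + partialDeriv j φ x • f₂ x) := by
    refine integral_congr_ae ?_
    filter_upwards [Lp.coeFn_add f₁ f₂] with x hx
    rw [hx, Pi.add_apply, smul_add]
  have e₂ : ∫ x, φ x • (g₁ + g₂ : SpinorL2 d) x = ∫ x, (φ x • g₁ x + φ x • g₂ x) := by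
    refine integral_congr_ae ?_
    filter_upwards [Lp.coeFn_add g₁ g₂] with x hx
    rw [hx, Pi.add_apply, smul_add]
  have hd := continuous_partialDeriv j hφ
  have hdc := hasCompactSupport_partialDeriv j hc
  rw [e₁, e₂, integral_add (integrable_test_smul f₁ hd hdc) (integrable_test_smul f₂ hd hdc),
    integral_add (integrable_test_smul g₁ hφ.continuous hc)
      (integrable_test_smul g₂ hφ.continuous hc), h₁ φ hφ hc, h₂ φ hφ hc, neg_add]

theorem HasWeakPartialDeriv.smul_L2 {d : ℕ} {j : Fin d} {f g : SpinorL2 d} (c : ℂ)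
    (h : HasWeakPartialDeriv j f g) :
    HasWeakPartialDeriv j (c • f : SpinorL2 d) (c • g : SpinorL2 d) := by
  intro φ hφ hc
  have e₁ : ∫ x, partialDeriv j φ x • (c • f : SpinorL2 d) x
      = ∫ x, c • (partialDeriv j φ x • f x) := by
    refine integral_congr_ae ?_
    filter_upwards [Lp.coeFn_smul c f] with x hx
    rw [hx, Pi.smul_apply, smul_comm]
  have e₂ : ∫ x, φ x • (c • g : SpinorL2 d) x = ∫ x, c • (φ x • g x) := by
    refine integral_congr_ae ?_
    filter_upwards [Lp.coeFn_smul c g] with x hx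
    rw [hx, Pi.smul_apply, smul_comm]
  rw [e₁, e₂, integral_smul, integral_smul, h φ hφ hc, smul_neg]

theorem HasWeakPartialDeriv.unique_L2 {d : ℕ} {j : Fin d} {f g₁ g₂ : SpinorL2 d}
    (h₁ : HasWeakPartialDeriv j f g₁) (h₂ : HasWeakPartialDeriv j f g₂) : g₁ = g₂ := by
  refine Lp.ext ?_
  refine ae_eq_of_integral_contDiff_smul_eq ((Lp.memLp g₁).locallyIntegrable one_le_two)
    ((Lp.memLp g₂).locallyIntegrable one_le_two) ?_
  intro φ hφ hc
  have := (h₁ φ hφ hc).symm.trans (h₂ φ hφ hc)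
  exact neg_injective this

/-- The Sobolev space `H¹(ℝ^d; ℂ^N)`: the functions in `L²` all of whose weak partial derivatives
of first order are in `L²`. -/
def sobolevH1 (d : ℕ) : Submodule ℂ (SpinorL2 d) where
  carrier := {ψ | ∀ j, ∃ g : SpinorL2 d, HasWeakPartialDeriv j ψ g}
  add_mem' := by
    intro ψ₁ ψ₂ h₁ h₂ j
    obtain ⟨g₁, hg₁⟩ := h₁ j
    obtain ⟨g₂, hg₂⟩ := h₂ j
    exact ⟨g₁ + g₂, hg₁.add_L2 hg₂⟩
  zero_mem' := by
    intro j
    refine ⟨0, ?_⟩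
    intro φ _ _
    have e : ∀ χ : Space d → ℝ, ∫ x, χ x • (0 : SpinorL2 d) x = 0 := by
      intro χ
      refine integral_eq_zero_of_ae ?_
      filter_upwards [Lp.coeFn_zero (Spinor d) 2 (volume : Measure (Space d))] with x hx
      rw [hx]
      simp
    rw [e, e, neg_zero]
  smul_mem' := by
    intro c ψ h j
    obtain ⟨g, hg⟩ := h j
    exact ⟨c • g, hg.smul_L2 c⟩

/-- The weak partial derivative `∂_j ψ ∈ L²` of `ψ ∈ H¹`. -/
def weakPartial {d : ℕ} (j : Fin d) : sobolevH1 d →ₗ[ℂ] SpinorL2 d where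
  toFun ψ := (ψ.2 j).choose
  map_add' ψ₁ ψ₂ := HasWeakPartialDeriv.unique_L2 ((ψ₁ + ψ₂).2 j).choose_spec
    ((ψ₁.2 j).choose_spec.add_L2 (ψ₂.2 j).choose_spec)
  map_smul' c ψ := HasWeakPartialDeriv.unique_L2 ((c • ψ).2 j).choose_spec
    ((ψ.2 j).choose_spec.smul_L2 c)

theorem weakPartial_spec {d : ℕ} (j : Fin d) (ψ : sobolevH1 d) :
    HasWeakPartialDeriv j (ψ : SpinorL2 d) (weakPartial j ψ) :=
  (ψ.2 j).choose_spec

/-- The magnetic derivative `∂_j^A ψ = ∂_j ψ - i A_j ψ` of `ψ ∈ H¹`. -/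
def magneticPartial {d : ℕ} (A : Space d → Space d) (j : Fin d) (ψ : sobolevH1 d)
    (x : Space d) : Spinor d :=
  weakPartial j ψ x - (Complex.I * (A x j : ℂ)) • (ψ : SpinorL2 d) x

/-- The square `‖∇_A ψ‖² = ∑_j ∫ |∂_j^A ψ|²` of the `L²` norm of the magnetic gradient. -/
def magneticGradSq {d : ℕ} (A : Space d → Space d) (ψ : sobolevH1 d) : ENNReal :=
  ∑ j, ∫⁻ x, ‖magneticPartial A j ψ x‖ₑ ^ 2

/-- The expression `-i α · ∇_A ψ + m β ψ + V ψ` for `ψ ∈ H¹`. -/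
def diracExpr {d : ℕ} (α : Fin d → SpinMatrix d) (β : SpinMatrix d) (m : ℝ)
    (A : Space d → Space d) (V : Space d → SpinMatrix d) (ψ : sobolevH1 d) (x : Space d) :
    Spinor d :=
  (-Complex.I) • ∑ j, (α j).act (magneticPartial A j ψ x)
    + (m : ℂ) • β.act ((ψ : SpinorL2 d) x) + (V x).act ((ψ : SpinorL2 d) x)

theorem diracExpr_add {d : ℕ} (α : Fin d → SpinMatrix d) (β : SpinMatrix d) (m : ℝ)
    (A : Space d → Space d) (V : Space d → SpinMatrix d) (ψ₁ ψ₂ : sobolevH1 d) :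
    diracExpr α β m A V (ψ₁ + ψ₂)
      =ᵐ[volume] diracExpr α β m A V ψ₁ + diracExpr α β m A V ψ₂ := by
  have hp : ∀ᵐ x, ∀ j, weakPartial j (ψ₁ + ψ₂) x = weakPartial j ψ₁ x + weakPartial j ψ₂ x := by
    rw [ae_all_iff]
    intro j
    rw [map_add]
    exact Lp.coeFn_add _ _
  filter_upwards [hp, Lp.coeFn_add (ψ₁ : SpinorL2 d) (ψ₂ : SpinorL2 d)] with x hx hψ
  have hψ' : ((ψ₁ + ψ₂ : sobolevH1 d) : SpinorL2 d) x
      = (ψ₁ : SpinorL2 d) x + (ψ₂ : SpinorL2 d) x := hψ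
  have hm : ∀ j, magneticPartial A j (ψ₁ + ψ₂) x
      = magneticPartial A j ψ₁ x + magneticPartial A j ψ₂ x := by
    intro j
    simp only [magneticPartial, hx, hψ', smul_add]
    abel
  simp only [diracExpr, Pi.add_apply, hm, hψ', map_add, Finset.sum_add_distrib, smul_add]
  abel

theorem diracExpr_smul {d : ℕ} (α : Fin d → SpinMatrix d) (β : SpinMatrix d) (m : ℝ)
    (A : Space d → Space d) (V : Space d → SpinMatrix d) (c : ℂ) (ψ : sobolevH1 d) :
    diracExpr α β m A V (c • ψ) =ᵐ[volume] c • diracExpr α β m A V ψ := by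
  have hp : ∀ᵐ x, ∀ j, weakPartial j (c • ψ) x = c • weakPartial j ψ x := by
    rw [ae_all_iff]
    intro j
    rw [map_smul]
    exact Lp.coeFn_smul _ _
  filter_upwards [hp, Lp.coeFn_smul c (ψ : SpinorL2 d)] with x hx hψ
  have hψ' : ((c • ψ : sobolevH1 d) : SpinorL2 d) x = c • (ψ : SpinorL2 d) x := hψ
  have hm : ∀ j, magneticPartial A j (c • ψ) x = c • magneticPartial A j ψ x := by
    intro j
    simp only [magneticPartial, hx, hψ', smul_sub]
    rw [smul_comm]
  simp only [diracExpr, Pi.smul_apply, hm, hψ', map_smul, ← Finset.smul_sum, smul_add]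
  rw [smul_comm c (-Complex.I), smul_comm c (m : ℂ)]

/-- The domain of the Dirac operator: all `ψ ∈ H¹` for which `-i α · ∇_A ψ + m β ψ + V ψ` is
in `L²`. -/
def diracDomain {d : ℕ} (α : Fin d → SpinMatrix d) (β : SpinMatrix d) (m : ℝ)
    (A : Space d → Space d) (V : Space d → SpinMatrix d) : Submodule ℂ (SpinorL2 d) where
  carrier := {ψ | ∃ h : ψ ∈ sobolevH1 d, MemLp (diracExpr α β m A V ⟨ψ, h⟩) 2 volume}
  add_mem' := by
    rintro ψ₁ ψ₂ ⟨h₁, k₁⟩ ⟨h₂, k₂⟩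
    exact ⟨add_mem h₁ h₂,
      (memLp_congr_ae (diracExpr_add α β m A V ⟨ψ₁, h₁⟩ ⟨ψ₂, h₂⟩)).2 (k₁.add k₂)⟩
  zero_mem' := by
    have h := diracExpr_smul α β m A V 0 (0 : sobolevH1 d)
    rw [zero_smul, zero_smul] at h
    exact ⟨zero_mem _, (memLp_congr_ae h).2 MemLp.zero⟩
  smul_mem' := by
    rintro c ψ ⟨h, k⟩
    exact ⟨Submodule.smul_mem _ c h,
      (memLp_congr_ae (diracExpr_smul α β m A V c ⟨ψ, h⟩)).2 (k.const_smul c)⟩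

/-- The Dirac operator `H_m(A, V) = -i α · ∇_A + m β + V` as an operator in `L²(ℝ^d; ℂ^N)`. -/
def diracOperator {d : ℕ} (α : Fin d → SpinMatrix d) (β : SpinMatrix d) (m : ℝ)
    (A : Space d → Space d) (V : Space d → SpinMatrix d) : SpinorL2 d →ₗ.[ℂ] SpinorL2 d where
  domain := diracDomain α β m A V
  toFun :=
    { toFun := fun ψ =>
        MemLp.toLp (diracExpr α β m A V ⟨ψ.1, ψ.2.choose⟩) ψ.2.choose_spec
      map_add' := by
        intro ψ₁ ψ₂
        have h := diracExpr_add α β m A V ⟨ψ₁.1, ψ₁.2.choose⟩ ⟨ψ₂.1, ψ₂.2.choose⟩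
        exact (MemLp.toLp_congr _ (ψ₁.2.choose_spec.add ψ₂.2.choose_spec) h).trans
          (MemLp.toLp_add _ _)
      map_smul' := by
        intro c ψ
        have h := diracExpr_smul α β m A V c ⟨ψ.1, ψ.2.choose⟩
        exact (MemLp.toLp_congr _ (ψ.2.choose_spec.const_smul c) h).trans
          (MemLp.toLp_const_smul _ _) }

/-- The point spectrum (set of eigenvalues) of a partially defined operator. -/
def pointSpectrum {H : Type*} [AddCommGroup H] [Module ℂ H] (T : H →ₗ.[ℂ] H) : Set ℂ :=
  {μ | ∃ ψ : T.domain, (ψ : H) ≠ 0 ∧ T ψ = μ • (ψ : H)}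

/-- `B` is the magnetic field of the vector potential `A`: `B_jk = ∂_j A_k - ∂_k A_j` in the sense
of distributions. It is used for locally integrable `A` and `B` only. -/
def IsMagneticField {d : ℕ} (A : Space d → Space d) (B : Space d → Matrix (Fin d) (Fin d) ℝ) :
    Prop :=
  ∀ j k, ∀ φ : Space d → ℝ, ContDiff ℝ ∞ φ → HasCompactSupport φ →
    ∫ x, φ x * B x j k = -∫ x, (partialDeriv j φ x * A x k - partialDeriv k φ x * A x j)

/-- `W` is bounded relative to `H_m(A)`: there are `a, b > 0` with `a ≤ 1` such that
`‖W ψ‖² ≤ a ‖H_m(A) ψ‖² + b ‖ψ‖²` for every `ψ ∈ H¹`. -/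
def IsDiracBounded {d : ℕ} (α : Fin d → SpinMatrix d) (β : SpinMatrix d) (m : ℝ)
    (A : Space d → Space d) (W : Space d → SpinMatrix d) : Prop :=
  ∃ a b : ℝ, 0 < a ∧ a ≤ 1 ∧ 0 < b ∧ ∀ ψ : sobolevH1 d,
    ∫⁻ x, ‖(W x).act ((ψ : SpinorL2 d) x)‖ₑ ^ 2
      ≤ ENNReal.ofReal a * ∫⁻ x, ‖diracExpr α β m A 0 ψ x‖ₑ ^ 2
        + ENNReal.ofReal b * ∫⁻ x, ‖(ψ : SpinorL2 d) x‖ₑ ^ 2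

/-- The electric potential `v 𝕀`. -/
def electricPotential {d : ℕ} (v : Space d → ℝ) (x : Space d) : SpinMatrix d :=
  (v x : ℂ) • (1 : SpinMatrix d)

/-- The operator norm `|M|` of a real square matrix for the Euclidean norm. (For a real matrix the
suprema over real and over complex vectors agree.) -/
def matrixOpNorm {d : ℕ} (M : Matrix (Fin d) (Fin d) ℝ) : ℝ :=
  ‖Matrix.toEuclideanCLM (𝕜 := ℝ) M‖

/-- The Hardy type inequality `∫ |x|² w² |ψ|² ≤ ε² ‖∇_A ψ‖²` for every `ψ ∈ H¹`. -/
def HardyBound {d : ℕ} (A : Space d → Space d) (w : Space d → ℝ) (ε : ℝ) : Prop :=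
  ∀ ψ : sobolevH1 d,
    ∫⁻ x, ENNReal.ofReal (‖x‖ ^ 2 * w x ^ 2 * ‖(ψ : SpinorL2 d) x‖ ^ 2)
      ≤ ENNReal.ofReal (ε ^ 2) * magneticGradSq A ψ

end

/-! Let ψ be an eigenfunction for μ. Testing the equation against α_j ψ shows that μ is real
(`eigenvalue_im_eq_zero`), so α·∇_A ψ = i f ψ with the real function f = Re μ - v. Put N = ‖fψ‖ =
‖α·∇_A ψ‖ and G = ‖∇_A ψ‖. Two inequalities between N and G exclude G > 0, and the magnetic Hardy
inequality then forces ψ = 0.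

The first is a virial inequality (`virial`). The dilation field x, weighted by f, is commuted with
-iα·∇_A. The terms without derivatives of f and without B collapse to ‖fψ‖², and Cauchy–Schwarz with
the two smallness assumptions gives N² ≤ ε₂GN + ε₁GN + ε₂G². The second is the Lichnerowicz formula
(`lichnerowicz`): (α·∇_A)² differs from ∇_A² by a term linear in B. Writing |B||ψ|² as the product
of |x||B||ψ| and |x|⁻¹|ψ| and using `magnetic_hardy`, one gets G² ≤ N² + (d ε₁/(d-2)) G².
`eq_zero_of_virial_of_lichnerowicz` combines the two.

Both rest on two integrated identities, a product rule for ∂_j^A and the commutator relation [∂_j^A,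
∂_k^A] = -i B_jk, each with a scalar weight Y and a constant matrix M. Only first derivatives of ψ
occur in them, so they make sense on H¹ (`integral_productDensity`, `integral_commutatorDensity`).
For smooth ψ they follow from integration by parts, and they extend by density. The passage to the
limit needs multiplication by A_j and by |x|B_jk to be bounded from H¹ to L². That these products
lie in L² follows from the domain assumption and the bound on B, and boundedness is then the closed
graph theorem (`exists_bound_mul`).

Weights singular at the origin are handled by cutoffs Y_n with |x||∇Y_n| bounded uniformly in n; all
error terms carry this factor and vanish by dominated convergence. -/

open Filter Topology
open scoped Convolution

/-! ### Mollification in L² -/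

section Mollification

variable {d : ℕ} {F : Type*} [NormedAddCommGroup F]

/-- Translations are continuous in `L²`. -/
theorem exists_lintegral_translate_le (f : Lp F 2 (volume : Measure (Space d))) {ε : ℝ}
    (hε : 0 < ε) :
    ∃ δ > 0, ∀ t : Space d, ‖t‖ < δ →
      ∫⁻ x, ‖f (x - t) - f x‖ₑ ^ 2 ≤ ENNReal.ofReal ε ^ 2 := by
  have : Fact ((2 : ENNReal) ≠ ⊤) := ⟨by simp⟩
  have hc : Continuous fun t : Space d => DomAddAct.mk t +ᵥ f :=
    (continuous_id.vadd continuous_const).comp DomAddAct.continuous_mk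
  have h0 : DomAddAct.mk (0 : Space d) +ᵥ f = f := by
    rw [DomAddAct.mk_zero, zero_vadd]
  obtain ⟨δ, hδ, h⟩ := Metric.continuous_iff.1 hc 0 ε hε
  refine ⟨δ, hδ, fun t ht => ?_⟩
  -- The action of `DomAddAct.mk c` sends f to f(c + ·), so f(x - t) corresponds to c = -t.
  have h1 := h (-t) (by simpa using ht)
  rw [h0, dist_eq_norm] at h1
  have h2 : eLpNorm (fun x => f (x - t) - f x) 2 volume ≤ ENNReal.ofReal ε := by
    have e : (fun x => f (x - t) - f x)
        =ᵐ[volume] (((DomAddAct.mk (-t) +ᵥ f) - f : Lp F 2 (volume : Measure (Space d)))) := by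
      filter_upwards [Lp.coeFn_sub (DomAddAct.mk (-t) +ᵥ f) f,
        DomAddAct.vadd_Lp_ae_eq (DomAddAct.mk (-t)) f] with x hx hy
      rw [hx, Pi.sub_apply, hy]
      simp [sub_eq_add_neg, add_comm]
    rw [eLpNorm_congr_ae e, ← Lp.enorm_def, ← ofReal_norm]
    exact ENNReal.ofReal_le_ofReal h1.le
  have h3 := eLpNorm_nnreal_pow_eq_lintegral (μ := volume) (f := fun x => f (x - t) - f x)
    (p := 2) (by norm_num)
  simp only [NNReal.coe_ofNat, ENNReal.coe_ofNat, ENNReal.rpow_ofNat] at h3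
  rw [← h3]
  gcongr

variable [NormedSpace ℝ F]

/-- The mollification of a function by a normalized bump function. -/
noncomputable def mollify (φ : ContDiffBump (0 : Space d)) (f : Space d → F) : Space d → F :=
  φ.normed volume ⋆[ContinuousLinearMap.lsmul ℝ ℝ, volume] f

theorem contDiff_mollify (φ : ContDiffBump (0 : Space d)) {f : Space d → F}
    (hf : LocallyIntegrable f) : ContDiff ℝ ∞ (mollify φ f) :=
  φ.hasCompactSupport_normed.contDiff_convolution_left _ (n := ⊤) φ.contDiff_normed hf

/-- Jensen's inequality for the square: on a probability space the L¹ norm is at most the L² norm.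
-/
theorem enorm_integral_sq_le {Ω : Type*} [MeasurableSpace Ω] (ν : Measure Ω)
    [IsProbabilityMeasure ν] {h : Ω → F} (hh : AEStronglyMeasurable h ν) :
    ‖∫ t, h t ∂ν‖ₑ ^ 2 ≤ ∫⁻ t, ‖h t‖ₑ ^ 2 ∂ν := by
  have h1 : ‖∫ t, h t ∂ν‖ₑ ≤ eLpNorm h 2 ν := by
    refine (enorm_integral_le_lintegral_enorm _).trans ?_
    rw [← eLpNorm_one_eq_lintegral_enorm]
    exact eLpNorm_le_eLpNorm_of_exponent_le (by norm_num) hh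
  have h3 := eLpNorm_nnreal_pow_eq_lintegral (μ := ν) (f := h) (p := 2) (by norm_num)
  simp only [NNReal.coe_ofNat, ENNReal.coe_ofNat, ENNReal.rpow_ofNat] at h3
  rw [← h3]
  gcongr

/-- A mollification averages translates of f against a probability density, so Jensen and Tonelli
bound the error by the L² modulus of continuity of translations. Only the outer radius of the bump
matters, so one bump can serve several functions at once. -/
theorem exists_mollify_close [CompleteSpace F] (f : Lp F 2 (volume : Measure (Space d))) {ε : ℝ} (hε : 0 < ε) :
    ∃ δ > 0, ∀ φ : ContDiffBump (0 : Space d), φ.rOut < δ →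
      eLpNorm (fun x => mollify φ f x - f x) 2 volume ≤ ENNReal.ofReal ε := by
  obtain ⟨δ, hδ, h⟩ := exists_lintegral_translate_le f hε
  refine ⟨δ, hδ, fun φ hφ => ?_⟩
  have hloc : LocallyIntegrable f volume := (Lp.memLp f).locallyIntegrable one_le_two
  have hsm : StronglyMeasurable f := Lp.stronglyMeasurable f
  set ρ := φ.normed (volume : Measure (Space d)) with hρ
  have hρm : Measurable fun t => ENNReal.ofReal (ρ t) :=
    (φ.continuous_normed.measurable).ennreal_ofReal
  set ν := (volume : Measure (Space d)).withDensity fun t => ENNReal.ofReal (ρ t) with hν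
  have hν1 : ∫⁻ t, ENNReal.ofReal (ρ t) = 1 := by
    rw [← ofReal_integral_eq_lintegral_ofReal φ.integrable_normed
      (ae_of_all _ φ.nonneg_normed), φ.integral_normed, ENNReal.ofReal_one]
  have : IsProbabilityMeasure ν := ⟨by rw [hν, withDensity_apply _ MeasurableSet.univ]; simpa⟩
  have hrep : ∀ x, mollify φ f x - f x = ∫ t, (f (x - t) - f x) ∂ν := by
    intro x
    rw [hν, integral_withDensity_eq_integral_toReal_smul hρm (by simp)]
    have e : ∀ t, (ENNReal.ofReal (ρ t)).toReal = ρ t :=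
      fun t => ENNReal.toReal_ofReal (φ.nonneg_normed t)
    simp only [e, smul_sub]
    have i1 : Integrable (fun t => ρ t • f (x - t)) :=
      φ.hasCompactSupport_normed.convolutionExists_left (ContinuousLinearMap.lsmul ℝ ℝ)
        φ.continuous_normed hloc x
    rw [integral_sub i1 (φ.integrable_normed.smul_const _), integral_smul_const,
      φ.integral_normed, one_smul]
    rfl
  have hmeas : Measurable fun p : Space d × Space d => ‖f (p.1 - p.2) - f p.1‖ₑ ^ 2 := by
    have : StronglyMeasurable fun p : Space d × Space d => f (p.1 - p.2) - f p.1 :=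
      (hsm.comp_measurable (measurable_fst.sub measurable_snd)).sub
        (hsm.comp_measurable measurable_fst)
    exact this.enorm.pow_const 2
  have h1 : ∫⁻ x, ‖mollify φ f x - f x‖ₑ ^ 2 ≤ ENNReal.ofReal ε ^ 2 := by
    calc ∫⁻ x, ‖mollify φ f x - f x‖ₑ ^ 2
        ≤ ∫⁻ x, ∫⁻ t, ‖f (x - t) - f x‖ₑ ^ 2 ∂ν := by
          refine lintegral_mono fun x => ?_
          rw [hrep]
          refine enorm_integral_sq_le ν ?_
          exact ((hsm.comp_measurable (measurable_const.sub measurable_id)).sub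
            stronglyMeasurable_const).aestronglyMeasurable
      _ = ∫⁻ t, (∫⁻ x, ‖f (x - t) - f x‖ₑ ^ 2) ∂ν := lintegral_lintegral_swap hmeas.aemeasurable
      _ = ∫⁻ t, ENNReal.ofReal (ρ t) * (∫⁻ x, ‖f (x - t) - f x‖ₑ ^ 2) := by
          rw [hν, lintegral_withDensity_eq_lintegral_mul _ hρm]
          · rfl
          · exact (hmeas.comp measurable_swap).lintegral_prod_right'
      _ ≤ ∫⁻ t, ENNReal.ofReal (ρ t) * ENNReal.ofReal ε ^ 2 := by
          refine lintegral_mono fun t => ?_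
          by_cases ht : ‖t‖ < δ
          · exact mul_le_mul_right (h t ht) _
          · have : ρ t = 0 := by
              have hs : t ∉ Function.support ρ := by
                rw [hρ, φ.support_normed_eq]
                simp only [Metric.mem_ball, dist_zero_right]
                intro h'
                exact ht (h'.trans hφ)
              simpa using hs
            simp [this]
      _ = ENNReal.ofReal ε ^ 2 := by rw [lintegral_mul_const _ hρm, hν1, one_mul]
  have h3 := eLpNorm_nnreal_pow_eq_lintegral (μ := volume) (f := fun x => mollify φ f x - f x)
    (p := 2) (by norm_num)
  simp only [NNReal.coe_ofNat, ENNReal.coe_ofNat, ENNReal.rpow_ofNat] at h3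
  rw [← h3] at h1
  exact (ENNReal.pow_le_pow_left_iff two_ne_zero).1 h1

/-- Mollification commutes with weak derivatives. -/
theorem fderiv_mollify (φ : ContDiffBump (0 : Space d)) {f g : Space d → F} {j : Fin d}
    (hf : LocallyIntegrable f) (h : HasWeakPartialDeriv j f g) (x : Space d) :
    fderiv ℝ (mollify φ f) x (EuclideanSpace.single j 1) = mollify φ g x := by
  have h1 := (φ.hasCompactSupport_normed (μ := volume)).hasFDerivAt_convolution_left
    (ContinuousLinearMap.lsmul ℝ ℝ) (φ.contDiff_normed (n := 1)) hf x
  have h1' : HasFDerivAt (mollify φ f) _ x := h1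
  rw [h1'.fderiv]
  set ρ := φ.normed (volume : Measure (Space d)) with hρ
  have hρs : ContDiff ℝ ∞ ρ := φ.contDiff_normed (n := ⊤)
  have hρc : HasCompactSupport ρ := φ.hasCompactSupport_normed
  -- The reflected kernel t ↦ ρ(x - t) is the test function. Its reflection changes the sign of the
  -- derivative, which compensates the sign in the definition of a weak derivative.
  have hd : ContDiff ℝ ∞ fun t : Space d => ρ (x - t) := hρs.comp (contDiff_const.sub contDiff_id)
  have hcs : HasCompactSupport fun t : Space d => ρ (x - t) :=
    hρc.comp_homeomorph (Homeomorph.subLeft x)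
  have h2 := h _ hd hcs
  have hpd : ∀ t, partialDeriv j (fun t : Space d => ρ (x - t)) t = - partialDeriv j ρ (x - t) := by
    intro t
    have ha : HasFDerivAt (fun t : Space d => ρ (x - t))
        ((fderiv ℝ ρ (x - t)).comp (-ContinuousLinearMap.id ℝ (Space d))) t :=
      HasFDerivAt.comp t ((hρs.differentiable (by simp)) (x - t)).hasFDerivAt
        ((hasFDerivAt_id t).const_sub x)
    rw [partialDeriv, ha.fderiv]
    simp
  simp only [hpd, neg_smul, integral_neg, neg_inj] at h2
  rw [convolution_eq_swap, mollify, convolution_eq_swap]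
  simp only [ContinuousLinearMap.lsmul_apply]
  rw [← h2, ContinuousLinearMap.integral_apply]
  · rfl
  · have := ((hρc.fderiv ℝ).convolutionExists_left
      ((ContinuousLinearMap.lsmul ℝ ℝ).precompL (Space d) : (Space d →L[ℝ] ℝ) →L[ℝ] F →L[ℝ] _)
      (hρs.continuous_fderiv (by simp)) hf x).integrable_swap
    exact this

end Mollification

/-! ### Density of smooth functions in H¹ -/

section SobolevApproximation

variable {d : ℕ}

/-- Integration by parts: a classical derivative is a weak derivative. -/
theorem ContDiff.hasWeakPartialDeriv {F : Type*} [NormedAddCommGroup F] [NormedSpace ℝ F]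
    {W : Space d → F} (hW : ContDiff ℝ ∞ W) (j : Fin d) :
    HasWeakPartialDeriv j W fun x => fderiv ℝ W x (EuclideanSpace.single j 1) := by
  intro φ hφ hc
  have hWd : Continuous fun x => fderiv ℝ W x (EuclideanSpace.single j 1) :=
    (hW.continuous_fderiv (by simp)).clm_apply continuous_const
  have h := integral_smul_fderiv_eq_neg_fderiv_smul_of_integrable (μ := volume) (f := φ) (g := W)
    (v := EuclideanSpace.single j 1)
    (((continuous_partialDeriv j hφ).smul hW.continuous).integrable_of_hasCompactSupport
      (hasCompactSupport_partialDeriv j hc).smul_right)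
    ((hφ.continuous.smul hWd).integrable_of_hasCompactSupport hc.smul_right)
    ((hφ.continuous.smul hW.continuous).integrable_of_hasCompactSupport hc.smul_right)
    (fun x _ => (hφ.differentiable (by simp)) x) (fun x _ => (hW.differentiable (by simp)) x)
  rw [h, neg_neg]

theorem HasWeakPartialDeriv.congr {F : Type*} [NormedAddCommGroup F] [NormedSpace ℝ F]
    {j : Fin d} {f f' g g' : Space d → F} (h : HasWeakPartialDeriv j f g)
    (hf : f =ᵐ[volume] f') (hg : g =ᵐ[volume] g') : HasWeakPartialDeriv j f' g' := by
  intro φ hφ hc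
  have := h φ hφ hc
  rw [integral_congr_ae (hf.mono fun x hx => by simp only; rw [hx] :
      (fun x => partialDeriv j φ x • f x) =ᵐ[volume] fun x => partialDeriv j φ x • f' x),
    integral_congr_ae (hg.mono fun x hx => by simp only; rw [hx] :
      (fun x => φ x • g x) =ᵐ[volume] fun x => φ x • g' x)] at this
  exact this

theorem weakPartial_eq {ψ : sobolevH1 d} {j : Fin d} {g : SpinorL2 d}
    (h : HasWeakPartialDeriv j (ψ : SpinorL2 d) g) : weakPartial j ψ = g :=
  (weakPartial_spec j ψ).unique_L2 h

/-- `W` is a smooth representative of the Sobolev function `w`. -/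
structure IsSmoothRep (w : sobolevH1 d) (W : Space d → Spinor d) : Prop where
  contDiff : ContDiff ℝ ∞ W
  ae_eq : (w : SpinorL2 d) =ᵐ[volume] W
  weakPartial_ae_eq : ∀ j, weakPartial j w =ᵐ[volume]
    fun x => fderiv ℝ W x (EuclideanSpace.single j 1)

/-- Smooth functions are dense in `H¹`. -/
theorem exists_smooth_close (ψ : sobolevH1 d) {ε : ℝ} (hε : 0 < ε) :
    ∃ (w : sobolevH1 d) (W : Space d → Spinor d), IsSmoothRep w W ∧
      ‖(w : SpinorL2 d) - ψ‖ ≤ ε ∧ ∀ j, ‖weakPartial j w - weakPartial j ψ‖ ≤ ε := by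
  obtain ⟨δ, hδ, h⟩ := exists_mollify_close (ψ : SpinorL2 d) hε
  choose δ' hδ' h' using fun j => exists_mollify_close (weakPartial j ψ) hε
  -- A single radius must work for ψ and its d derivatives, so that the derivatives of the
  -- approximation are the mollified derivatives.
  obtain ⟨r, hr, hrδ, hrδ'⟩ : ∃ r > 0, r < δ ∧ ∀ j, r < δ' j := by
    have h1 : ∀ᶠ r in 𝓝[>] (0 : ℝ), r < δ ∧ ∀ j, r < δ' j :=
      nhdsWithin_le_nhds ((gt_mem_nhds hδ).and (eventually_all.2 fun j => gt_mem_nhds (hδ' j)))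
    obtain ⟨r, h2, h3⟩ := (h1.and self_mem_nhdsWithin).exists
    exact ⟨r, h3, h2.1, h2.2⟩
  let φ : ContDiffBump (0 : Space d) := ⟨r / 2, r, by positivity, by linarith⟩
  have hloc : LocallyIntegrable (ψ : SpinorL2 d) volume :=
    (Lp.memLp (ψ : SpinorL2 d)).locallyIntegrable one_le_two
  set W := mollify φ (ψ : SpinorL2 d) with hWdef
  have hW : ContDiff ℝ ∞ W := contDiff_mollify φ hloc
  have hder : ∀ j, (fun x => fderiv ℝ W x (EuclideanSpace.single j 1))
      = mollify φ (weakPartial j ψ) := fun j =>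
    funext fun x => fderiv_mollify φ hloc (weakPartial_spec j ψ) x
  have key : ∀ (f : SpinorL2 d) (G : Space d → Spinor d), Continuous G →
      eLpNorm (fun x => G x - f x) 2 volume ≤ ENNReal.ofReal ε →
      ∃ g : SpinorL2 d, g =ᵐ[volume] G ∧ ‖g - f‖ ≤ ε := by
    intro f G hG hle
    have hm : MemLp (fun x => G x - f x) 2 volume :=
      ⟨hG.aestronglyMeasurable.sub (Lp.memLp f).1, hle.trans_lt ENNReal.ofReal_lt_top⟩
    have hm2 : MemLp G 2 volume := by
      have := hm.add (Lp.memLp f)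
      refine this.ae_eq (ae_of_all _ fun x => ?_)
      simp
    refine ⟨hm2.toLp G, hm2.coeFn_toLp, ?_⟩
    have e : hm2.toLp G - f = hm.toLp _ := by
      refine Lp.ext ?_
      filter_upwards [Lp.coeFn_sub (hm2.toLp G) f, hm2.coeFn_toLp, hm.coeFn_toLp] with x h1 h2 h3
      rw [h1, Pi.sub_apply, h2, h3]
    rw [e, Lp.norm_toLp]
    exact ENNReal.toReal_le_of_le_ofReal hε.le hle
  obtain ⟨w, hw, hwε⟩ := key ψ W hW.continuous (h φ hrδ)
  have hcont : ∀ j, Continuous (mollify φ (weakPartial j ψ)) := fun j => by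
    rw [← hder j]
    exact (hW.continuous_fderiv (by simp)).clm_apply continuous_const
  choose g hg hgε using fun j => key (weakPartial j ψ) _ (hcont j) (h' j φ (hrδ' j))
  have hwg : ∀ j, HasWeakPartialDeriv j w (g j) := fun j =>
    (hW.hasWeakPartialDeriv j).congr hw.symm (by rw [hder j]; exact (hg j).symm)
  have hwH : w ∈ sobolevH1 d := fun j => ⟨g j, hwg j⟩
  have hwp : ∀ j, weakPartial j ⟨w, hwH⟩ = g j := fun j => weakPartial_eq (hwg j)
  refine ⟨⟨w, hwH⟩, W, ⟨hW, hw, fun j => ?_⟩, hwε, fun j => ?_⟩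
  · rw [hwp j, hder j]
    exact hg j
  · rw [hwp j]
    exact hgε j

end SobolevApproximation

/-! ### Boundedness of multiplication operators from H¹ to L² -/

section ClosedGraph

variable {d : ℕ}

theorem continuous_integral_test_smul {φ : Space d → ℝ} (hφ : Continuous φ)
    (hc : HasCompactSupport φ) : Continuous fun f : SpinorL2 d => ∫ x, φ x • f x := by
  have hm : MemLp φ 2 (volume : Measure (Space d)) := hφ.memLp_of_hasCompactSupport hc
  have h := ((ContinuousLinearMap.lsmul ℝ ℝ : ℝ →L[ℝ] Spinor d →L[ℝ] Spinor d).lpPairing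
    (volume : Measure (Space d)) 2 2 (hm.toLp φ)).continuous
  refine h.congr fun f => ?_
  rw [ContinuousLinearMap.lpPairing_eq_integral]
  refine integral_congr_ae ?_
  filter_upwards [hm.coeFn_toLp] with x hx
  rw [hx]
  rfl

variable (d) in
/-- The graph of the weak gradient, a model of `H¹` as a Banach space. -/
noncomputable def gradGraph : Submodule ℂ (SpinorL2 d × (Fin d → SpinorL2 d)) where
  carrier := {p | ∀ j, HasWeakPartialDeriv j p.1 (p.2 j)}
  add_mem' h₁ h₂ j := (h₁ j).add_L2 (h₂ j)
  zero_mem' j := by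
    have := (weakPartial_spec j (0 : sobolevH1 d))
    rwa [map_zero] at this
  smul_mem' c _ h j := (h j).smul_L2 c

/-- Each test function imposes an equation between continuous functionals on L². Closedness makes
the graph a Banach space, as the closed graph theorem requires. -/
theorem isClosed_gradGraph : IsClosed (gradGraph d : Set (SpinorL2 d × (Fin d → SpinorL2 d))) := by
  have e : (gradGraph d : Set (SpinorL2 d × (Fin d → SpinorL2 d)))
      = ⋂ j, ⋂ φ : Space d → ℝ, ⋂ (_ : ContDiff ℝ ∞ φ), ⋂ (_ : HasCompactSupport φ),
        {p | ∫ x, partialDeriv j φ x • p.1 x = -∫ x, φ x • p.2 j x} := by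
    ext p
    simp only [Set.mem_iInter]
    rfl
  rw [e]
  refine isClosed_iInter fun j => isClosed_iInter fun φ => isClosed_iInter fun hφ =>
    isClosed_iInter fun hc => isClosed_eq ?_ ?_
  · exact (continuous_integral_test_smul (continuous_partialDeriv j hφ)
      (hasCompactSupport_partialDeriv j hc)).comp continuous_fst
  · exact ((continuous_integral_test_smul hφ.continuous hc).comp
      ((continuous_apply j).comp continuous_snd)).neg

/-- The element of `H¹` given by a point of the graph of the gradient. -/
def gradGraphToH1 (p : gradGraph d) : sobolevH1 d := ⟨p.1.1, fun j => ⟨p.1.2 j, p.2 j⟩⟩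

/-- A multiplication operator from `H¹` to `L²`. -/
noncomputable def mulH1 {a : Space d → ℝ}
    (ha : ∀ ψ : sobolevH1 d, MemLp (fun x => a x • (ψ : SpinorL2 d) x) 2 volume) :
    sobolevH1 d →ₗ[ℂ] SpinorL2 d where
  toFun ψ := (ha ψ).toLp _
  map_add' ψ₁ ψ₂ := by
    rw [← MemLp.toLp_add]
    refine MemLp.toLp_congr _ _ ?_
    filter_upwards [Lp.coeFn_add (ψ₁ : SpinorL2 d) (ψ₂ : SpinorL2 d)] with x hx
    have hx' : ((ψ₁ + ψ₂ : sobolevH1 d) : SpinorL2 d) x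
      = (ψ₁ : SpinorL2 d) x + (ψ₂ : SpinorL2 d) x := hx
    rw [hx', smul_add]
    rfl
  map_smul' c ψ := by
    simp only [RingHom.id_apply]
    rw [← MemLp.toLp_const_smul]
    refine MemLp.toLp_congr _ _ ?_
    filter_upwards [Lp.coeFn_smul c (ψ : SpinorL2 d)] with x hx
    have hx' : ((c • ψ : sobolevH1 d) : SpinorL2 d) x = c • (ψ : SpinorL2 d) x := hx
    rw [hx', smul_comm]
    rfl

theorem coeFn_mulH1 {a : Space d → ℝ}
    (ha : ∀ ψ : sobolevH1 d, MemLp (fun x => a x • (ψ : SpinorL2 d) x) 2 volume)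
    (ψ : sobolevH1 d) : mulH1 ha ψ =ᵐ[volume] fun x => a x • (ψ : SpinorL2 d) x :=
  (ha ψ).coeFn_toLp

/-- A multiplication operator which maps `H¹` into `L²` is bounded. -/
theorem exists_bound_mul {a : Space d → ℝ}
    (ha : ∀ ψ : sobolevH1 d, MemLp (fun x => a x • (ψ : SpinorL2 d) x) 2 volume) :
    ∃ C : ℝ, ∀ ψ : sobolevH1 d, ‖mulH1 ha ψ‖
      ≤ C * (‖(ψ : SpinorL2 d)‖ + ∑ j, ‖weakPartial j ψ‖) := by
  have : CompleteSpace (gradGraph d) := isClosed_gradGraph.completeSpace_coe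
  let T : gradGraph d →ₗ[ℂ] SpinorL2 d :=
    { toFun := fun p => mulH1 ha (gradGraphToH1 p)
      map_add' := fun p q => (mulH1 ha).map_add (gradGraphToH1 p) (gradGraphToH1 q)
      map_smul' := fun c p => (mulH1 ha).map_smul c (gradGraphToH1 p) }
  have hT : Continuous T := by
    -- Along a common subsequence both u n and T (u n) converge almost everywhere, and pointwise
    -- multiplication by a identifies the limit.
    refine T.continuous_of_seq_closed_graph fun u p y hu hTu => ?_
    have h1 : Tendsto (fun n => (u n).1.1) atTop (𝓝 p.1.1) :=
      ((continuous_fst.comp continuous_subtype_val).tendsto _).comp hu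
    obtain ⟨ns, hns, h2⟩ := (tendstoInMeasure_of_tendsto_Lp h1).exists_seq_tendsto_ae
    have h3 : Tendsto (fun n => T (u (ns n))) atTop (𝓝 y) := hTu.comp hns.tendsto_atTop
    obtain ⟨ms, hms, h4⟩ := (tendstoInMeasure_of_tendsto_Lp h3).exists_seq_tendsto_ae
    refine Lp.ext ?_
    have h5 : ∀ᵐ x, ∀ n, T (u n) x = a x • (u n).1.1 x :=
      ae_all_iff.2 fun n => coeFn_mulH1 ha (gradGraphToH1 (u n))
    filter_upwards [h2, h4, h5, coeFn_mulH1 ha (gradGraphToH1 p)] with x e2 e4 e5 e6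
    have e7 : Tendsto (fun n => T (u (ns (ms n))) x) atTop (𝓝 (a x • p.1.1 x)) := by
      simp only [e5]
      exact (e2.comp hms.tendsto_atTop).const_smul (a x)
    exact (tendsto_nhds_unique e4 e7).trans e6.symm
  let T' : gradGraph d →L[ℂ] SpinorL2 d := ⟨T, hT⟩
  refine ⟨‖T'‖, fun ψ => ?_⟩
  let p : gradGraph d := ⟨(ψ.1, fun j => weakPartial j ψ), fun j => weakPartial_spec j ψ⟩
  refine (T'.le_opNorm p).trans ?_
  gcongr
  have hp : ‖p‖ = max ‖(ψ : SpinorL2 d)‖ ‖fun j => weakPartial j ψ‖ := rfl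
  rw [hp]
  have hs : 0 ≤ ∑ j, ‖weakPartial j ψ‖ := Finset.sum_nonneg fun _ _ => norm_nonneg _
  refine max_le (by linarith) ?_
  refine (pi_norm_le_iff_of_nonneg (by positivity)).2 fun j => ?_
  have := Finset.single_le_sum (f := fun j => ‖weakPartial j ψ‖) (fun _ _ => norm_nonneg _)
    (Finset.mem_univ j)
  have h0 := norm_nonneg (ψ : SpinorL2 d)
  linarith

/-- Every `H¹` function is the limit in `H¹` of smooth functions. -/
theorem exists_seq_isSmoothRep (ψ : sobolevH1 d) :
    ∃ (w : ℕ → sobolevH1 d) (W : ℕ → Space d → Spinor d), (∀ n, IsSmoothRep (w n) (W n)) ∧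
      Tendsto (fun n => (w n : SpinorL2 d)) atTop (𝓝 ψ) ∧
      ∀ j, Tendsto (fun n => weakPartial j (w n)) atTop (𝓝 (weakPartial j ψ)) := by
  choose w W h h0 h1 using fun n : ℕ => exists_smooth_close ψ (Nat.one_div_pos_of_nat (n := n))
  refine ⟨w, W, h, ?_, fun j => ?_⟩
  · exact tendsto_iff_norm_sub_tendsto_zero.2 (squeeze_zero (fun _ => norm_nonneg _) h0
      tendsto_one_div_add_atTop_nhds_zero_nat)
  · exact tendsto_iff_norm_sub_tendsto_zero.2 (squeeze_zero (fun _ => norm_nonneg _)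
      (fun n => h1 n j) tendsto_one_div_add_atTop_nhds_zero_nat)

/-- Used with a = A_j and a = |x|B_jk to pass from smooth functions to all of H¹. -/
theorem tendsto_mulH1 {a : Space d → ℝ}
    (ha : ∀ ψ : sobolevH1 d, MemLp (fun x => a x • (ψ : SpinorL2 d) x) 2 volume)
    {w : ℕ → sobolevH1 d} {ψ : sobolevH1 d}
    (h : Tendsto (fun n => (w n : SpinorL2 d)) atTop (𝓝 ψ))
    (h' : ∀ j, Tendsto (fun n => weakPartial j (w n)) atTop (𝓝 (weakPartial j ψ))) :
    Tendsto (fun n => mulH1 ha (w n)) atTop (𝓝 (mulH1 ha ψ)) := by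
  obtain ⟨C, hC⟩ := exists_bound_mul ha
  rw [tendsto_iff_norm_sub_tendsto_zero] at h ⊢
  have h'' := fun j => tendsto_iff_norm_sub_tendsto_zero.1 (h' j)
  have hs := (h.add (tendsto_finsetSum Finset.univ fun j _ => h'' j)).const_mul C
  simp only [Finset.sum_const_zero, add_zero, mul_zero] at hs
  refine squeeze_zero (fun _ => norm_nonneg _) (fun n => ?_) hs
  have := hC (w n - ψ)
  simpa only [map_sub, AddSubgroupClass.coe_sub] using this

end ClosedGraph

/-! ### Product rule and commutator identity for smooth functions -/

section SmoothIdentities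

variable {d : ℕ}

/-- The integral of a derivative of a compactly supported function vanishes. -/
theorem integral_fderiv_apply_eq_zero {F : Type*} [NormedAddCommGroup F] [NormedSpace ℝ F]
    {f : Space d → F} (hf : ContDiff ℝ 1 f) (hc : HasCompactSupport f) (e : Space d) :
    Integrable (fun x => fderiv ℝ f x e) ∧ ∫ x, fderiv ℝ f x e = 0 := by
  have hd : Continuous fun x => fderiv ℝ f x e :=
    (hf.continuous_fderiv (by simp)).clm_apply continuous_const
  have hi : Integrable fun x => fderiv ℝ f x e :=
    hd.integrable_of_hasCompactSupport (hc.fderiv_apply ℝ e)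
  refine ⟨hi, ?_⟩
  have h := integral_smul_fderiv_eq_neg_fderiv_smul_of_integrable (μ := volume)
    (f := fun _ : Space d => (1 : ℝ)) (g := f) (v := e)
    (by simp) (by simpa using hi)
    (by simpa using hf.continuous.integrable_of_hasCompactSupport hc)
    (fun x _ => differentiableAt_const _) (fun x _ => hf.differentiable (by simp) x)
  simpa using h

/-- The sesquilinear density `Y ⟨f, M g⟩`. -/
noncomputable def pairing (Y : Space d → ℝ) (M : Spinor d →L[ℂ] Spinor d) (f g : Space d → Spinor d)
    (x : Space d) : ℂ := (Y x : ℂ) * inner ℂ (f x) (M (g x))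

theorem ContDiff.pairing {Y : Space d → ℝ} (hY : ContDiff ℝ ∞ Y) (M : Spinor d →L[ℂ] Spinor d)
    {f g : Space d → Spinor d} (hf : ContDiff ℝ ∞ f) (hg : ContDiff ℝ ∞ g) :
    ContDiff ℝ ∞ (pairing Y M f g) :=
  (Complex.ofRealCLM.contDiff.comp hY).mul
    (hf.inner ℂ ((M.restrictScalars ℝ).contDiff.comp hg))

theorem hasCompactSupport_pairing {Y : Space d → ℝ} (hc : HasCompactSupport Y)
    (M : Spinor d →L[ℂ] Spinor d) (f g : Space d → Spinor d) :
    HasCompactSupport (pairing Y M f g) :=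
  HasCompactSupport.mul_right (f := fun x => (Y x : ℂ)) (hc.comp_left Complex.ofReal_zero)

theorem fderiv_pairing {Y : Space d → ℝ} (hY : ContDiff ℝ ∞ Y) (M : Spinor d →L[ℂ] Spinor d)
    {f g : Space d → Spinor d} (hf : ContDiff ℝ ∞ f) (hg : ContDiff ℝ ∞ g) (x e : Space d) :
    fderiv ℝ (pairing Y M f g) x e = (fderiv ℝ Y x e : ℂ) * inner ℂ (f x) (M (g x))
      + Y x * inner ℂ (fderiv ℝ f x e) (M (g x)) + Y x * inner ℂ (f x) (M (fderiv ℝ g x e)) := by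
  have h1 : HasFDerivAt (fun x => (Y x : ℂ)) (Complex.ofRealCLM.comp (fderiv ℝ Y x)) x :=
    Complex.ofRealCLM.hasFDerivAt.comp x (hY.differentiable (by simp) x).hasFDerivAt
  have h2 := (hf.differentiable (by simp) x).hasFDerivAt
  have h3 : HasFDerivAt (fun x => M (g x)) ((M.restrictScalars ℝ).comp (fderiv ℝ g x)) x :=
    (M.restrictScalars ℝ).hasFDerivAt.comp x (hg.differentiable (by simp) x).hasFDerivAt
  have h : HasFDerivAt (pairing Y M f g) _ x := h1.mul (h2.inner ℂ h3)
  rw [h.fderiv]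
  simp
  ring

/-- The magnetic field in the sense of distributions, tested with a complex function. -/
theorem IsMagneticField.integral_complex {A : Space d → Space d}
    {B : Space d → Matrix (Fin d) (Fin d) ℝ} (hAB : IsMagneticField A B)
    (hA : ∀ j, LocallyIntegrable fun x => A x j) (hB : ∀ j k, LocallyIntegrable fun x => B x j k)
    (j k : Fin d) {F : Space d → ℂ} (hF : ContDiff ℝ ∞ F) (hc : HasCompactSupport F) :
    Integrable (fun x => F x * B x j k) ∧
    Integrable (fun x => fderiv ℝ F x (EuclideanSpace.single j 1) * A x k
      - fderiv ℝ F x (EuclideanSpace.single k 1) * A x j) ∧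
    ∫ x, F x * B x j k = -∫ x, (fderiv ℝ F x (EuclideanSpace.single j 1) * A x k
      - fderiv ℝ F x (EuclideanSpace.single k 1) * A x j) := by
  have hd : ∀ e, Continuous fun x => fderiv ℝ F x e := fun e =>
    (hF.continuous_fderiv (by simp)).clm_apply continuous_const
  have i0 : ∀ (G : Space d → ℂ) (b : Space d → ℝ), Continuous G → HasCompactSupport G →
      LocallyIntegrable b → Integrable fun x => G x * b x := by
    intro G b hG hGc hb
    have := hb.integrable_smul_right_of_hasCompactSupport hG hGc
    refine this.congr (ae_of_all _ fun x => ?_)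
    simp [mul_comm]
  have i1 := i0 F _ hF.continuous hc (hB j k)
  have i2 : Integrable (fun x => fderiv ℝ F x (EuclideanSpace.single j 1) * A x k
      - fderiv ℝ F x (EuclideanSpace.single k 1) * A x j) :=
    (i0 _ _ (hd (EuclideanSpace.single j 1)) (hc.fderiv_apply ℝ _) (hA k)).sub
    (i0 _ _ (hd (EuclideanSpace.single k 1)) (hc.fderiv_apply ℝ _) (hA j))
  refine ⟨i1, i2, ?_⟩
  -- The definition of B allows real test functions only, so real and imaginary parts are tested
  -- separately.
  have hre : ∀ L : ℂ →L[ℝ] ℝ, L (∫ x, F x * B x j k)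
      = L (-∫ x, (fderiv ℝ F x (EuclideanSpace.single j 1) * A x k
      - fderiv ℝ F x (EuclideanSpace.single k 1) * A x j)) := by
    intro L
    have hLF : ∀ x e, fderiv ℝ (fun y => L (F y)) x e = L (fderiv ℝ F x e) := by
      intro x e
      have : HasFDerivAt (fun y => L (F y)) (L.comp (fderiv ℝ F x)) x :=
        L.hasFDerivAt.comp x (hF.differentiable (by simp) x).hasFDerivAt
      rw [this.fderiv]
      rfl
    have hs : ∀ (z : ℂ) (r : ℝ), L (z * r) = L z * r := by
      intro z r
      rw [mul_comm, ← Complex.real_smul, map_smul, smul_eq_mul, mul_comm]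
    have h := hAB j k (fun y => L (F y)) (L.contDiff.comp hF) (hc.comp_left L.map_zero)
    rw [map_neg, ← L.integral_comp_comm i1, ← L.integral_comp_comm i2]
    simp only [partialDeriv, hLF] at h
    simpa only [map_sub, hs] using h
  exact Complex.ext (hre Complex.reCLM) (hre Complex.imCLM)

/-- The integrand of the commutator identity for the magnetic derivatives: formally, its integral
vanishes since `[∂_j^A, ∂_k^A] = -i B_jk`. -/
noncomputable def commutatorDensity (A : Space d → Space d) (B : Space d → Matrix (Fin d) (Fin d) ℝ)
    (Y : Space d → ℝ) (M : Spinor d →L[ℂ] Spinor d) (j k : Fin d) (ψ : sobolevH1 d)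
    (x : Space d) : ℂ :=
  pairing Y M (magneticPartial A j ψ) (magneticPartial A k ψ) x
    - pairing Y M (magneticPartial A k ψ) (magneticPartial A j ψ) x
    + pairing (partialDeriv j Y) M (ψ : SpinorL2 d) (magneticPartial A k ψ) x
    - pairing (partialDeriv k Y) M (ψ : SpinorL2 d) (magneticPartial A j ψ) x
    - Complex.I * (B x j k * pairing Y M (ψ : SpinorL2 d) (ψ : SpinorL2 d) x)

/-- The integrand of the product rule for the magnetic derivatives. -/
noncomputable def productDensity (A : Space d → Space d) (Y : Space d → ℝ) (M : Spinor d →L[ℂ] Spinor d)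
    (j : Fin d) (ψ : sobolevH1 d) (x : Space d) : ℂ :=
  pairing (partialDeriv j Y) M (ψ : SpinorL2 d) (ψ : SpinorL2 d) x
    + pairing Y M (magneticPartial A j ψ) (ψ : SpinorL2 d) x
    + pairing Y M (ψ : SpinorL2 d) (magneticPartial A j ψ) x

/-- The density is the exact derivative ∂_j(Y⟨W, MW⟩): since A_j is real, its contributions from the
two slots of the inner product cancel. -/
theorem IsSmoothRep.integral_productDensity {w : sobolevH1 d} {W : Space d → Spinor d}
    (h : IsSmoothRep w W) (A : Space d → Space d) {Y : Space d → ℝ} (hY : ContDiff ℝ ∞ Y)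
    (hc : HasCompactSupport Y) (M : Spinor d →L[ℂ] Spinor d) (j : Fin d) :
    ∫ x, productDensity A Y M j w x = 0 := by
  have hp := integral_fderiv_apply_eq_zero ((hY.pairing M h.contDiff h.contDiff).of_le (by simp))
    (hasCompactSupport_pairing hc M W W) (EuclideanSpace.single j 1)
  rw [← hp.2]
  refine integral_congr_ae ?_
  filter_upwards [h.ae_eq, h.weakPartial_ae_eq j] with x h1 h2
  rw [fderiv_pairing hY M h.contDiff h.contDiff]
  simp only [productDensity, pairing, magneticPartial, h1, h2, partialDeriv, map_sub, map_smul,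
    inner_sub_left, inner_sub_right, inner_smul_left, inner_smul_right, map_mul, Complex.conj_I,
    Complex.conj_ofReal]
  ring

/-- In ∂_j(Y⟨W, M∂_kW⟩) - ∂_k(Y⟨W, M∂_jW⟩) the second derivatives cancel by symmetry. The terms
quadratic in A cancel as well, and the linear ones assemble into the distributional definition of
B_jk tested with Y⟨W, MW⟩. -/
theorem IsSmoothRep.integral_commutatorDensity {w : sobolevH1 d} {W : Space d → Spinor d}
    (h : IsSmoothRep w W) {A : Space d → Space d}
    {B : Space d → Matrix (Fin d) (Fin d) ℝ} (hAB : IsMagneticField A B)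
    (hA : ∀ j, LocallyIntegrable fun x => A x j) (hB : ∀ j k, LocallyIntegrable fun x => B x j k)
    {Y : Space d → ℝ} (hY : ContDiff ℝ ∞ Y)
    (hc : HasCompactSupport Y) (M : Spinor d →L[ℂ] Spinor d) (j k : Fin d) :
    ∫ x, commutatorDensity A B Y M j k w x = 0 := by
  have hd : ∀ e, ContDiff ℝ ∞ fun x => fderiv ℝ W x e := fun e =>
    (h.contDiff.fderiv_right (by simp)).clm_apply contDiff_const
  have hp : ∀ a b : Fin d, _ := fun a b => integral_fderiv_apply_eq_zero
    ((hY.pairing M h.contDiff (hd (EuclideanSpace.single b 1))).of_le (by simp))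
    (hasCompactSupport_pairing hc M W _) (EuclideanSpace.single a 1)
  have hF := hY.pairing M h.contDiff h.contDiff
  have hFc := hasCompactSupport_pairing hc M W W
  obtain ⟨i1, i2, e⟩ := hAB.integral_complex hA hB j k hF hFc
  have key : ∀ᵐ x, commutatorDensity A B Y M j k w x =
      (fderiv ℝ (pairing Y M W fun x => fderiv ℝ W x (EuclideanSpace.single k 1)) x
        (EuclideanSpace.single j 1)
      - fderiv ℝ (pairing Y M W fun x => fderiv ℝ W x (EuclideanSpace.single j 1)) x
        (EuclideanSpace.single k 1))
      - Complex.I * ((fderiv ℝ (pairing Y M W W) x (EuclideanSpace.single j 1) * A x k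
      - fderiv ℝ (pairing Y M W W) x (EuclideanSpace.single k 1) * A x j)
        + pairing Y M W W x * B x j k) := by
    filter_upwards [h.ae_eq, h.weakPartial_ae_eq j, h.weakPartial_ae_eq k] with x h1 h2 h3
    have hdd : ∀ e e', fderiv ℝ (fun x => fderiv ℝ W x e) x e' = fderiv ℝ (fderiv ℝ W) x e' e := by
      intro e e'
      have : HasFDerivAt (fderiv ℝ W) (fderiv ℝ (fderiv ℝ W) x) x :=
        ((h.contDiff.fderiv_right (m := ∞) (by simp)).differentiable (by simp) x).hasFDerivAt
      rw [(this.clm_apply (hasFDerivAt_const e x)).fderiv]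
      simp
    have hsymm : fderiv ℝ (fderiv ℝ W) x (EuclideanSpace.single j 1) (EuclideanSpace.single k 1)
        = fderiv ℝ (fderiv ℝ W) x (EuclideanSpace.single k 1) (EuclideanSpace.single j 1) :=
      ((contDiff_infty.1 h.contDiff 2).contDiffAt.isSymmSndFDerivAt (by simp)).eq _ _
    rw [fderiv_pairing hY M h.contDiff (hd _), fderiv_pairing hY M h.contDiff (hd _),
      fderiv_pairing hY M h.contDiff h.contDiff, fderiv_pairing hY M h.contDiff h.contDiff,
      hdd, hdd, hsymm]
    simp only [commutatorDensity, pairing, magneticPartial, h1, h2, h3, partialDeriv, map_sub,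
      map_smul, inner_sub_left, inner_sub_right, inner_smul_left, inner_smul_right, map_mul,
      Complex.conj_I, Complex.conj_ofReal]
    ring_nf
  rw [integral_congr_ae key, integral_sub (by exact (hp j k).1.sub (hp k j).1)
      (by exact (i2.add i1).const_mul _),
    integral_sub (hp j k).1 (hp k j).1, (hp j k).2, (hp k j).2, integral_const_mul,
    integral_add i2 i1, e]
  simp

end SmoothIdentities

/-! ### Extension of the identities to H¹ -/

section SobolevIdentities

variable {d : ℕ}

theorem integrable_pairing {Y : Space d → ℝ} (hY : Continuous Y) (hc : HasCompactSupport Y)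
    (M : Spinor d →L[ℂ] Spinor d) {f g : Space d → Spinor d} (hf : MemLp f 2 volume)
    (hg : MemLp g 2 volume) : Integrable (pairing Y M f g) := by
  obtain ⟨C, hC⟩ := hY.bounded_above_of_compact_support hc
  have hMg : MemLp (fun x => M (g x)) 2 volume := M.comp_memLp' hg
  have h1 : Integrable fun x => inner ℂ (f x) (M (g x)) := by
    refine (L2.integrable_inner (𝕜 := ℂ) (hf.toLp f) (hMg.toLp _)).congr ?_
    filter_upwards [hf.coeFn_toLp, hMg.coeFn_toLp] with x e1 e2
    rw [e1, e2]
  exact h1.bdd_mul (c := C) (Complex.continuous_ofReal.comp hY).aestronglyMeasurable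
    (ae_of_all _ fun x => by simpa using hC x)

/-- Since Y is bounded, Y and M act as bounded operators on L², and the integral becomes a jointly
continuous inner product. -/
theorem tendsto_integral_pairing {Y : Space d → ℝ} (hY : Continuous Y) (hc : HasCompactSupport Y)
    (M : Spinor d →L[ℂ] Spinor d) {f g : ℕ → SpinorL2 d} {f₀ g₀ : SpinorL2 d}
    (hf : Tendsto f atTop (𝓝 f₀)) (hg : Tendsto g atTop (𝓝 g₀)) :
    Tendsto (fun n => ∫ x, pairing Y M (f n) (g n) x) atTop (𝓝 (∫ x, pairing Y M f₀ g₀ x)) := by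
  have hm : MemLp Y ⊤ (volume : Measure (Space d)) := hY.memLp_of_hasCompactSupport hc
  let T := (ContinuousLinearMap.lsmul ℝ ℝ : ℝ →L[ℝ] Spinor d →L[ℝ] Spinor d).holderL
    (volume : Measure (Space d)) ⊤ 2 2 (hm.toLp Y)
  have hT : ∀ h : SpinorL2 d, T h =ᵐ[volume] fun x => Y x • h x := fun h => by
    filter_upwards [ContinuousLinearMap.coeFn_holder (r := 2)
      (ContinuousLinearMap.lsmul ℝ ℝ : ℝ →L[ℝ] Spinor d →L[ℝ] Spinor d) (hm.toLp Y) h,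
      hm.coeFn_toLp] with x h1 h2
    have h1' : T h x = (hm.toLp Y) x • h x := h1
    rw [h1', h2]
  have e : ∀ h k : SpinorL2 d, ∫ x, pairing Y M h k x = inner ℂ (T h) (M.compLp k) := by
    intro h k
    rw [L2.inner_def]
    refine integral_congr_ae ?_
    filter_upwards [hT h, M.coeFn_compLp k] with x h1 h2
    rw [h1, h2, pairing, ← Complex.coe_smul, inner_smul_left, Complex.conj_ofReal]
  simp only [e]
  exact ((T.continuous.tendsto _).comp hf).inner
    (((M.compLpL 2 volume).continuous.tendsto _).comp hg)

section

variable {A : Space d → Space d}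

/-- The magnetic derivative `∂_j^A` as an operator from `H¹` to `L²`. -/
noncomputable def magneticL2 {j : Fin d}
    (ha : ∀ ψ : sobolevH1 d, MemLp (fun x => A x j • (ψ : SpinorL2 d) x) 2 volume) :
    sobolevH1 d →ₗ[ℂ] SpinorL2 d := weakPartial j - Complex.I • mulH1 ha

theorem coeFn_magneticL2 {j : Fin d}
    (ha : ∀ ψ : sobolevH1 d, MemLp (fun x => A x j • (ψ : SpinorL2 d) x) 2 volume)
    (ψ : sobolevH1 d) : magneticL2 ha ψ =ᵐ[volume] magneticPartial A j ψ := by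
  filter_upwards [Lp.coeFn_sub (weakPartial j ψ) (Complex.I • mulH1 ha ψ),
    Lp.coeFn_smul Complex.I (mulH1 ha ψ), coeFn_mulH1 ha ψ] with x h1 h2 h3
  have h1' : magneticL2 ha ψ x = weakPartial j ψ x - (Complex.I • mulH1 ha ψ : SpinorL2 d) x := h1
  rw [h1', h2, Pi.smul_apply, h3, magneticPartial, mul_smul, Complex.coe_smul]

theorem memLp_magneticPartial {j : Fin d}
    (ha : ∀ ψ : sobolevH1 d, MemLp (fun x => A x j • (ψ : SpinorL2 d) x) 2 volume)
    (ψ : sobolevH1 d) : MemLp (magneticPartial A j ψ) 2 volume :=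
  (memLp_congr_ae (coeFn_magneticL2 ha ψ)).1 (Lp.memLp _)

theorem tendsto_magneticL2 {j : Fin d}
    (ha : ∀ ψ : sobolevH1 d, MemLp (fun x => A x j • (ψ : SpinorL2 d) x) 2 volume)
    {w : ℕ → sobolevH1 d} {ψ : sobolevH1 d}
    (h : Tendsto (fun n => (w n : SpinorL2 d)) atTop (𝓝 ψ))
    (h' : ∀ j, Tendsto (fun n => weakPartial j (w n)) atTop (𝓝 (weakPartial j ψ))) :
    Tendsto (fun n => magneticL2 ha (w n)) atTop (𝓝 (magneticL2 ha ψ)) :=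
  (h' j).sub ((tendsto_mulH1 ha h h').const_smul Complex.I)

theorem integral_pairing_congr {Y : Space d → ℝ} {M : Spinor d →L[ℂ] Spinor d}
    {f f' g g' : Space d → Spinor d} (hf : f =ᵐ[volume] f') (hg : g =ᵐ[volume] g') :
    ∫ x, pairing Y M f g x = ∫ x, pairing Y M f' g' x := by
  refine integral_congr_ae ?_
  filter_upwards [hf, hg] with x h1 h2
  simp only [pairing, h1, h2]

/-- The product rule for the magnetic derivative, in integrated form. -/
theorem integral_productDensity {j : Fin d}
    (ha : ∀ ψ : sobolevH1 d, MemLp (fun x => A x j • (ψ : SpinorL2 d) x) 2 volume)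
    {Y : Space d → ℝ} (hY : ContDiff ℝ ∞ Y) (hc : HasCompactSupport Y)
    (M : Spinor d →L[ℂ] Spinor d) (ψ : sobolevH1 d) :
    Integrable (productDensity A Y M j ψ) ∧ ∫ x, productDensity A Y M j ψ x = 0 := by
  have hd := continuous_partialDeriv j hY
  have hdc := hasCompactSupport_partialDeriv j hc
  have i1 := fun φ : sobolevH1 d => integrable_pairing hd hdc M (Lp.memLp (φ : SpinorL2 d))
    (Lp.memLp (φ : SpinorL2 d))
  have i2 := fun φ : sobolevH1 d => integrable_pairing hY.continuous hc M
    (memLp_magneticPartial ha φ) (Lp.memLp (φ : SpinorL2 d))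
  have i3 := fun φ : sobolevH1 d => integrable_pairing hY.continuous hc M
    (Lp.memLp (φ : SpinorL2 d)) (memLp_magneticPartial ha φ)
  refine ⟨((i1 ψ).add (i2 ψ)).add (i3 ψ), ?_⟩
  have e : ∀ φ : sobolevH1 d, ∫ x, productDensity A Y M j φ x
      = (∫ x, pairing (partialDeriv j Y) M (φ : SpinorL2 d) (φ : SpinorL2 d) x)
        + (∫ x, pairing Y M (magneticL2 ha φ) (φ : SpinorL2 d) x)
        + ∫ x, pairing Y M (φ : SpinorL2 d) (magneticL2 ha φ) x := by
    intro φ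
    rw [integral_pairing_congr (coeFn_magneticL2 ha φ) EventuallyEq.rfl,
      integral_pairing_congr EventuallyEq.rfl (coeFn_magneticL2 ha φ),
      ← integral_add (i1 φ) (i2 φ), ← integral_add (by exact (i1 φ).add (i2 φ)) (i3 φ)]
    rfl
  -- Every term is continuous for H¹ convergence, so the identity for smooth functions survives in
  -- the limit.
  obtain ⟨w, W, hW, h, h'⟩ := exists_seq_isSmoothRep ψ
  have hm := tendsto_magneticL2 ha h h'
  have hlim := ((tendsto_integral_pairing hd hdc M h h).add
    (tendsto_integral_pairing hY.continuous hc M hm h)).add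
    (tendsto_integral_pairing hY.continuous hc M h hm)
  rw [e]
  refine tendsto_nhds_unique hlim ?_
  simp only [← e, (hW _).integral_productDensity A hY hc M j]
  exact tendsto_const_nhds

/-- Admits weights that are smooth only off the origin, such as |x|⁻¹ or powers of f, once
multiplied by a cutoff vanishing near 0. -/
theorem ContDiff.mul_of_zero_notMem_tsupport {Y g : Space d → ℝ} (hY : ContDiff ℝ ∞ Y)
    (h0 : (0 : Space d) ∉ tsupport Y) (hg : ContDiffOn ℝ ∞ g {0}ᶜ) :
    ContDiff ℝ ∞ fun x => Y x * g x := by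
  refine contDiff_iff_contDiffAt.2 fun x => ?_
  by_cases hx : x = 0
  · rw [hx]
    have : (fun x => Y x * g x) =ᶠ[𝓝 0] fun _ => 0 := by
      filter_upwards [(isClosed_tsupport Y).isOpen_compl.mem_nhds h0] with y hy
      rw [image_eq_zero_of_notMem_tsupport hy, zero_mul]
    exact contDiffAt_const.congr_of_eventuallyEq this
  · exact hY.contDiffAt.mul (hg.contDiffAt (isOpen_compl_singleton.mem_nhds hx))

theorem contDiffOn_norm_inv : ContDiffOn ℝ ∞ (fun x : Space d => ‖x‖⁻¹) {0}ᶜ := fun _ hx =>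
  ((contDiffAt_norm ℝ hx).inv (norm_ne_zero_iff.2 hx)).contDiffWithinAt

/-- The commutator identity for two magnetic derivatives, in integrated form. -/
theorem integral_commutatorDensity {B : Space d → Matrix (Fin d) (Fin d) ℝ}
    (ha : ∀ j (ψ : sobolevH1 d), MemLp (fun x => A x j • (ψ : SpinorL2 d) x) 2 volume)
    (hAB : IsMagneticField A B)
    (hA : ∀ j, LocallyIntegrable fun x => A x j) (hB : ∀ j k, LocallyIntegrable fun x => B x j k)
    (hb : ∀ j k (ψ : sobolevH1 d),
      MemLp (fun x => (‖x‖ * B x j k) • (ψ : SpinorL2 d) x) 2 volume)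
    {Y : Space d → ℝ} (hY : ContDiff ℝ ∞ Y) (hc : HasCompactSupport Y)
    (h0 : (0 : Space d) ∉ tsupport Y)
    (M : Spinor d →L[ℂ] Spinor d) (j k : Fin d) (ψ : sobolevH1 d) :
    Integrable (commutatorDensity A B Y M j k ψ) ∧
      ∫ x, commutatorDensity A B Y M j k ψ x = 0 := by
  have hdj := continuous_partialDeriv j hY
  have hdcj := hasCompactSupport_partialDeriv j hc
  have hdk := continuous_partialDeriv k hY
  have hdck := hasCompactSupport_partialDeriv k hc
  have hZ : Continuous fun x => Y x * ‖x‖⁻¹ :=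
    (hY.mul_of_zero_notMem_tsupport h0 contDiffOn_norm_inv).continuous
  have hZc : HasCompactSupport fun x => Y x * ‖x‖⁻¹ := hc.mul_right
  have i1 := fun (φ : sobolevH1 d) (a b : Fin d) => integrable_pairing hY.continuous hc M
    (memLp_magneticPartial (ha a) φ) (memLp_magneticPartial (ha b) φ)
  have i3 := fun φ : sobolevH1 d => integrable_pairing hdj hdcj M
    (Lp.memLp (φ : SpinorL2 d)) (memLp_magneticPartial (ha k) φ)
  have i4 := fun φ : sobolevH1 d => integrable_pairing hdk hdck M
    (Lp.memLp (φ : SpinorL2 d)) (memLp_magneticPartial (ha j) φ)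
  -- Only |x|B_jk is known to map H¹ into L², so the missing factor |x|⁻¹ is absorbed in Y, which
  -- vanishes near the origin.
  have hpt : ∀ (φ : sobolevH1 d) x,
      pairing (fun x => Y x * ‖x‖⁻¹) M (fun x => (‖x‖ * B x j k) • (φ : SpinorL2 d) x)
        (φ : SpinorL2 d) x
      = B x j k * pairing Y M (φ : SpinorL2 d) (φ : SpinorL2 d) x := by
    intro φ x
    simp only [pairing]
    by_cases hx : x = 0
    · have : Y x = 0 := image_eq_zero_of_notMem_tsupport (by rwa [hx])
      simp [this]
    · have : (‖x‖ : ℂ) ≠ 0 := by simpa using hx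
      rw [← Complex.coe_smul, inner_smul_left, Complex.conj_ofReal]
      push_cast
      field_simp
  have i5 : ∀ φ : sobolevH1 d, Integrable fun x =>
      (B x j k : ℂ) * pairing Y M (φ : SpinorL2 d) (φ : SpinorL2 d) x := by
    intro φ
    refine (integrable_pairing hZ hZc M (hb j k φ) (Lp.memLp (φ : SpinorL2 d))).congr ?_
    exact ae_of_all _ (hpt φ)
  refine ⟨((((i1 ψ j k).sub (i1 ψ k j)).add (i3 ψ)).sub (i4 ψ)).sub
    ((i5 ψ).const_mul Complex.I), ?_⟩
  have e : ∀ φ : sobolevH1 d, ∫ x, commutatorDensity A B Y M j k φ x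
      = (∫ x, pairing Y M (magneticL2 (ha j) φ) (magneticL2 (ha k) φ) x)
        - (∫ x, pairing Y M (magneticL2 (ha k) φ) (magneticL2 (ha j) φ) x)
        + (∫ x, pairing (partialDeriv j Y) M (φ : SpinorL2 d) (magneticL2 (ha k) φ) x)
        - (∫ x, pairing (partialDeriv k Y) M (φ : SpinorL2 d) (magneticL2 (ha j) φ) x)
        - Complex.I * ∫ x, pairing (fun x => Y x * ‖x‖⁻¹) M (mulH1 (hb j k) φ)
            (φ : SpinorL2 d) x := by
    intro φ
    rw [integral_pairing_congr (coeFn_magneticL2 (ha j) φ) (coeFn_magneticL2 (ha k) φ),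
      integral_pairing_congr (coeFn_magneticL2 (ha k) φ) (coeFn_magneticL2 (ha j) φ),
      integral_pairing_congr EventuallyEq.rfl (coeFn_magneticL2 (ha k) φ),
      integral_pairing_congr EventuallyEq.rfl (coeFn_magneticL2 (ha j) φ),
      integral_pairing_congr (coeFn_mulH1 (hb j k) φ) EventuallyEq.rfl,
      ← integral_sub (i1 φ j k) (i1 φ k j),
      ← integral_add (by exact (i1 φ j k).sub (i1 φ k j)) (i3 φ),
      ← integral_sub (by exact ((i1 φ j k).sub (i1 φ k j)).add (i3 φ)) (i4 φ),
      integral_congr_ae (ae_of_all _ (hpt φ)), ← integral_const_mul,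
      ← integral_sub (by exact (((i1 φ j k).sub (i1 φ k j)).add (i3 φ)).sub (i4 φ))
        ((i5 φ).const_mul _)]
    rfl
  obtain ⟨w, W, hW, h, h'⟩ := exists_seq_isSmoothRep ψ
  have hm := fun j => tendsto_magneticL2 (ha j) h h'
  have hlim := ((((tendsto_integral_pairing hY.continuous hc M (hm j) (hm k)).sub
    (tendsto_integral_pairing hY.continuous hc M (hm k) (hm j))).add
    (tendsto_integral_pairing hdj hdcj M h (hm k))).sub
    (tendsto_integral_pairing hdk hdck M h (hm j))).sub
    ((tendsto_integral_pairing hZ hZc M (tendsto_mulH1 (hb j k) h h') h).const_mul Complex.I)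
  rw [e]
  refine tendsto_nhds_unique hlim ?_
  simp only [← e, (hW _).integral_commutatorDensity hAB hA hB hY hc M j k]
  exact tendsto_const_nhds

end

end SobolevIdentities

/-! ### Clifford algebra and matrix norms -/

section Clifford

variable {d : ℕ} {α : Fin d → SpinMatrix d} {β : SpinMatrix d}

theorem IsDiracMatrices.inner_act (h : IsDiracMatrices α β) (j : Fin d) (u w : Spinor d) :
    inner ℂ ((α j).act u) w = inner ℂ u ((α j).act w) := by
  have e : star ((α j).act) = (α j).act := by
    rw [SpinMatrix.act, ← map_star, Matrix.star_eq_conjTranspose, (h.hermitian_alpha j).eq]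
  rw [← ContinuousLinearMap.adjoint_inner_right, ← ContinuousLinearMap.star_eq_adjoint, e]

theorem IsDiracMatrices.act_act (h : IsDiracMatrices α β) (j k : Fin d) (u : Spinor d) :
    (α j).act ((α k).act u) = (if j = k then (2 : ℂ) else 0) • u - (α k).act ((α j).act u) := by
  rw [eq_sub_iff_add_eq]
  have e := congrArg (fun M : SpinMatrix d => M.act u) (h.anticomm_alpha j k)
  simp only [SpinMatrix.act, map_add, map_mul, add_apply,
    mul_apply_eq_comp] at e
  rw [e]
  split_ifs with hjk
  · have : (2 : SpinMatrix d) = (2 : ℂ) • 1 := by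
      rw [two_smul, one_add_one_eq_two]
    rw [this, map_smul, map_one]
    rfl
  · simp

/-- The Clifford action `∑ a_j α_j` of a real vector on spinors. -/
noncomputable def cliffordAct (α : Fin d → SpinMatrix d) (a : Fin d → ℝ) (u : Spinor d) :
    Spinor d := ∑ j, (a j : ℂ) • (α j).act u

/-- Symmetrizing the double sum in j and k, anticommutation removes every off-diagonal term. Because
this is an equality, the Clifford factors in the later estimates cost no constants. -/
theorem IsDiracMatrices.norm_cliffordAct_sq (h : IsDiracMatrices α β) (a : Fin d → ℝ)
    (u : Spinor d) : ‖cliffordAct α a u‖ ^ 2 = (∑ j, a j ^ 2) * ‖u‖ ^ 2 := by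
  have e1 : inner ℂ (cliffordAct α a u) (cliffordAct α a u)
      = ∑ j, ∑ k, (a j : ℂ) * a k * inner ℂ u ((α j).act ((α k).act u)) := by
    simp only [cliffordAct, sum_inner, inner_sum, inner_smul_left, inner_smul_right,
      Complex.conj_ofReal, h.inner_act]
    simp only [Finset.mul_sum]
    rw [Finset.sum_comm]
    exact Finset.sum_congr rfl fun j _ => Finset.sum_congr rfl fun k _ => by ring
  have e2 : ∑ j, ∑ k, (a j : ℂ) * a k * inner ℂ u ((α j).act ((α k).act u))
      = 2 * (∑ j, (a j : ℂ) ^ 2) * inner ℂ u u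
        - ∑ j, ∑ k, (a j : ℂ) * a k * inner ℂ u ((α j).act ((α k).act u)) := by
    conv_rhs => rw [Finset.sum_comm]
    rw [eq_sub_iff_add_eq, ← Finset.sum_add_distrib]
    have : ∀ j, ∑ k, (a j : ℂ) * a k * inner ℂ u ((α j).act ((α k).act u))
        + ∑ k, (a k : ℂ) * a j * inner ℂ u ((α k).act ((α j).act u))
        = 2 * (a j : ℂ) ^ 2 * inner ℂ u u := by
      intro j
      rw [← Finset.sum_add_distrib]
      have : ∀ k, (a j : ℂ) * a k * inner ℂ u ((α j).act ((α k).act u))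
          + (a k : ℂ) * a j * inner ℂ u ((α k).act ((α j).act u))
          = if j = k then 2 * (a j : ℂ) ^ 2 * inner ℂ u u else 0 := by
        intro k
        rw [h.act_act j k, inner_sub_right, inner_smul_right]
        split_ifs with hjk
        · subst hjk
          ring
        · ring
      simp [this]
    rw [Finset.sum_congr rfl fun j _ => this j, Finset.mul_sum, Finset.sum_mul]
  rw [← e1] at e2
  have e3 : inner ℂ (cliffordAct α a u) (cliffordAct α a u)
      = (∑ j, (a j : ℂ) ^ 2) * inner ℂ u u := by linear_combination (1 / 2 : ℂ) * e2
  rw [inner_self_eq_norm_sq_to_K, inner_self_eq_norm_sq_to_K] at e3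
  apply Complex.ofReal_injective
  push_cast
  exact e3

theorem IsDiracMatrices.norm_cliffordAct (h : IsDiracMatrices α β) (a : Fin d → ℝ)
    (u : Spinor d) : ‖cliffordAct α a u‖ = √(∑ j, a j ^ 2) * ‖u‖ := by
  rw [← Real.sqrt_sq (norm_nonneg (cliffordAct α a u)), h.norm_cliffordAct_sq,
    Real.sqrt_mul (Finset.sum_nonneg fun _ _ => sq_nonneg _), Real.sqrt_sq (norm_nonneg u)]

theorem IsDiracMatrices.norm_act (h : IsDiracMatrices α β) (j : Fin d) (u : Spinor d) :
    ‖(α j).act u‖ = ‖u‖ := by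
  have e : cliffordAct α (Pi.single j 1) u = (α j).act u := by
    rw [cliffordAct, Finset.sum_eq_single j]
    · simp
    · intro k _ hk
      simp [hk]
    · simp
  rw [← e, h.norm_cliffordAct, Finset.sum_eq_single j]
  · simp
  · intro k _ hk
    simp [hk]
  · simp

theorem norm_sum_smul_le (a : Fin d → ℝ) (p : Fin d → Spinor d) :
    ‖∑ k, (a k : ℂ) • p k‖ ≤ √(∑ k, a k ^ 2) * √(∑ k, ‖p k‖ ^ 2) := by
  refine (norm_sum_le _ _).trans ?_
  have := Real.sum_mul_le_sqrt_mul_sqrt Finset.univ (fun k => |a k|) fun k => ‖p k‖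
  simpa [norm_smul] using this

theorem matrixOpNorm_nonneg (M : Matrix (Fin d) (Fin d) ℝ) : 0 ≤ matrixOpNorm M := norm_nonneg _

theorem sqrt_sum_mulVec_sq_le (M : Matrix (Fin d) (Fin d) ℝ) (x : Space d) :
    √(∑ j, (∑ k, M j k * x k) ^ 2) ≤ matrixOpNorm M * ‖x‖ := by
  have h := (Matrix.toEuclideanCLM (𝕜 := ℝ) M).le_opNorm x
  rw [EuclideanSpace.norm_eq (Matrix.toEuclideanCLM (𝕜 := ℝ) M x)] at h
  simpa [Matrix.mulVec, dotProduct, matrixOpNorm] using h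

/-- Apply M to its own j-th row r: the j-th entry of the result is |r|², hence |r|² ≤ |M||r|. -/
theorem sqrt_sum_row_sq_le (M : Matrix (Fin d) (Fin d) ℝ) (j : Fin d) :
    √(∑ k, M j k ^ 2) ≤ matrixOpNorm M := by
  set r : Space d := WithLp.toLp 2 (M j) with hr
  have hn : ‖r‖ = √(∑ k, M j k ^ 2) := by simp [EuclideanSpace.norm_eq, hr]
  have h1 := sqrt_sum_mulVec_sq_le M r
  have h2 : ‖r‖ ^ 2 ≤ √(∑ i, (∑ k, M i k * r k) ^ 2) := by
    refine Real.le_sqrt_of_sq_le ?_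
    have e : ‖r‖ ^ 2 = ∑ k, M j k * r k := by
      rw [EuclideanSpace.real_norm_sq_eq]
      exact Finset.sum_congr rfl fun k _ => sq (r k)
    rw [e]
    exact Finset.single_le_sum (f := fun i => (∑ k, M i k * r k) ^ 2)
      (fun _ _ => sq_nonneg _) (Finset.mem_univ j)
  rw [← hn]
  have h0 := matrixOpNorm_nonneg M
  by_contra hlt
  push Not at hlt
  nlinarith [norm_nonneg r]

theorem abs_entry_le (M : Matrix (Fin d) (Fin d) ℝ) (j k : Fin d) :
    |M j k| ≤ matrixOpNorm M := by
  refine le_trans ?_ (sqrt_sum_row_sq_le M j)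
  rw [← Real.sqrt_sq_eq_abs]
  exact Real.sqrt_le_sqrt (Finset.single_le_sum (f := fun k => M j k ^ 2)
    (fun _ _ => sq_nonneg _) (Finset.mem_univ k))

/-- The d rows are estimated separately; this is the origin of the factor d in the Lichnerowicz
inequality. -/
theorem IsDiracMatrices.norm_sum_field_le (h : IsDiracMatrices α β)
    (M : Matrix (Fin d) (Fin d) ℝ) (u : Spinor d) :
    ‖∑ j, (α j).act (cliffordAct α (M j) u)‖ ≤ d * (matrixOpNorm M * ‖u‖) := by
  refine (norm_sum_le _ _).trans ?_
  have : ∀ j ∈ Finset.univ, ‖(α j).act (cliffordAct α (M j) u)‖ ≤ matrixOpNorm M * ‖u‖ := by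
    intro j _
    rw [h.norm_act, h.norm_cliffordAct]
    exact mul_le_mul_of_nonneg_right (sqrt_sum_row_sq_le M j) (norm_nonneg u)
  refine (Finset.sum_le_sum this).trans ?_
  simp

theorem sum_partialDeriv_sq (φ : Space d → ℝ) (x : Space d) :
    √(∑ j, partialDeriv j φ x ^ 2) = ‖fderiv ℝ φ x‖ := by
  set g := (InnerProductSpace.toDual ℝ (Space d)).symm (fderiv ℝ φ x) with hg
  have h1 : ‖g‖ = ‖fderiv ℝ φ x‖ := LinearIsometryEquiv.norm_map _ _
  have h2 : ∀ j, partialDeriv j φ x = g j := by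
    intro j
    have : inner ℝ g (EuclideanSpace.single j 1) = fderiv ℝ φ x (EuclideanSpace.single j 1) :=
      InnerProductSpace.toDual_symm_apply
    rw [partialDeriv, ← this]
    simp [EuclideanSpace.inner_single_right]
  simp only [h2]
  rw [← h1, EuclideanSpace.norm_eq]
  simp

/-- The algebraic identity behind the Lichnerowicz formula. -/
theorem IsDiracMatrices.sum_inner_act (h : IsDiracMatrices α β) (p : Fin d → Spinor d) :
    ∑ j, ∑ k, (inner ℂ (p j) ((α j).act ((α k).act (p k)))
      - inner ℂ (p k) ((α j).act ((α k).act (p j))))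
    = 2 * ((‖∑ j, (α j).act (p j)‖ ^ 2 - ∑ j, ‖p j‖ ^ 2 : ℝ) : ℂ) := by
  have e1 : ∑ j, ∑ k, inner ℂ (p j) ((α j).act ((α k).act (p k)))
      = ((‖∑ j, (α j).act (p j)‖ ^ 2 : ℝ) : ℂ) := by
    have := inner_self_eq_norm_sq_to_K (𝕜 := ℂ) (∑ j, (α j).act (p j))
    push_cast
    refine Eq.trans ?_ this
    simp only [sum_inner, inner_sum, h.inner_act]
    rw [Finset.sum_comm]
  -- Exchanging α_j and α_k leaves the diagonal 2∑|p_j|² and minus the square computed in `e1`.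
  have e2 : ∑ j, ∑ k, inner ℂ (p k) ((α j).act ((α k).act (p j)))
      = 2 * ((∑ j, ‖p j‖ ^ 2 : ℝ) : ℂ) - ((‖∑ j, (α j).act (p j)‖ ^ 2 : ℝ) : ℂ) := by
    rw [← e1]
    rw [Finset.sum_comm (f := fun j k => inner ℂ (p j) ((α j).act ((α k).act (p k)))),
      Complex.ofReal_sum, Finset.mul_sum, ← Finset.sum_sub_distrib]
    refine Finset.sum_congr rfl fun j _ => ?_
    simp only [h.act_act j, inner_sub_right, Finset.sum_sub_distrib, inner_smul_right, ite_mul,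
      zero_mul, Finset.sum_ite_eq, Finset.mem_univ, if_true]
    rw [inner_self_eq_norm_sq_to_K]
    simp
  simp only [Finset.sum_sub_distrib]
  rw [e1, e2]
  push_cast
  ring

end Clifford

/-! ### Pointwise Lichnerowicz and virial bounds -/

section PointwiseBounds

variable {d : ℕ} {α : Fin d → SpinMatrix d} {β : SpinMatrix d}

/-- The length `|∇_A ψ|` of the magnetic gradient. -/
noncomputable def magneticGradNorm (A : Space d → Space d) (ψ : sobolevH1 d) (x : Space d) : ℝ :=
  √(∑ j, ‖magneticPartial A j ψ x‖ ^ 2)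

/-- The vector `α · ∇_A ψ`. -/
noncomputable def diracGrad (α : Fin d → SpinMatrix d) (A : Space d → Space d) (ψ : sobolevH1 d)
    (x : Space d) : Spinor d := ∑ j, (α j).act (magneticPartial A j ψ x)

theorem magneticGradNorm_sq (A : Space d → Space d) (ψ : sobolevH1 d) (x : Space d) :
    magneticGradNorm A ψ x ^ 2 = ∑ j, ‖magneticPartial A j ψ x‖ ^ 2 :=
  Real.sq_sqrt (Finset.sum_nonneg fun _ _ => sq_nonneg _)

theorem norm_ofReal_mul_inner_le (c : ℝ) (u w : Spinor d) :
    ‖(c : ℂ) * inner ℂ u w‖ ≤ |c| * (‖u‖ * ‖w‖) := by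
  rw [norm_mul, Complex.norm_real, Real.norm_eq_abs]
  gcongr
  exact norm_inner_le_norm u w

theorem sum_inner_cliffordAct (a : Fin d → ℝ) (u w : Spinor d) :
    ∑ j, (a j : ℂ) * inner ℂ u ((α j).act w) = inner ℂ u (cliffordAct α a w) := by
  simp only [cliffordAct, inner_sum, inner_smul_right]

/-- The Lichnerowicz formula at the level of densities: with M = α_jα_k, summing the quadratic
gradient terms gives 2Y(|α·∇_Aψ|² - |∇_Aψ|²). What is left is the field term and terms carrying ∇Y.
-/
theorem IsDiracMatrices.norm_sum_commutatorDensity_le (h : IsDiracMatrices α β)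
    (A : Space d → Space d) (B : Space d → Matrix (Fin d) (Fin d) ℝ) (Y : Space d → ℝ)
    (ψ : sobolevH1 d) (x : Space d) :
    ‖∑ j, ∑ k, commutatorDensity A B Y ((α j).act.comp (α k).act) j k ψ x
      + ((2 * (Y x * (magneticGradNorm A ψ x ^ 2 - ‖diracGrad α A ψ x‖ ^ 2)) : ℝ) : ℂ)‖
    ≤ d * (|Y x| * (matrixOpNorm (B x) * ‖(ψ : SpinorL2 d) x‖ ^ 2))
      + 2 * (‖fderiv ℝ Y x‖ * (‖(ψ : SpinorL2 d) x‖
        * (‖diracGrad α A ψ x‖ + magneticGradNorm A ψ x))) := by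
  set u := (ψ : SpinorL2 d) x with hu
  set P := diracGrad α A ψ x with hP
  have e1 : ∑ j, ∑ k, (pairing Y ((α j).act.comp (α k).act) (magneticPartial A j ψ)
        (magneticPartial A k ψ) x
      - pairing Y ((α j).act.comp (α k).act) (magneticPartial A k ψ) (magneticPartial A j ψ) x)
      = -((2 * (Y x * (magneticGradNorm A ψ x ^ 2 - ‖P‖ ^ 2)) : ℝ) : ℂ) := by
    have := h.sum_inner_act fun j => magneticPartial A j ψ x
    have e : ∀ j k, pairing Y ((α j).act.comp (α k).act) (magneticPartial A j ψ)
        (magneticPartial A k ψ) x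
      - pairing Y ((α j).act.comp (α k).act) (magneticPartial A k ψ) (magneticPartial A j ψ) x
      = (Y x : ℂ) * (inner ℂ (magneticPartial A j ψ x)
          ((α j).act ((α k).act (magneticPartial A k ψ x)))
        - inner ℂ (magneticPartial A k ψ x)
          ((α j).act ((α k).act (magneticPartial A j ψ x)))) := fun j k => by
      simp only [pairing, ContinuousLinearMap.comp_apply]
      ring
    simp only [e, ← Finset.mul_sum]
    rw [this, magneticGradNorm_sq]
    push_cast
    rw [hP, diracGrad]
    ring
  have e2 : ∑ j, ∑ k, pairing (partialDeriv j Y) ((α j).act.comp (α k).act) (ψ : SpinorL2 d)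
      (magneticPartial A k ψ) x = inner ℂ u (cliffordAct α (fun j => partialDeriv j Y x) P) := by
    rw [← sum_inner_cliffordAct]
    refine Finset.sum_congr rfl fun j _ => ?_
    simp only [pairing, ContinuousLinearMap.comp_apply, ← Finset.mul_sum, hP, diracGrad, map_sum,
      inner_sum]
    rfl
  -- Writing α_jα_k = 2δ_jk - α_kα_j reduces this to the sum in `e2` and a term ∇Y·∇_Aψ free of
  -- matrices.
  have e3 : ∑ j, ∑ k, pairing (partialDeriv k Y) ((α j).act.comp (α k).act) (ψ : SpinorL2 d)
      (magneticPartial A j ψ) x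
      = 2 * inner ℂ u (∑ j, (partialDeriv j Y x : ℂ) • magneticPartial A j ψ x)
        - inner ℂ u (cliffordAct α (fun j => partialDeriv j Y x) P) := by
    rw [← e2, Finset.sum_comm (f := fun j k => pairing (partialDeriv j Y) _ _ _ x), inner_sum,
      Finset.mul_sum, ← Finset.sum_sub_distrib]
    refine Finset.sum_congr rfl fun j _ => ?_
    simp only [pairing, ContinuousLinearMap.comp_apply, h.act_act j, inner_sub_right, mul_sub,
      Finset.sum_sub_distrib, inner_smul_right, ite_mul, mul_ite, zero_mul, mul_zero,
      Finset.sum_ite_eq, Finset.mem_univ, if_true]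
    rw [hu]
    ring
  have e4 : ∑ j, ∑ k, (B x j k : ℂ) * pairing Y ((α j).act.comp (α k).act) (ψ : SpinorL2 d)
      (ψ : SpinorL2 d) x
      = (Y x : ℂ) * inner ℂ u (∑ j, (α j).act (cliffordAct α (B x j) u)) := by
    simp only [inner_sum, Finset.mul_sum, cliffordAct, map_sum, map_smul, inner_smul_right,
      pairing, ContinuousLinearMap.comp_apply]
    exact Finset.sum_congr rfl fun j _ => Finset.sum_congr rfl fun k _ => by ring
  have e : ∑ j, ∑ k, commutatorDensity A B Y ((α j).act.comp (α k).act) j k ψ x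
      + ((2 * (Y x * (magneticGradNorm A ψ x ^ 2 - ‖P‖ ^ 2)) : ℝ) : ℂ)
      = -Complex.I * ((Y x : ℂ) * inner ℂ u (∑ j, (α j).act (cliffordAct α (B x j) u)))
        + (2 * inner ℂ u (cliffordAct α (fun j => partialDeriv j Y x) P)
          - 2 * inner ℂ u (∑ j, (partialDeriv j Y x : ℂ) • magneticPartial A j ψ x)) := by
    simp only [commutatorDensity]
    simp only [Finset.sum_sub_distrib, Finset.sum_add_distrib, ← Finset.mul_sum] at e1 ⊢
    rw [e1, e2, e3, e4]
    ring
  rw [e]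
  have b1 := norm_ofReal_mul_inner_le (Y x) u (∑ j, (α j).act (cliffordAct α (B x j) u))
  have b1' := h.norm_sum_field_le (B x) u
  have b2 : ‖inner ℂ u (cliffordAct α (fun j => partialDeriv j Y x) P)‖
      ≤ ‖u‖ * (‖fderiv ℝ Y x‖ * ‖P‖) := by
    rw [← sum_partialDeriv_sq, ← h.norm_cliffordAct]
    exact norm_inner_le_norm _ _
  have b3 : ‖inner ℂ u (∑ j, (partialDeriv j Y x : ℂ) • magneticPartial A j ψ x)‖
      ≤ ‖u‖ * (‖fderiv ℝ Y x‖ * magneticGradNorm A ψ x) := by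
    refine (norm_inner_le_norm _ _).trans ?_
    gcongr
    rw [← sum_partialDeriv_sq]
    exact norm_sum_smul_le _ _
  have b1'' : |Y x| * (‖u‖ * ‖∑ j, (α j).act (cliffordAct α (B x j) u)‖)
      ≤ |Y x| * (‖u‖ * (d * (matrixOpNorm (B x) * ‖u‖))) := by gcongr
  refine (norm_add_le _ _).trans ?_
  refine (add_le_add_right (norm_sub_le _ _) _).trans ?_
  simp only [norm_mul, norm_neg, Complex.norm_I, one_mul, Complex.norm_ofNat]
  simp only [norm_mul] at b1
  nlinarith

theorem partialDeriv_coord (x : Space d) (k j : Fin d) :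
    partialDeriv j (fun y : Space d => y k) x = if k = j then 1 else 0 := by
  have : HasFDerivAt (fun y : Space d => y k) (EuclideanSpace.proj k : Space d →L[ℝ] ℝ) x :=
    (EuclideanSpace.proj k : Space d →L[ℝ] ℝ).hasFDerivAt
  rw [partialDeriv, this.fderiv]
  simp

theorem partialDeriv_mul {f g : Space d → ℝ} {x : Space d} (hf : DifferentiableAt ℝ f x)
    (hg : DifferentiableAt ℝ g x) (j : Fin d) :
    partialDeriv j (fun y => f y * g y) x = partialDeriv j f x * g x + f x * partialDeriv j g x := by
  have := (hf.hasFDerivAt.mul hg.hasFDerivAt).fderiv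
  rw [partialDeriv]
  erw [this]
  simp
  ring

theorem differentiableAt_coord (x : Space d) (k : Fin d) :
    DifferentiableAt ℝ (fun y : Space d => y k) x :=
  (EuclideanSpace.proj k : Space d →L[ℝ] ℝ).differentiableAt

/-- The pointwise bound behind the virial identity: if `-i α · ∇_A ψ = f ψ` at `x`, then the
combination of commutator and product densities for the fields `f Y x` and `f² Y x` reproduces
`Y f² |ψ|²` up to terms with `∇ f`, `B` and `∇ Y`. -/
theorem IsDiracMatrices.norm_virialDensity_le (h : IsDiracMatrices α β)
    (A : Space d → Space d) (B : Space d → Matrix (Fin d) (Fin d) ℝ) {Y f : Space d → ℝ}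
    (ψ : sobolevH1 d) {x : Space d} (hY : DifferentiableAt ℝ Y x) (hf : DifferentiableAt ℝ f x)
    (heq : diracGrad α A ψ x = (Complex.I * f x) • (ψ : SpinorL2 d) x) :
    ‖(Complex.I * ∑ j, ∑ k, commutatorDensity A B (fun y => Y y * (y k * f y)) (α j).act j k ψ x
      - ∑ j, productDensity A (fun y => Y y * (y j * (f y * f y)))
          (ContinuousLinearMap.id ℂ _) j ψ x)
      + ((Y x * (|f x| * ‖(ψ : SpinorL2 d) x‖) ^ 2 : ℝ) : ℂ)‖
    ≤ |Y x| * (‖x‖ * ‖fderiv ℝ f x‖ * ‖(ψ : SpinorL2 d) x‖ * (|f x| * ‖(ψ : SpinorL2 d) x‖))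
      + |Y x| * (‖x‖ * matrixOpNorm (B x) * ‖(ψ : SpinorL2 d) x‖
          * (|f x| * ‖(ψ : SpinorL2 d) x‖))
      + |Y x| * (‖x‖ * ‖fderiv ℝ f x‖ * ‖(ψ : SpinorL2 d) x‖ * magneticGradNorm A ψ x)
      + ‖x‖ * ‖fderiv ℝ Y x‖ * ((|f x| * ‖(ψ : SpinorL2 d) x‖) * magneticGradNorm A ψ x) := by
  set u := (ψ : SpinorL2 d) x with hu
  set w := ∑ k, (x k : ℂ) • magneticPartial A k ψ x with hw
  have hZ : ∀ j k, partialDeriv j (fun y => Y y * (y k * f y)) x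
      = partialDeriv j Y x * (x k * f x)
        + Y x * ((if k = j then 1 else 0) * f x + x k * partialDeriv j f x) := fun j k => by
    have hkf : DifferentiableAt ℝ (fun y : Space d => y k * f y) x :=
      (differentiableAt_coord x k).mul hf
    rw [partialDeriv_mul hY hkf,
      partialDeriv_mul (differentiableAt_coord x k) hf, partialDeriv_coord]
  have hV : ∀ j, partialDeriv j (fun y => Y y * (y j * (f y * f y))) x
      = partialDeriv j Y x * (x j * (f x * f x))
        + Y x * (f x * f x + 2 * (x j * (f x * partialDeriv j f x))) := fun j => by
    have hff : DifferentiableAt ℝ (fun y : Space d => f y * f y) x := hf.mul hf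
    have hkf : DifferentiableAt ℝ (fun y : Space d => y j * (f y * f y)) x :=
      (differentiableAt_coord x j).mul hff
    rw [partialDeriv_mul hY hkf,
      partialDeriv_mul (differentiableAt_coord x j) hff, partialDeriv_mul hf hf,
      partialDeriv_coord]
    simp only [if_true]
    ring
  have hwu : ∀ z : Spinor d, inner ℂ z w = ∑ k, (x k : ℂ) * inner ℂ z (magneticPartial A k ψ x) :=
    fun z => by simp only [hw, inner_sum, inner_smul_right]
  have hwu' : ∀ z : Spinor d, inner ℂ w z = ∑ k, (x k : ℂ) * inner ℂ (magneticPartial A k ψ x) z :=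
    fun z => by simp only [hw, sum_inner, inner_smul_left, Complex.conj_ofReal]
  -- Here and in `s2` the equation replaces α·∇_Aψ by i f ψ. Together they give -2i Y f² Re⟨ψ,
  -- x·∇_Aψ⟩, which the product rule for the field Y f² x cancels.
  have s1 : ∑ j, ∑ k, pairing (fun y => Y y * (y k * f y)) (α j).act (magneticPartial A j ψ)
      (magneticPartial A k ψ) x = -Complex.I * Y x * f x ^ 2 * inner ℂ u w := by
    have : inner ℂ (diracGrad α A ψ x) w = -Complex.I * f x * inner ℂ u w := by
      rw [heq, inner_smul_left]
      simp
    rw [diracGrad, sum_inner] at this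
    have e : -Complex.I * Y x * f x ^ 2 * inner ℂ u w
        = Y x * f x * (-Complex.I * f x * inner ℂ u w) := by ring
    rw [e, ← this, Finset.mul_sum]
    refine Finset.sum_congr rfl fun j _ => ?_
    rw [hwu, Finset.mul_sum]
    refine Finset.sum_congr rfl fun k _ => ?_
    simp only [pairing, h.inner_act]
    push_cast
    ring
  have s2 : ∑ j, ∑ k, pairing (fun y => Y y * (y k * f y)) (α j).act (magneticPartial A k ψ)
      (magneticPartial A j ψ) x = Complex.I * Y x * f x ^ 2 * inner ℂ w u := by
    have : inner ℂ w (diracGrad α A ψ x) = Complex.I * f x * inner ℂ w u := by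
      rw [heq, inner_smul_right]
    rw [diracGrad, inner_sum] at this
    have e : Complex.I * Y x * f x ^ 2 * inner ℂ w u
        = Y x * f x * (Complex.I * f x * inner ℂ w u) := by ring
    rw [e, ← this, Finset.mul_sum]
    refine Finset.sum_congr rfl fun j _ => ?_
    rw [hwu', Finset.mul_sum]
    refine Finset.sum_congr rfl fun k _ => ?_
    simp only [pairing]
    push_cast
    ring
  have hP : ∑ j, inner ℂ u ((α j).act (magneticPartial A j ψ x))
      = Complex.I * f x * inner ℂ u u := by
    rw [← inner_sum, ← inner_smul_right, ← heq, diracGrad]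
  have hαw : ∀ j, inner ℂ u ((α j).act w)
      = ∑ k, (x k : ℂ) * inner ℂ u ((α j).act (magneticPartial A k ψ x)) := fun j => by
    simp only [hw, map_sum, map_smul, inner_sum, inner_smul_right]
  have s3 : ∑ j, ∑ k, pairing (partialDeriv j fun y => Y y * (y k * f y)) (α j).act
      (ψ : SpinorL2 d) (magneticPartial A k ψ) x
      = f x * inner ℂ u (cliffordAct α (fun j => partialDeriv j Y x) w)
        + Y x * f x * (Complex.I * f x * inner ℂ u u)
        + Y x * inner ℂ u (cliffordAct α (fun j => partialDeriv j f x) w) := by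
    rw [← hP, ← sum_inner_cliffordAct, ← sum_inner_cliffordAct, Finset.mul_sum, Finset.mul_sum,
      Finset.mul_sum, ← Finset.sum_add_distrib, ← Finset.sum_add_distrib]
    refine Finset.sum_congr rfl fun j _ => ?_
    rw [hαw]
    have : ∀ k, pairing (partialDeriv j fun y => Y y * (y k * f y)) (α j).act
        (ψ : SpinorL2 d) (magneticPartial A k ψ) x
        = (f x * partialDeriv j Y x + Y x * partialDeriv j f x)
          * (x k * inner ℂ u ((α j).act (magneticPartial A k ψ x)))
          + if k = j then Y x * f x * inner ℂ u ((α j).act (magneticPartial A k ψ x)) else 0 := by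
      intro k
      simp only [pairing, hZ]
      split_ifs <;> push_cast <;> ring
    simp only [this, Finset.sum_add_distrib, ← Finset.mul_sum, Finset.sum_ite_eq',
      Finset.mem_univ, if_true]
    ring
  -- The sum over k is the divergence of Y f x; it stays unexpanded so that it can be matched with
  -- the one in `s6`.
  have s4 : ∑ j, ∑ k, pairing (partialDeriv k fun y => Y y * (y k * f y)) (α j).act
      (ψ : SpinorL2 d) (magneticPartial A j ψ) x
      = (∑ k, ((partialDeriv k Y x * (x k * f x) + Y x * (f x + x k * partialDeriv k f x) : ℝ) : ℂ))
        * (Complex.I * f x * inner ℂ u u) := by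
    rw [← hP, Finset.sum_mul_sum, Finset.sum_comm]
    refine Finset.sum_congr rfl fun j _ => Finset.sum_congr rfl fun k _ => ?_
    simp only [pairing, hZ, if_true, one_mul]
    rfl
  have s5 : ∑ j, ∑ k, (B x j k : ℂ) * pairing (fun y => Y y * (y k * f y)) (α j).act
      (ψ : SpinorL2 d) (ψ : SpinorL2 d) x
      = Y x * f x * inner ℂ u (cliffordAct α (fun j => ∑ k, B x j k * x k) u) := by
    rw [← sum_inner_cliffordAct, Finset.mul_sum]
    refine Finset.sum_congr rfl fun j _ => ?_
    rw [Complex.ofReal_sum, Finset.sum_mul, Finset.mul_sum]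
    refine Finset.sum_congr rfl fun k _ => ?_
    simp only [pairing]
    push_cast
    rw [hu]
    ring
  have s6 : ∑ j, productDensity A (fun y => Y y * (y j * (f y * f y)))
      (ContinuousLinearMap.id ℂ _) j ψ x
      = (∑ k, ((partialDeriv k Y x * (x k * f x) + Y x * (f x + x k * partialDeriv k f x)
          + Y x * (x k * partialDeriv k f x) : ℝ) : ℂ)) * (f x * inner ℂ u u)
        + Y x * f x ^ 2 * (inner ℂ w u + inner ℂ u w) := by
    rw [hwu, hwu', ← Finset.sum_add_distrib, Finset.sum_mul, Finset.mul_sum,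
      ← Finset.sum_add_distrib]
    refine Finset.sum_congr rfl fun j _ => ?_
    simp only [productDensity, pairing, hV, ContinuousLinearMap.id_apply]
    push_cast
    rw [hu]
    ring
  have huu : inner ℂ u u = (‖u‖ : ℂ) ^ 2 := inner_self_eq_norm_sq_to_K u
  have e : (Complex.I * ∑ j, ∑ k,
        commutatorDensity A B (fun y => Y y * (y k * f y)) (α j).act j k ψ x
      - ∑ j, productDensity A (fun y => Y y * (y j * (f y * f y)))
          (ContinuousLinearMap.id ℂ _) j ψ x)
      + ((Y x * (|f x| * ‖u‖) ^ 2 : ℝ) : ℂ)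
      = -((Y x * f x : ℝ) : ℂ) * ((∑ k, x k * partialDeriv k f x : ℝ) : ℂ) * inner ℂ u u
        + ((Y x * f x : ℝ) : ℂ) * inner ℂ u (cliffordAct α (fun j => ∑ k, B x j k * x k) u)
        + Complex.I * ((Y x : ℂ) * inner ℂ u (cliffordAct α (fun j => partialDeriv j f x) w))
        + Complex.I * ((f x : ℂ) * inner ℂ u (cliffordAct α (fun j => partialDeriv j Y x) w)) := by
    simp only [commutatorDensity]
    simp only [Finset.sum_sub_distrib, Finset.sum_add_distrib, ← Finset.mul_sum]
    have hsplit : ∑ k, ((partialDeriv k Y x * (x k * f x)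
        + Y x * (f x + x k * partialDeriv k f x) + Y x * (x k * partialDeriv k f x) : ℝ) : ℂ)
        = (∑ k, ((partialDeriv k Y x * (x k * f x)
          + Y x * (f x + x k * partialDeriv k f x) : ℝ) : ℂ))
          + Y x * ((∑ k, x k * partialDeriv k f x : ℝ) : ℂ) := by
      rw [Complex.ofReal_sum, Finset.mul_sum, ← Finset.sum_add_distrib]
      exact Finset.sum_congr rfl fun k _ => by push_cast; ring
    rw [s1, s2, s3, s4, s5, s6, hsplit, mul_pow, sq_abs]
    -- The divergence of Y f x cancels between the commutator and product terms, and the dimension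
    -- with it. The surviving -Y f²|ψ|² comes from the diagonal part of ∂_j(x_k f) in `s3`.
    generalize (∑ k, ((partialDeriv k Y x * (x k * f x)
      + Y x * (f x + x k * partialDeriv k f x) : ℝ) : ℂ)) = S
    push_cast
    rw [← huu]
    linear_combination (-(Y x : ℂ) * f x ^ 2 * inner ℂ u w - Y x * f x ^ 2 * inner ℂ w u
      + Y x * f x ^ 2 * inner ℂ u u - S * f x * inner ℂ u u
      - Y x * f x * inner ℂ u (cliffordAct α (fun j => ∑ k, B x j k * x k) u)) * Complex.I_sq
  rw [e]
  have hx : √(∑ k, x k ^ 2) = ‖x‖ := by simp [EuclideanSpace.norm_eq]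
  have hwn : ‖w‖ ≤ ‖x‖ * magneticGradNorm A ψ x := by
    rw [← hx]
    exact norm_sum_smul_le _ _
  have hR : |∑ k, x k * partialDeriv k f x| ≤ ‖x‖ * ‖fderiv ℝ f x‖ := by
    rw [← hx, ← sum_partialDeriv_sq]
    refine (Finset.abs_sum_le_sum_abs _ _).trans ?_
    simpa [abs_mul] using Real.sum_mul_le_sqrt_mul_sqrt Finset.univ (fun k => |x k|)
      fun k => |partialDeriv k f x|
  have b1 : ‖-((Y x * f x : ℝ) : ℂ) * ((∑ k, x k * partialDeriv k f x : ℝ) : ℂ) * inner ℂ u u‖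
      ≤ |Y x| * |f x| * (‖x‖ * ‖fderiv ℝ f x‖) * (‖u‖ * ‖u‖) := by
    rw [norm_mul, norm_mul, norm_neg, Complex.norm_real, Complex.norm_real, Real.norm_eq_abs,
      Real.norm_eq_abs, abs_mul]
    gcongr
    exact norm_inner_le_norm _ _
  have b2 : ‖((Y x * f x : ℝ) : ℂ) * inner ℂ u (cliffordAct α (fun j => ∑ k, B x j k * x k) u)‖
      ≤ |Y x * f x| * (‖u‖ * (matrixOpNorm (B x) * ‖x‖ * ‖u‖)) := by
    refine (norm_ofReal_mul_inner_le _ _ _).trans ?_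
    rw [h.norm_cliffordAct]
    gcongr
    exact sqrt_sum_mulVec_sq_le _ _
  have b3 : ∀ (c : ℝ) (φ : Space d → ℝ),
      ‖Complex.I * ((c : ℂ) * inner ℂ u (cliffordAct α (fun j => partialDeriv j φ x) w))‖
      ≤ |c| * (‖u‖ * (‖fderiv ℝ φ x‖ * (‖x‖ * magneticGradNorm A ψ x))) := fun c φ => by
    rw [norm_mul, Complex.norm_I, one_mul]
    refine (norm_ofReal_mul_inner_le _ _ _).trans ?_
    rw [h.norm_cliffordAct, sum_partialDeriv_sq]
    gcongr
  refine (norm_add_le_of_le (norm_add_le_of_le (norm_add_le_of_le b1 b2) (b3 (Y x) f))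
    (b3 (f x) Y)).trans (le_of_eq ?_)
  rw [abs_mul]
  ring

end PointwiseBounds

/-! ### Scale invariant cutoff functions -/

section Cutoffs

variable {d : ℕ}

/-- A sequence of cutoff functions which exhausts the space without the origin, with the scale
invariant bound `|x| |∇ Y_n| ≤ C`. -/
structure IsCutoffSeq (Y : ℕ → Space d → ℝ) : Prop where
  contDiff : ∀ n, ContDiff ℝ ∞ (Y n)
  hasCompactSupport : ∀ n, HasCompactSupport (Y n)
  nonneg : ∀ n x, 0 ≤ Y n x
  le_one : ∀ n x, Y n x ≤ 1
  bound : ∃ C, ∀ n x, ‖x‖ * ‖fderiv ℝ (Y n) x‖ ≤ C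
  eventuallyEq : ∀ x, x ≠ 0 → ∀ᶠ n in atTop, Y n =ᶠ[𝓝 x] fun _ => 1

/-- The bump function which the cutoff functions are built from. -/
noncomputable def unitBump (d : ℕ) : ContDiffBump (0 : Space d) := ⟨1, 2, by norm_num, by norm_num⟩

/-- The quantity |x||∇χ| is invariant under dilations: for χ(c·) its value at x is at most that of χ
at cx. Hence the bound does not depend on c. -/
theorem exists_norm_mul_fderiv_unitBump_le :
    ∃ C, ∀ (c : ℝ) (x : Space d), ‖x‖ * ‖fderiv ℝ (fun y => unitBump d (c • y)) x‖ ≤ C := by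
  have hs : ContDiff ℝ ∞ (unitBump d) := (unitBump d).contDiff
  have hc : HasCompactSupport fun y : Space d => ‖y‖ * ‖fderiv ℝ (unitBump d) y‖ :=
    ((unitBump d).hasCompactSupport.fderiv ℝ).norm.mul_left
  obtain ⟨C, hC⟩ := Continuous.bounded_above_of_compact_support
    (f := fun y : Space d => ‖y‖ * ‖fderiv ℝ (unitBump d) y‖)
    (continuous_norm.mul (hs.continuous_fderiv (by simp)).norm) hc
  refine ⟨C, fun c x => ?_⟩
  have e : fderiv ℝ (fun y => unitBump d (c • y)) x = c • fderiv ℝ (unitBump d) (c • x) :=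
    fderiv_comp_smul ..
  have := hC (c • x)
  rw [Real.norm_of_nonneg (by positivity), norm_smul] at this
  rw [e, norm_smul]
  linarith

/-- The cutoff functions at infinity. -/
noncomputable def outerCutoff (d : ℕ) (n : ℕ) (x : Space d) : ℝ :=
  unitBump d (((n : ℝ) + 1)⁻¹ • x)

/-- The cutoff functions at the origin. -/
noncomputable def innerCutoff (d : ℕ) (n : ℕ) (x : Space d) : ℝ :=
  1 - unitBump d (((n : ℝ) + 1) • x)

theorem contDiff_unitBump_smul (c : ℝ) : ContDiff ℝ ∞ fun y : Space d => unitBump d (c • y) :=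
  (unitBump d).contDiff.comp (contDiff_const_smul c)

theorem outerCutoff_isCutoffSeq : IsCutoffSeq (outerCutoff d) where
  contDiff n := contDiff_unitBump_smul _
  hasCompactSupport n := (unitBump d).hasCompactSupport.comp_smul (by positivity)
  nonneg n x := (unitBump d).nonneg
  le_one n x := (unitBump d).le_one
  bound := by
    obtain ⟨C, hC⟩ := exists_norm_mul_fderiv_unitBump_le (d := d)
    exact ⟨C, fun n x => hC _ x⟩
  eventuallyEq x hx := by
    obtain ⟨N, hN⟩ := exists_nat_gt ‖x‖
    filter_upwards [eventually_ge_atTop N] with n hn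
    have hn' : (N : ℝ) ≤ n := by exact_mod_cast hn
    filter_upwards [Metric.ball_mem_nhds x one_pos] with y hy
    refine (unitBump d).one_of_mem_closedBall ?_
    have h1 : ‖y‖ < ‖x‖ + 1 := by
      have := norm_sub_norm_le y x
      rw [Metric.mem_ball, dist_eq_norm] at hy
      linarith
    rw [mem_closedBall_zero_iff, norm_smul, Real.norm_of_nonneg (by positivity)]
    rw [inv_mul_le_iff₀ (by positivity)]
    change ‖y‖ ≤ (n + 1) * 1
    linarith

/-- The cutoff functions with support away from the origin and from infinity. -/
noncomputable def annularCutoff (d : ℕ) (n : ℕ) (x : Space d) : ℝ :=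
  innerCutoff d n x * outerCutoff d n x

theorem annularCutoff_isCutoffSeq : IsCutoffSeq (annularCutoff d) where
  contDiff n := (contDiff_const.sub (contDiff_unitBump_smul _)).mul (contDiff_unitBump_smul _)
  hasCompactSupport n := (outerCutoff_isCutoffSeq.hasCompactSupport n).mul_left
  nonneg n x := mul_nonneg (sub_nonneg.2 (unitBump d).le_one) (unitBump d).nonneg
  le_one n x := mul_le_one₀ (sub_le_self _ (unitBump d).nonneg) (unitBump d).nonneg
    (unitBump d).le_one
  bound := by
    obtain ⟨C, hC⟩ := exists_norm_mul_fderiv_unitBump_le (d := d)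
    refine ⟨C + C, fun n x => ?_⟩
    have h1 : HasFDerivAt (innerCutoff d n)
        (-fderiv ℝ (fun y => unitBump d (((n : ℝ) + 1) • y)) x) x :=
      ((contDiff_unitBump_smul _).differentiable (by simp) x).hasFDerivAt.const_sub 1
    have h2 : HasFDerivAt (outerCutoff d n) _ x :=
      ((contDiff_unitBump_smul _).differentiable (by simp) x).hasFDerivAt
    have h3 : HasFDerivAt (annularCutoff d n) _ x := h1.mul h2
    rw [h3.fderiv]
    have b1 : |innerCutoff d n x| ≤ 1 := by
      have : 0 ≤ innerCutoff d n x := sub_nonneg.2 (unitBump d).le_one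
      rw [abs_of_nonneg this]
      exact sub_le_self _ (unitBump d).nonneg
    have b2 : |outerCutoff d n x| ≤ 1 := by
      rw [abs_of_nonneg (outerCutoff_isCutoffSeq.nonneg n x)]
      exact outerCutoff_isCutoffSeq.le_one n x
    have c1 := hC ((n : ℝ) + 1) x
    have c2 := hC ((n : ℝ) + 1)⁻¹ x
    set D1 := fderiv ℝ (fun y => unitBump d (((n : ℝ) + 1) • y)) x
    set D2 := fderiv ℝ (fun y => unitBump d (((n : ℝ) + 1)⁻¹ • y)) x
    have h4 : ‖innerCutoff d n x • D2 + outerCutoff d n x • -D1‖ ≤ ‖D2‖ + ‖D1‖ := by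
      refine (norm_add_le _ _).trans ?_
      rw [norm_smul, norm_smul, norm_neg, Real.norm_eq_abs, Real.norm_eq_abs]
      gcongr
      · exact mul_le_of_le_one_left (norm_nonneg _) b1
      · exact mul_le_of_le_one_left (norm_nonneg _) b2
    calc _ ≤ ‖x‖ * (‖D2‖ + ‖D1‖) := by gcongr
      _ ≤ C + C := by linarith
  eventuallyEq x hx := by
    have hx0 : 0 < ‖x‖ := norm_pos_iff.2 hx
    -- Points y near x satisfy |y| > |x|/2, so n > 4/|x| puts (n+1)y beyond the outer radius 2 of
    -- the bump.
    obtain ⟨N, hN⟩ := exists_nat_gt (4 / ‖x‖)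
    filter_upwards [outerCutoff_isCutoffSeq.eventuallyEq x hx, eventually_ge_atTop N] with n h1 hn
    have hn' : (N : ℝ) ≤ n := by exact_mod_cast hn
    filter_upwards [h1, Metric.ball_mem_nhds x (half_pos hx0)] with y h2 hy
    have h3 : ‖x‖ / 2 < ‖y‖ := by
      have := norm_sub_norm_le x y
      rw [Metric.mem_ball, dist_comm, dist_eq_norm] at hy
      linarith
    have h4 : unitBump d (((n : ℝ) + 1) • y) = 0 := by
      refine (unitBump d).zero_of_le_dist ?_
      rw [dist_zero_right, norm_smul, Real.norm_of_nonneg (by positivity)]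
      change (2 : ℝ) ≤ _
      rw [div_lt_iff₀ hx0] at hN
      nlinarith
    rw [annularCutoff, innerCutoff, h4, h2]
    norm_num

theorem zero_notMem_tsupport_annularCutoff (n : ℕ) :
    (0 : Space d) ∉ tsupport (annularCutoff d n) := by
  rw [notMem_tsupport_iff_eventuallyEq]
  have hn : (0 : ℝ) < ((n : ℝ) + 1)⁻¹ := by positivity
  filter_upwards [Metric.ball_mem_nhds (0 : Space d) hn] with y hy
  have h4 : unitBump d (((n : ℝ) + 1) • y) = 1 := by
    refine (unitBump d).one_of_mem_closedBall ?_
    rw [mem_ball_zero_iff] at hy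
    rw [mem_closedBall_zero_iff, norm_smul, Real.norm_of_nonneg (by positivity)]
    change _ ≤ (1 : ℝ)
    calc ((n : ℝ) + 1) * ‖y‖ ≤ (n + 1) * ((n : ℝ) + 1)⁻¹ := by gcongr
      _ = 1 := mul_inv_cancel₀ (by positivity)
  rw [annularCutoff, innerCutoff, h4]
  simp

variable {Y : ℕ → Space d → ℝ}

theorem IsCutoffSeq.integrable_mul (hY : IsCutoffSeq Y) {h : Space d → ℝ} (hh : Integrable h)
    (n : ℕ) : Integrable fun x => Y n x * h x :=
  hh.bdd_mul (c := 1) (hY.contDiff n).continuous.aestronglyMeasurable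
    (ae_of_all _ fun x => by
      rw [Real.norm_of_nonneg (hY.nonneg n x)]
      exact hY.le_one n x)

theorem IsCutoffSeq.integrable_fderiv_mul (hY : IsCutoffSeq Y) {h : Space d → ℝ}
    (hh : Integrable h) (n : ℕ) : Integrable fun x => ‖x‖ * ‖fderiv ℝ (Y n) x‖ * h x := by
  obtain ⟨C, hC⟩ := hY.bound
  exact hh.bdd_mul (c := C) (continuous_norm.mul
    ((hY.contDiff n).continuous_fderiv (by simp)).norm).aestronglyMeasurable
    (ae_of_all _ fun x => by
      rw [Real.norm_of_nonneg (by positivity)]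
      exact hC n x)

theorem ae_ne_zero (hd : 0 < d) : ∀ᵐ x : Space d, x ≠ 0 := by
  have : Nonempty (Fin d) := ⟨⟨0, hd⟩⟩
  exact (measure_eq_zero_iff_ae_notMem (s := {(0 : Space d)})).1 (measure_singleton _)

theorem IsCutoffSeq.tendsto_integral_mul (hY : IsCutoffSeq Y) (hd : 0 < d) {h : Space d → ℝ}
    (hh : Integrable h) : Tendsto (fun n => ∫ x, Y n x * h x) atTop (𝓝 (∫ x, h x)) := by
  refine tendsto_integral_of_dominated_convergence (fun x => ‖h x‖)
    (fun n => (hY.integrable_mul hh n).1) hh.norm (fun n => ae_of_all _ fun x => ?_) ?_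
  · rw [norm_mul, Real.norm_of_nonneg (hY.nonneg n x)]
    exact mul_le_of_le_one_left (norm_nonneg _) (hY.le_one n x)
  · filter_upwards [ae_ne_zero hd] with x hx
    refine tendsto_const_nhds.congr' ?_
    filter_upwards [hY.eventuallyEq x hx] with n hn
    rw [hn.eq_of_nhds, one_mul]

/-- The factor |x||∇Y_n| is uniformly bounded and eventually vanishes at each x ≠ 0, so dominated
convergence needs only h ∈ L¹, with no decay rate. -/
theorem IsCutoffSeq.tendsto_integral_fderiv_mul (hY : IsCutoffSeq Y) (hd : 0 < d)
    {h : Space d → ℝ} (hh : Integrable h) :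
    Tendsto (fun n => ∫ x, ‖x‖ * ‖fderiv ℝ (Y n) x‖ * h x) atTop (𝓝 0) := by
  obtain ⟨C, hC⟩ := hY.bound
  rw [← integral_zero (Space d) ℝ (μ := volume)]
  refine tendsto_integral_of_dominated_convergence (fun x => C * ‖h x‖)
    (fun n => (hY.integrable_fderiv_mul hh n).1) (hh.norm.const_mul C)
    (fun n => ae_of_all _ fun x => ?_) ?_
  · rw [norm_mul, Real.norm_of_nonneg (by positivity)]
    exact mul_le_mul_of_nonneg_right (hC n x) (norm_nonneg _)
  · filter_upwards [ae_ne_zero hd] with x hx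
    refine tendsto_const_nhds.congr' ?_
    filter_upwards [hY.eventuallyEq x hx] with n hn
    rw [hn.fderiv_eq]
    simp

end Cutoffs

/-! ### From pointwise bounds to integral inequalities -/

section SquareIntegrable

variable {d : ℕ}

theorem integral_mul_le_sqrt_mul_sqrt {a b : Space d → ℝ} (ha : MemLp a 2 volume)
    (hb : MemLp b 2 volume) (ha0 : ∀ x, 0 ≤ a x) (hb0 : ∀ x, 0 ≤ b x) :
    ∫ x, a x * b x ≤ √(∫ x, a x ^ 2) * √(∫ x, b x ^ 2) := by
  have h := integral_mul_le_Lp_mul_Lq_of_nonneg (μ := volume) Real.HolderConjugate.two_two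
    (ae_of_all _ ha0) (ae_of_all _ hb0) (by simpa using ha) (by simpa using hb)
  simpa [Real.sqrt_eq_rpow] using h

theorem memLp_two_of_lintegral_le {a : Space d → ℝ} (ha : AEStronglyMeasurable a volume) {c : ℝ}
    (h : ∫⁻ x, ENNReal.ofReal (a x ^ 2) ≤ ENNReal.ofReal c) :
    MemLp a 2 volume ∧ ∫ x, a x ^ 2 ≤ max c 0 := by
  have hi : Integrable fun x => a x ^ 2 := by
    refine ⟨ha.pow 2, ?_⟩
    rw [hasFiniteIntegral_iff_ofReal (ae_of_all _ fun x => sq_nonneg (a x))]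
    exact h.trans_lt ENNReal.ofReal_lt_top
  refine ⟨(memLp_two_iff_integrable_sq ha).2 hi, ?_⟩
  rw [integral_eq_lintegral_of_nonneg_ae (ae_of_all _ fun x => sq_nonneg (a x)) hi.1]
  exact ENNReal.toReal_le_of_le_ofReal (le_max_right _ _)
    (h.trans (ENNReal.ofReal_le_ofReal (le_max_left _ _)))

/-- A density with zero integral may be added to r at no cost, so the pointwise bounds modulo
commutator and product densities become inequalities between integrals. -/
theorem integral_le_of_norm_add_le {D : Space d → ℂ} {r b : Space d → ℝ} (hD : Integrable D)
    (hD0 : ∫ x, D x = 0) (hr : Integrable r) (hb : Integrable b)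
    (h : ∀ᵐ x, ‖D x + (r x : ℂ)‖ ≤ b x) : ∫ x, r x ≤ ∫ x, b x := by
  have hr' : Integrable fun x => (r x : ℂ) := hr.ofReal
  have e : ((∫ x, r x : ℝ) : ℂ) = ∫ x, (D x + (r x : ℂ)) := by
    rw [integral_add hD hr', hD0, zero_add]
    exact integral_ofReal.symm
  calc ∫ x, r x ≤ ‖((∫ x, r x : ℝ) : ℂ)‖ := by
        rw [Complex.norm_real]
        exact Real.le_norm_self _
    _ ≤ ∫ x, b x := by
        rw [e]
        exact norm_integral_le_of_norm_le hb h

end SquareIntegrable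

/-! ### Hardy type bounds: integrability and the pointwise estimate -/

section Hardy

variable {d : ℕ} {A : Space d → Space d}

theorem aestronglyMeasurable_of_memLpLoc {F : Type*} [NormedAddCommGroup F] {f : Space d → F}
    {p : ENNReal} (h : MemLpLoc f p) : AEStronglyMeasurable f volume := by
  have h1 := (aestronglyMeasurable_iUnion_iff (μ := volume) (f := f)
    (s := fun n : ℕ => Metric.closedBall (0 : Space d) n)).2
    fun n => (h _ (isCompact_closedBall _ _)).1
  rwa [Metric.iUnion_closedBall_nat, Measure.restrict_univ] at h1

theorem locallyIntegrable_of_memLpLoc {F : Type*} [NormedAddCommGroup F] {f : Space d → F}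
    (h : MemLpLoc f 2) : LocallyIntegrable f volume := by
  rw [locallyIntegrable_iff]
  intro K hK
  have : IsFiniteMeasure (volume.restrict K : Measure (Space d)) :=
    ⟨by simpa using hK.measure_lt_top⟩
  exact (h K hK).integrable one_le_two

theorem memLp_magneticGradNorm
    (hp : ∀ j (ψ : sobolevH1 d), MemLp (magneticPartial A j ψ) 2 volume) (ψ : sobolevH1 d) :
    MemLp (magneticGradNorm A ψ) 2 volume ∧
      magneticGradSq A ψ = ENNReal.ofReal (∫ x, magneticGradNorm A ψ x ^ 2) := by
  have hi : ∀ j, Integrable fun x => ‖magneticPartial A j ψ x‖ ^ 2 := fun j =>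
    (memLp_two_iff_integrable_sq_norm (hp j ψ).1).1 (hp j ψ)
  have hm : AEStronglyMeasurable (magneticGradNorm A ψ) volume :=
    Real.continuous_sqrt.comp_aestronglyMeasurable
      (integrable_finsetSum Finset.univ fun j _ => hi j).1
  have hs : Integrable fun x => magneticGradNorm A ψ x ^ 2 := by
    simp only [magneticGradNorm_sq]
    exact integrable_finsetSum Finset.univ fun j _ => hi j
  refine ⟨(memLp_two_iff_integrable_sq hm).2 hs, ?_⟩
  simp only [magneticGradNorm_sq]
  rw [integral_finsetSum _ fun j _ => hi j,
    ENNReal.ofReal_sum_of_nonneg fun j _ => integral_nonneg fun x => sq_nonneg _, magneticGradSq]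
  refine Finset.sum_congr rfl fun j _ => ?_
  rw [ofReal_integral_eq_lintegral_ofReal (hi j) (ae_of_all _ fun x => sq_nonneg _)]
  refine lintegral_congr fun x => ?_
  rw [ENNReal.ofReal_pow (norm_nonneg _), ofReal_norm]

/-- The consequences of a Hardy type inequality for real integrals. -/
theorem HardyBound.memLp {w : Space d → ℝ} {ε : ℝ} (h : HardyBound A w ε)
    (hw : AEStronglyMeasurable w volume)
    (hp : ∀ j (ψ : sobolevH1 d), MemLp (magneticPartial A j ψ) 2 volume) (ψ : sobolevH1 d) :
    MemLp (fun x => ‖x‖ * w x * ‖(ψ : SpinorL2 d) x‖) 2 volume ∧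
      ∫ x, (‖x‖ * w x * ‖(ψ : SpinorL2 d) x‖) ^ 2
        ≤ ε ^ 2 * ∫ x, magneticGradNorm A ψ x ^ 2 := by
  have h0 : 0 ≤ ε ^ 2 * ∫ x, magneticGradNorm A ψ x ^ 2 :=
    mul_nonneg (sq_nonneg _) (integral_nonneg fun x => sq_nonneg _)
  have hm : AEStronglyMeasurable (fun x => ‖x‖ * w x * ‖(ψ : SpinorL2 d) x‖) volume :=
    (continuous_norm.aestronglyMeasurable.mul hw).mul (Lp.memLp (ψ : SpinorL2 d)).1.norm
  rw [← max_eq_left h0]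
  refine memLp_two_of_lintegral_le hm ?_
  have := h ψ
  rw [(memLp_magneticGradNorm hp ψ).2, ← ENNReal.ofReal_mul (sq_nonneg _)] at this
  simpa only [mul_pow] using this

/-- The pointwise bound behind the Hardy inequality. -/
theorem norm_hardyDensity_le (A : Space d → Space d) {Y : Space d → ℝ} (ψ : sobolevH1 d)
    {x : Space d} (hY : DifferentiableAt ℝ Y x) (hY0 : 0 ≤ Y x) {δ : ℝ} (hδ : 0 < δ) :
    ((d : ℝ) - 2) * (Y x * ((‖x‖ ^ 2 + δ)⁻¹ * ‖(ψ : SpinorL2 d) x‖ ^ 2))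
      ≤ (∑ j, productDensity A (fun y => Y y * (y j * (‖y‖ ^ 2 + δ)⁻¹))
          (ContinuousLinearMap.id ℂ _) j ψ x).re
        + ‖x‖ * ‖fderiv ℝ Y x‖ * ((‖x‖ ^ 2 + δ)⁻¹ * ‖(ψ : SpinorL2 d) x‖ ^ 2)
        + 2 * (Y x * ((‖x‖ ^ 2 + δ)⁻¹ * ‖x‖ * (magneticGradNorm A ψ x
          * ‖(ψ : SpinorL2 d) x‖))) := by
  set u := (ψ : SpinorL2 d) x with hu
  set q : Space d → ℝ := fun y => (‖y‖ ^ 2 + δ)⁻¹ with hq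
  have hpos : 0 < ‖x‖ ^ 2 + δ := by positivity
  have hx : √(∑ k, x k ^ 2) = ‖x‖ := by simp [EuclideanSpace.norm_eq]
  have hqd : HasFDerivAt q (-((‖x‖ ^ 2 + δ) ^ 2)⁻¹ • (2 • innerSL ℝ x)) x := by
    have h1 : HasFDerivAt (fun y : Space d => ‖y‖ ^ 2 + δ) (2 • innerSL ℝ x) x :=
      (hasStrictFDerivAt_norm_sq x).hasFDerivAt.add_const δ
    exact (hasDerivAt_inv hpos.ne').comp_hasFDerivAt x h1
  have hqj : ∀ j, partialDeriv j q x = -(2 * x j * q x ^ 2) := by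
    intro j
    rw [partialDeriv, hqd.fderiv]
    simp [EuclideanSpace.inner_single_right, hq]
    ring
  have hZ : ∀ j, partialDeriv j (fun y => Y y * (y j * q y)) x
      = partialDeriv j Y x * x j * q x + Y x * (q x - 2 * x j ^ 2 * q x ^ 2) := fun j => by
    have h1 : DifferentiableAt ℝ (fun y : Space d => y j * q y) x :=
      (differentiableAt_coord x j).mul hqd.differentiableAt
    rw [partialDeriv_mul hY h1, partialDeriv_mul (differentiableAt_coord x j)
      hqd.differentiableAt, partialDeriv_coord, hqj, if_pos rfl]
    ring
  set w := ∑ k, (x k : ℂ) • magneticPartial A k ψ x with hw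
  have hwn : ‖w‖ ≤ ‖x‖ * magneticGradNorm A ψ x := by
    rw [← hx]
    exact norm_sum_smul_le _ _
  have hre : ∀ j, (productDensity A (fun y => Y y * (y j * q y)) (ContinuousLinearMap.id ℂ _) j ψ
      x).re = (x j * partialDeriv j Y x) * (q x * ‖u‖ ^ 2)
        + Y x * (q x - 2 * x j ^ 2 * q x ^ 2) * ‖u‖ ^ 2
        + 2 * (Y x * q x) * (inner ℂ ((x j : ℂ) • magneticPartial A j ψ x) u).re := by
    intro j
    have huu : inner ℂ u u = ((‖u‖ ^ 2 : ℝ) : ℂ) := by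
      push_cast
      exact inner_self_eq_norm_sq_to_K u
    have hsym : (inner ℂ u (magneticPartial A j ψ x)).re
        = (inner ℂ (magneticPartial A j ψ x) u).re :=
      inner_re_symm (𝕜 := ℂ) _ _
    rw [inner_smul_left, Complex.conj_ofReal]
    simp only [productDensity, pairing, ContinuousLinearMap.id_apply, hZ, Complex.add_re,
      Complex.re_ofReal_mul, ← hu, hsym, huu, Complex.ofReal_re]
    ring
  have hsum : (∑ j, productDensity A (fun y => Y y * (y j * q y))
      (ContinuousLinearMap.id ℂ _) j ψ x).re
      = (∑ j, x j * partialDeriv j Y x) * (q x * ‖u‖ ^ 2)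
        + Y x * (d * q x - 2 * ‖x‖ ^ 2 * q x ^ 2) * ‖u‖ ^ 2
        + 2 * (Y x * q x) * (inner ℂ w u).re := by
    rw [Complex.re_sum, Finset.sum_congr rfl fun j _ => hre j, Finset.sum_add_distrib,
      Finset.sum_add_distrib, ← Finset.sum_mul, ← Finset.sum_mul, ← Finset.mul_sum,
      ← Finset.mul_sum, hw, sum_inner, Complex.re_sum, Finset.sum_sub_distrib, ← Finset.sum_mul,
      ← Finset.mul_sum, EuclideanSpace.real_norm_sq_eq x,
      Finset.sum_const, Finset.card_univ, Fintype.card_fin, nsmul_eq_mul]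
  rw [hsum]
  have hR : |∑ k, x k * partialDeriv k Y x| ≤ ‖x‖ * ‖fderiv ℝ Y x‖ := by
    rw [← hx, ← sum_partialDeriv_sq]
    refine (Finset.abs_sum_le_sum_abs _ _).trans ?_
    simpa [abs_mul] using Real.sum_mul_le_sqrt_mul_sqrt Finset.univ (fun k => |x k|)
      fun k => |partialDeriv k Y x|
  have hq0 : 0 < q x := by positivity
  have hq1 : ‖x‖ ^ 2 * q x ≤ 1 := by
    rw [hq]
    simp only
    rw [← div_eq_mul_inv, div_le_one hpos]
    linarith
  have hin : |(inner ℂ w u).re| ≤ ‖x‖ * magneticGradNorm A ψ x * ‖u‖ :=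
    (Complex.abs_re_le_norm _).trans ((norm_inner_le_norm _ _).trans (by gcongr))
  have t1 : -(‖x‖ * ‖fderiv ℝ Y x‖) * (q x * ‖u‖ ^ 2)
      ≤ (∑ k, x k * partialDeriv k Y x) * (q x * ‖u‖ ^ 2) := by
    gcongr
    exact (abs_le.1 hR).1
  have t2 : 2 * (Y x * q x) * -(‖x‖ * magneticGradNorm A ψ x * ‖u‖)
      ≤ 2 * (Y x * q x) * (inner ℂ w u).re := by
    gcongr
    exact (abs_le.1 hin).1
  -- With q = (|x|² + δ)⁻¹, the divergence of x q is dq - 2|x|²q², which is at least (d-2)q because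
  -- |x|²q ≤ 1.
  have t3 : 0 ≤ Y x * ‖u‖ ^ 2 * q x * (1 - ‖x‖ ^ 2 * q x) := by
    have : 0 ≤ 1 - ‖x‖ ^ 2 * q x := by linarith
    positivity
  change _ ≤ _ + ‖x‖ * ‖fderiv ℝ Y x‖ * (q x * ‖u‖ ^ 2)
    + 2 * (Y x * (q x * ‖x‖ * (magneticGradNorm A ψ x * ‖u‖)))
  change ((d : ℝ) - 2) * (Y x * (q x * ‖u‖ ^ 2)) ≤ _
  nlinarith

end Hardy

/-! ### Hardy, Lichnerowicz and virial inequalities -/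

section IntegralInequalities

variable {d : ℕ} {A : Space d → Space d}

theorem sq_sqrt_integral_sq (a : Space d → ℝ) : √(∫ x, a x ^ 2) ^ 2 = ∫ x, a x ^ 2 :=
  Real.sq_sqrt (integral_nonneg fun _ => sq_nonneg _)

/-- The regularized magnetic Hardy inequality. -/
theorem integral_regularized_hardy_le (hd : 3 ≤ d)
    (ha : ∀ j (ψ : sobolevH1 d), MemLp (fun x => A x j • (ψ : SpinorL2 d) x) 2 volume)
    (ψ : sobolevH1 d) {δ : ℝ} (hδ : 0 < δ) :
    Integrable (fun x => (‖x‖ ^ 2 + δ)⁻¹ * ‖(ψ : SpinorL2 d) x‖ ^ 2) ∧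
    ∫ x, (‖x‖ ^ 2 + δ)⁻¹ * ‖(ψ : SpinorL2 d) x‖ ^ 2
      ≤ 4 / ((d : ℝ) - 2) ^ 2 * ∫ x, magneticGradNorm A ψ x ^ 2 := by
  have hd' : (3 : ℝ) ≤ d := by exact_mod_cast hd
  have hd0 : 0 < d := by omega
  have hpos : ∀ x : Space d, 0 < ‖x‖ ^ 2 + δ := fun x => by positivity
  have hqs : ContDiff ℝ ∞ fun x : Space d => (‖x‖ ^ 2 + δ)⁻¹ :=
    ((contDiff_norm_sq ℝ).add contDiff_const).inv fun x => (hpos x).ne'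
  have hp := fun j ψ => memLp_magneticPartial (ha j) ψ
  have hg := (memLp_magneticGradNorm hp ψ).1
  have hU : MemLp (fun x => ‖(ψ : SpinorL2 d) x‖) 2 volume := (Lp.memLp (ψ : SpinorL2 d)).norm
  have hqU : MemLp (fun x => √((‖x‖ ^ 2 + δ)⁻¹) * ‖(ψ : SpinorL2 d) x‖) 2 volume := by
    refine hU.of_le_mul (c := √(δ⁻¹))
      ((Real.continuous_sqrt.comp hqs.continuous).aestronglyMeasurable.mul hU.1)
      (ae_of_all _ fun x => ?_)
    rw [norm_mul, Real.norm_of_nonneg (Real.sqrt_nonneg _)]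
    gcongr
    nlinarith [sq_nonneg ‖x‖]
  have hsq : ∀ x, (√((‖x‖ ^ 2 + δ)⁻¹) * ‖(ψ : SpinorL2 d) x‖) ^ 2
      = (‖x‖ ^ 2 + δ)⁻¹ * ‖(ψ : SpinorL2 d) x‖ ^ 2 := fun x => by
    rw [mul_pow, Real.sq_sqrt (inv_nonneg.2 (hpos x).le)]
  have hi : Integrable fun x => (‖x‖ ^ 2 + δ)⁻¹ * ‖(ψ : SpinorL2 d) x‖ ^ 2 := by
    simpa only [hsq] using (memLp_two_iff_integrable_sq hqU.1).1 hqU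
  refine ⟨hi, ?_⟩
  have hle : ∀ x : Space d, (‖x‖ ^ 2 + δ)⁻¹ * ‖x‖ ≤ √((‖x‖ ^ 2 + δ)⁻¹) := fun x => by
    have h1 : ‖x‖ ≤ √(‖x‖ ^ 2 + δ) := Real.le_sqrt_of_sq_le (by linarith)
    have h2 : √(‖x‖ ^ 2 + δ) * √(‖x‖ ^ 2 + δ) = ‖x‖ ^ 2 + δ := Real.mul_self_sqrt (hpos x).le
    have h3 : 0 < √(‖x‖ ^ 2 + δ) := Real.sqrt_pos.2 (hpos x)
    have e : (‖x‖ ^ 2 + δ)⁻¹ = (√(‖x‖ ^ 2 + δ))⁻¹ * (√(‖x‖ ^ 2 + δ))⁻¹ := by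
      rw [← mul_inv, h2]
    rw [Real.sqrt_inv, e, mul_assoc]
    refine mul_le_of_le_one_right (by positivity) ?_
    rw [inv_mul_le_iff₀ h3, mul_one]
    exact h1
  have hi2 : Integrable fun x => (√((‖x‖ ^ 2 + δ)⁻¹) * ‖(ψ : SpinorL2 d) x‖)
      * magneticGradNorm A ψ x := hqU.integrable_mul hg
  have hi3 : Integrable fun x => (‖x‖ ^ 2 + δ)⁻¹ * ‖x‖ * (magneticGradNorm A ψ x
      * ‖(ψ : SpinorL2 d) x‖) := by
    refine hi2.mono' ((hqs.continuous.mul continuous_norm).aestronglyMeasurable.mul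
      (hg.1.mul hU.1)) (ae_of_all _ fun x => ?_)
    have h1 : 0 ≤ magneticGradNorm A ψ x := Real.sqrt_nonneg _
    have h2 := hpos x
    rw [Real.norm_of_nonneg (mul_nonneg (by positivity) (mul_nonneg h1 (norm_nonneg _)))]
    have := mul_le_mul_of_nonneg_right (hle x) (mul_nonneg h1 (norm_nonneg ((ψ : SpinorL2 d) x)))
    linarith
  have hY := outerCutoff_isCutoffSeq (d := d)
  have hn : ∀ n, ((d : ℝ) - 2) * ∫ x, outerCutoff d n x
        * ((‖x‖ ^ 2 + δ)⁻¹ * ‖(ψ : SpinorL2 d) x‖ ^ 2)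
      ≤ (∫ x, ‖x‖ * ‖fderiv ℝ (outerCutoff d n) x‖
          * ((‖x‖ ^ 2 + δ)⁻¹ * ‖(ψ : SpinorL2 d) x‖ ^ 2))
        + 2 * ∫ x, outerCutoff d n x * ((‖x‖ ^ 2 + δ)⁻¹ * ‖x‖ * (magneticGradNorm A ψ x
          * ‖(ψ : SpinorL2 d) x‖)) := by
    intro n
    have hprod : ∀ j, _ := fun j => integral_productDensity (ha j)
      (Y := fun y => outerCutoff d n y * (y j * (‖y‖ ^ 2 + δ)⁻¹))
      ((hY.contDiff n).mul ((EuclideanSpace.proj j : Space d →L[ℝ] ℝ).contDiff.mul hqs))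
      (hY.hasCompactSupport n).mul_right (ContinuousLinearMap.id ℂ _) ψ
    have hre : Integrable fun x => (∑ j, productDensity A
        (fun y => outerCutoff d n y * (y j * (‖y‖ ^ 2 + δ)⁻¹))
        (ContinuousLinearMap.id ℂ _) j ψ x).re :=
      (integrable_finsetSum Finset.univ fun j _ => (hprod j).1).re
    have hre0 : ∫ x, (∑ j, productDensity A
        (fun y => outerCutoff d n y * (y j * (‖y‖ ^ 2 + δ)⁻¹))
        (ContinuousLinearMap.id ℂ _) j ψ x).re = 0 := by
      have h1 := Complex.reCLM.integral_comp_comm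
        (integrable_finsetSum Finset.univ fun j _ => (hprod j).1)
      rw [integral_finsetSum _ fun j _ => (hprod j).1] at h1
      simp only [(hprod _).2, Finset.sum_const_zero, map_zero] at h1
      exact h1
    have i1 := hY.integrable_mul hi n
    have i2 := hY.integrable_fderiv_mul hi n
    have i3 := hY.integrable_mul hi3 n
    have hmono := integral_mono (i1.const_mul ((d : ℝ) - 2))
      ((hre.add i2).add (i3.const_mul 2)) fun x => norm_hardyDensity_le A ψ
        ((hY.contDiff n).differentiable (by simp) x) (hY.nonneg n x) hδ
    simp only [Pi.add_apply] at hmono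
    rw [integral_const_mul, integral_add (by exact hre.add i2) (i3.const_mul 2),
      integral_add hre i2, hre0, zero_add, integral_const_mul] at hmono
    exact hmono
  have hlim := le_of_tendsto_of_tendsto' ((hY.tendsto_integral_mul hd0 hi).const_mul _)
    ((hY.tendsto_integral_fderiv_mul hd0 hi).add
      ((hY.tendsto_integral_mul hd0 hi3).const_mul 2)) hn
  rw [zero_add] at hlim
  have h1 : ∫ x, (‖x‖ ^ 2 + δ)⁻¹ * ‖x‖ * (magneticGradNorm A ψ x * ‖(ψ : SpinorL2 d) x‖)
      ≤ ∫ x, (√((‖x‖ ^ 2 + δ)⁻¹) * ‖(ψ : SpinorL2 d) x‖) * magneticGradNorm A ψ x := by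
    refine integral_mono hi3 hi2 fun x => ?_
    have h1 : 0 ≤ magneticGradNorm A ψ x := Real.sqrt_nonneg _
    have := mul_le_mul_of_nonneg_right (hle x) (mul_nonneg h1 (norm_nonneg ((ψ : SpinorL2 d) x)))
    linarith
  have h2 := integral_mul_le_sqrt_mul_sqrt hqU hg (fun x => by positivity)
    fun x => Real.sqrt_nonneg _
  have hJ := sq_sqrt_integral_sq fun x => √((‖x‖ ^ 2 + δ)⁻¹) * ‖(ψ : SpinorL2 d) x‖
  have hG := sq_sqrt_integral_sq (magneticGradNorm A ψ)
  simp only [hsq] at h2 hJ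
  set J := ∫ x, (‖x‖ ^ 2 + δ)⁻¹ * ‖(ψ : SpinorL2 d) x‖ ^ 2
  set G := ∫ x, magneticGradNorm A ψ x ^ 2
  have hs : 0 < (d : ℝ) - 2 := by linarith
  rw [div_mul_eq_mul_div, le_div_iff₀ (by positivity)]
  -- Cauchy–Schwarz gives (d-2)J ≤ 2√J√G. Since the regularized J is already finite, √J can be
  -- divided out.
  have h3 : ((d : ℝ) - 2) * √J ≤ 2 * √G := by
    rcases (Real.sqrt_nonneg J).eq_or_lt with h0 | h0
    · rw [← h0]
      simp [Real.sqrt_nonneg]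
    · refine le_of_mul_le_mul_right ?_ h0
      nlinarith
  have h4 : 0 ≤ ((d : ℝ) - 2) * √J := by positivity
  nlinarith [pow_le_pow_left₀ h4 h3 2]

/-- The magnetic Hardy inequality. -/
theorem magnetic_hardy (hd : 3 ≤ d)
    (ha : ∀ j (ψ : sobolevH1 d), MemLp (fun x => A x j • (ψ : SpinorL2 d) x) 2 volume)
    (ψ : sobolevH1 d) :
    MemLp (fun x => ‖x‖⁻¹ * ‖(ψ : SpinorL2 d) x‖) 2 volume ∧
    ∫ x, (‖x‖⁻¹ * ‖(ψ : SpinorL2 d) x‖) ^ 2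
      ≤ 4 / ((d : ℝ) - 2) ^ 2 * ∫ x, magneticGradNorm A ψ x ^ 2 := by
  have h0 : 0 ≤ 4 / ((d : ℝ) - 2) ^ 2 * ∫ x, magneticGradNorm A ψ x ^ 2 :=
    mul_nonneg (by positivity) (integral_nonneg fun x => sq_nonneg _)
  rw [← max_eq_left h0]
  have hm : AEStronglyMeasurable (fun x => ‖x‖⁻¹ * ‖(ψ : SpinorL2 d) x‖) volume :=
    measurable_norm.inv.aestronglyMeasurable.mul (Lp.memLp (ψ : SpinorL2 d)).1.norm
  refine memLp_two_of_lintegral_le hm ?_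
  -- The constant is independent of δ, so Fatou's lemma along δ = 1/(n+1) removes the
  -- regularization.
  have hn := fun n : ℕ => integral_regularized_hardy_le hd ha ψ (Nat.one_div_pos_of_nat (n := n))
  set F : ℕ → Space d → ENNReal := fun n x =>
    ENNReal.ofReal ((‖x‖ ^ 2 + 1 / ((n : ℝ) + 1))⁻¹ * ‖(ψ : SpinorL2 d) x‖ ^ 2)
  have hF : ∀ n, ∫⁻ x, F n x
      ≤ ENNReal.ofReal (4 / ((d : ℝ) - 2) ^ 2 * ∫ x, magneticGradNorm A ψ x ^ 2) := fun n => by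
    rw [← ofReal_integral_eq_lintegral_ofReal (hn n).1 (ae_of_all _ fun x => by positivity)]
    exact ENNReal.ofReal_le_ofReal (hn n).2
  calc ∫⁻ x, ENNReal.ofReal ((‖x‖⁻¹ * ‖(ψ : SpinorL2 d) x‖) ^ 2)
      = ∫⁻ x, liminf (fun n => F n x) atTop := by
        refine lintegral_congr_ae ?_
        filter_upwards [ae_ne_zero (d := d) (by omega)] with x hx
        refine (Tendsto.liminf_eq ?_).symm
        refine (ENNReal.continuous_ofReal.tendsto _).comp ?_
        have h1 : Tendsto (fun n : ℕ => ‖x‖ ^ 2 + 1 / ((n : ℝ) + 1)) atTop (𝓝 (‖x‖ ^ 2 + 0)) :=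
          tendsto_const_nhds.add tendsto_one_div_add_atTop_nhds_zero_nat
        have h2 : ‖x‖ ^ 2 + 0 ≠ 0 := by
          rw [add_zero]
          exact pow_ne_zero _ (norm_ne_zero_iff.2 hx)
        have h3 := (h1.inv₀ h2).mul_const (‖(ψ : SpinorL2 d) x‖ ^ 2)
        rwa [add_zero, ← inv_pow, ← mul_pow] at h3
    _ ≤ liminf (fun n => ∫⁻ x, F n x) atTop :=
        lintegral_liminf_le' fun n => (hn n).1.1.aemeasurable.ennreal_ofReal
    _ ≤ _ := liminf_le_of_frequently_le' (Frequently.of_forall hF)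

variable {α : Fin d → SpinMatrix d} {β : SpinMatrix d} {B : Space d → Matrix (Fin d) (Fin d) ℝ}

/-- The Lichnerowicz inequality: the magnetic gradient is controlled by `α · ∇_A ψ` and by the
magnetic field. -/
theorem IsDiracMatrices.lichnerowicz (h : IsDiracMatrices α β) (hd : 3 ≤ d)
    (ha : ∀ j (ψ : sobolevH1 d), MemLp (fun x => A x j • (ψ : SpinorL2 d) x) 2 volume)
    (hAB : IsMagneticField A B)
    (hA : ∀ j, LocallyIntegrable fun x => A x j) (hB : ∀ j k, LocallyIntegrable fun x => B x j k)
    (hb : ∀ j k (ψ : sobolevH1 d),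
      MemLp (fun x => (‖x‖ * B x j k) • (ψ : SpinorL2 d) x) 2 volume)
    (hBm : ∀ ψ : sobolevH1 d,
      MemLp (fun x => ‖x‖ * matrixOpNorm (B x) * ‖(ψ : SpinorL2 d) x‖) 2 volume)
    (ψ : sobolevH1 d) :
    ∫ x, magneticGradNorm A ψ x ^ 2 ≤ (∫ x, ‖diracGrad α A ψ x‖ ^ 2)
      + d / 2 * ∫ x, (‖x‖ * matrixOpNorm (B x) * ‖(ψ : SpinorL2 d) x‖)
        * (‖x‖⁻¹ * ‖(ψ : SpinorL2 d) x‖) := by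
  have hd0 : 0 < d := by omega
  have hp := fun j ψ => memLp_magneticPartial (ha j) ψ
  have hg := (memLp_magneticGradNorm hp ψ).1
  have hP : MemLp (diracGrad α A ψ) 2 volume :=
    memLp_finsetSum Finset.univ fun j _ => (α j).act.comp_memLp' (hp j ψ)
  have hH := (magnetic_hardy hd ha ψ).1
  have hg2 : Integrable fun x => magneticGradNorm A ψ x ^ 2 :=
    (memLp_two_iff_integrable_sq hg.1).1 hg
  have hP2 : Integrable fun x => ‖diracGrad α A ψ x‖ ^ 2 :=
    (memLp_two_iff_integrable_sq_norm hP.1).1 hP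
  have i1 : Integrable fun x => magneticGradNorm A ψ x ^ 2 - ‖diracGrad α A ψ x‖ ^ 2 :=
    hg2.sub hP2
  have i2 : Integrable fun x => (‖x‖ * matrixOpNorm (B x) * ‖(ψ : SpinorL2 d) x‖)
        * (‖x‖⁻¹ * ‖(ψ : SpinorL2 d) x‖) := (hBm ψ).integrable_mul hH
  -- The cutoff error |∇Y||ψ| is read as |x||∇Y| times |x|⁻¹|ψ|, and the latter is in L² by Hardy.
  have i3 : Integrable fun x => (‖x‖⁻¹ * ‖(ψ : SpinorL2 d) x‖)
      * (‖diracGrad α A ψ x‖ + magneticGradNorm A ψ x) := hH.integrable_mul (hP.norm.add hg)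
  have hY := annularCutoff_isCutoffSeq (d := d)
  have hn : ∀ n, 2 * ∫ x, annularCutoff d n x
        * (magneticGradNorm A ψ x ^ 2 - ‖diracGrad α A ψ x‖ ^ 2)
      ≤ d * (∫ x, annularCutoff d n x * ((‖x‖ * matrixOpNorm (B x) * ‖(ψ : SpinorL2 d) x‖)
        * (‖x‖⁻¹ * ‖(ψ : SpinorL2 d) x‖)))
        + 2 * ∫ x, ‖x‖ * ‖fderiv ℝ (annularCutoff d n) x‖ * ((‖x‖⁻¹ * ‖(ψ : SpinorL2 d) x‖)
          * (‖diracGrad α A ψ x‖ + magneticGradNorm A ψ x)) := by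
    intro n
    have hc : ∀ j k, _ := fun j k => integral_commutatorDensity ha hAB hA hB hb (hY.contDiff n)
      (hY.hasCompactSupport n) (zero_notMem_tsupport_annularCutoff n)
      ((α j).act.comp (α k).act) j k ψ
    have hD : Integrable fun x => ∑ j, ∑ k,
        commutatorDensity A B (annularCutoff d n) ((α j).act.comp (α k).act) j k ψ x :=
      integrable_finsetSum Finset.univ fun j _ => integrable_finsetSum Finset.univ fun k _ =>
        (hc j k).1
    have hD0 : ∫ x, ∑ j, ∑ k,
        commutatorDensity A B (annularCutoff d n) ((α j).act.comp (α k).act) j k ψ x = 0 := by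
      rw [integral_finsetSum _ fun j _ => integrable_finsetSum Finset.univ fun k _ => (hc j k).1]
      refine Finset.sum_eq_zero fun j _ => ?_
      rw [integral_finsetSum _ fun k _ => (hc j k).1]
      exact Finset.sum_eq_zero fun k _ => (hc j k).2
    have j1 := (hY.integrable_mul i1 n).const_mul 2
    have j2 := (hY.integrable_mul i2 n).const_mul (d : ℝ)
    have j3 := (hY.integrable_fderiv_mul i3 n).const_mul 2
    have := integral_le_of_norm_add_le hD hD0 j1 (j2.add j3) (by
      filter_upwards [ae_ne_zero hd0] with x hx
      have hx0 : ‖x‖ ≠ 0 := norm_ne_zero_iff.2 hx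
      refine (h.norm_sum_commutatorDensity_le A B (annularCutoff d n) ψ x).trans (le_of_eq ?_)
      rw [abs_of_nonneg (hY.nonneg n x), Pi.add_apply]
      field_simp)
    simp only [Pi.add_apply] at this
    rwa [integral_const_mul, integral_add j2 j3, integral_const_mul, integral_const_mul] at this
  have hlim := le_of_tendsto_of_tendsto' ((hY.tendsto_integral_mul hd0 i1).const_mul _)
    (((hY.tendsto_integral_mul hd0 i2).const_mul _).add
      ((hY.tendsto_integral_fderiv_mul hd0 i3).const_mul 2)) hn
  rw [integral_sub hg2 hP2] at hlim
  linarith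

/-- The virial inequality for solutions of `-i α · ∇_A ψ = f ψ`. -/
theorem IsDiracMatrices.virial (h : IsDiracMatrices α β) (hd : 0 < d)
    (ha : ∀ j (ψ : sobolevH1 d), MemLp (fun x => A x j • (ψ : SpinorL2 d) x) 2 volume)
    (hAB : IsMagneticField A B)
    (hA : ∀ j, LocallyIntegrable fun x => A x j) (hB : ∀ j k, LocallyIntegrable fun x => B x j k)
    (hb : ∀ j k (ψ : sobolevH1 d),
      MemLp (fun x => (‖x‖ * B x j k) • (ψ : SpinorL2 d) x) 2 volume)
    (hBm : ∀ ψ : sobolevH1 d,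
      MemLp (fun x => ‖x‖ * matrixOpNorm (B x) * ‖(ψ : SpinorL2 d) x‖) 2 volume)
    (ψ : sobolevH1 d) {f : Space d → ℝ} (hf : ContDiffOn ℝ ∞ f {0}ᶜ)
    (heq : ∀ᵐ x, diracGrad α A ψ x = (Complex.I * f x) • (ψ : SpinorL2 d) x)
    (hfm : MemLp (fun x => |f x| * ‖(ψ : SpinorL2 d) x‖) 2 volume)
    (hfd : MemLp (fun x => ‖x‖ * ‖fderiv ℝ f x‖ * ‖(ψ : SpinorL2 d) x‖) 2 volume) :
    ∫ x, (|f x| * ‖(ψ : SpinorL2 d) x‖) ^ 2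
      ≤ (∫ x, (‖x‖ * ‖fderiv ℝ f x‖ * ‖(ψ : SpinorL2 d) x‖) * (|f x| * ‖(ψ : SpinorL2 d) x‖))
      + (∫ x, (‖x‖ * matrixOpNorm (B x) * ‖(ψ : SpinorL2 d) x‖)
        * (|f x| * ‖(ψ : SpinorL2 d) x‖))
      + ∫ x, (‖x‖ * ‖fderiv ℝ f x‖ * ‖(ψ : SpinorL2 d) x‖) * magneticGradNorm A ψ x := by
  have hp := fun j ψ => memLp_magneticPartial (ha j) ψ
  have hg := (memLp_magneticGradNorm hp ψ).1
  have i0 : Integrable fun x => (|f x| * ‖(ψ : SpinorL2 d) x‖) ^ 2 :=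
    (memLp_two_iff_integrable_sq hfm.1).1 hfm
  have i1 := hfd.integrable_mul hfm
  have i2 := (hBm ψ).integrable_mul hfm
  have i3 := hfd.integrable_mul hg
  have i4 := hfm.integrable_mul hg
  have hY := annularCutoff_isCutoffSeq (d := d)
  have hn : ∀ n, ∫ x, annularCutoff d n x * (|f x| * ‖(ψ : SpinorL2 d) x‖) ^ 2
      ≤ (∫ x, annularCutoff d n x * ((‖x‖ * ‖fderiv ℝ f x‖ * ‖(ψ : SpinorL2 d) x‖)
          * (|f x| * ‖(ψ : SpinorL2 d) x‖)))
        + (∫ x, annularCutoff d n x * ((‖x‖ * matrixOpNorm (B x) * ‖(ψ : SpinorL2 d) x‖)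
          * (|f x| * ‖(ψ : SpinorL2 d) x‖)))
        + (∫ x, annularCutoff d n x * ((‖x‖ * ‖fderiv ℝ f x‖ * ‖(ψ : SpinorL2 d) x‖)
          * magneticGradNorm A ψ x))
        + ∫ x, ‖x‖ * ‖fderiv ℝ (annularCutoff d n) x‖ * ((|f x| * ‖(ψ : SpinorL2 d) x‖)
          * magneticGradNorm A ψ x) := by
    intro n
    have h0 := zero_notMem_tsupport_annularCutoff (d := d) n
    have hcoord : ∀ k, ContDiffOn ℝ ∞ (fun y : Space d => y k) {0}ᶜ := fun k =>
      (EuclideanSpace.proj k : Space d →L[ℝ] ℝ).contDiff.contDiffOn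
    -- The multiplier is the field Y f x, smooth because Y vanishes near the only possible
    -- singularity of f.
    have hc : ∀ j k, _ := fun j k => integral_commutatorDensity ha hAB hA hB hb
      ((hY.contDiff n).mul_of_zero_notMem_tsupport h0 ((hcoord k).mul hf))
      (hY.hasCompactSupport n).mul_right (fun hmem => h0 (tsupport_mul_subset_left hmem))
      (α j).act j k ψ
    have hq : ∀ j, _ := fun j => integral_productDensity (ha j)
      ((hY.contDiff n).mul_of_zero_notMem_tsupport h0 ((hcoord j).mul (hf.mul hf)))
      (hY.hasCompactSupport n).mul_right (ContinuousLinearMap.id ℂ _) ψ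
    have hD1 : Integrable fun x => Complex.I * ∑ j, ∑ k, commutatorDensity A B
        (fun y => annularCutoff d n y * (y k * f y)) (α j).act j k ψ x :=
      (integrable_finsetSum Finset.univ fun j _ => integrable_finsetSum Finset.univ fun k _ =>
        (hc j k).1).const_mul _
    have hD2 : Integrable fun x => ∑ j, productDensity A
        (fun y => annularCutoff d n y * (y j * (f y * f y))) (ContinuousLinearMap.id ℂ _) j ψ x :=
      integrable_finsetSum Finset.univ fun j _ => (hq j).1
    have hD0 : ∫ x, (Complex.I * ∑ j, ∑ k, commutatorDensity A B
        (fun y => annularCutoff d n y * (y k * f y)) (α j).act j k ψ x - ∑ j, productDensity A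
        (fun y => annularCutoff d n y * (y j * (f y * f y))) (ContinuousLinearMap.id ℂ _) j ψ x)
        = 0 := by
      rw [integral_sub hD1 hD2, integral_const_mul,
        integral_finsetSum _ fun j _ => integrable_finsetSum Finset.univ fun k _ => (hc j k).1,
        integral_finsetSum _ fun j _ => (hq j).1, Finset.sum_eq_zero fun j _ => (hq j).2,
        Finset.sum_eq_zero fun j _ => ?_]
      · simp
      · rw [integral_finsetSum _ fun k _ => (hc j k).1]
        exact Finset.sum_eq_zero fun k _ => (hc j k).2
    have j0 := hY.integrable_mul i0 n
    have j1 := hY.integrable_mul i1 n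
    have j2 := hY.integrable_mul i2 n
    have j3 := hY.integrable_mul i3 n
    have j4 := hY.integrable_fderiv_mul i4 n
    have := integral_le_of_norm_add_le (hD1.sub hD2) hD0 j0 (((j1.add j2).add j3).add j4) (by
      filter_upwards [ae_ne_zero hd, heq] with x hx hxe
      refine (h.norm_virialDensity_le A B ψ ((hY.contDiff n).differentiable (by simp) x)
        ((hf.contDiffAt (isOpen_compl_singleton.mem_nhds hx)).differentiableAt (by simp))
        hxe).trans (le_of_eq ?_)
      rw [abs_of_nonneg (hY.nonneg n x)]
      rfl)
    refine this.trans (le_of_eq ?_)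
    rw [← integral_add (by exact j1) (by exact j2),
      ← integral_add (by exact j1.add j2) (by exact j3),
      ← integral_add (by exact (j1.add j2).add j3) (by exact j4)]
    rfl
  have hlim := le_of_tendsto_of_tendsto' (hY.tendsto_integral_mul hd i0)
    ((((hY.tendsto_integral_mul hd i1).add (hY.tendsto_integral_mul hd i2)).add
      (hY.tendsto_integral_mul hd i3)).add (hY.tendsto_integral_fderiv_mul hd i4)) hn
  rwa [add_zero] at hlim

/-- The eigenvalues of the symmetric operator `-i α · ∇_A + v` are real. -/
theorem IsDiracMatrices.eigenvalue_im_eq_zero (h : IsDiracMatrices α β) (hd : 3 ≤ d)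
    (ha : ∀ j (ψ : sobolevH1 d), MemLp (fun x => A x j • (ψ : SpinorL2 d) x) 2 volume)
    (ψ : sobolevH1 d) {v : Space d → ℝ} {μ : ℂ}
    (heq : ∀ᵐ x, diracGrad α A ψ x = (Complex.I * (μ - v x)) • (ψ : SpinorL2 d) x)
    (hψ : (ψ : SpinorL2 d) ≠ 0) : μ.im = 0 := by
  have hd0 : 0 < d := by omega
  have hU : MemLp (fun x => ‖(ψ : SpinorL2 d) x‖) 2 volume := (Lp.memLp (ψ : SpinorL2 d)).norm
  have i1 : Integrable fun x => ‖(ψ : SpinorL2 d) x‖ ^ 2 :=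
    (memLp_two_iff_integrable_sq hU.1).1 hU
  have i2 := (magnetic_hardy hd ha ψ).1.integrable_mul hU
  have hY := outerCutoff_isCutoffSeq (d := d)
  have hn : ∀ n, 2 * μ.im ^ 2 * ∫ x, outerCutoff d n x * ‖(ψ : SpinorL2 d) x‖ ^ 2
      ≤ |μ.im| * ∫ x, ‖x‖ * ‖fderiv ℝ (outerCutoff d n) x‖
        * ((‖x‖⁻¹ * ‖(ψ : SpinorL2 d) x‖) * ‖(ψ : SpinorL2 d) x‖) := by
    intro n
    have hq : ∀ j, _ := fun j => integral_productDensity (ha j) (hY.contDiff n)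
      (hY.hasCompactSupport n) (α j).act ψ
    -- The product rule with M = α_j yields -2 Im μ · Y|ψ|² plus a term in ∇Y; the real potential v
    -- cancels pointwise. The extra factor Im μ fixes the sign.
    have hD : Integrable fun x =>
        (μ.im : ℂ) * ∑ j, productDensity A (outerCutoff d n) (α j).act j ψ x :=
      (integrable_finsetSum Finset.univ fun j _ => (hq j).1).const_mul _
    have hD0 : ∫ x, (μ.im : ℂ)
        * ∑ j, productDensity A (outerCutoff d n) (α j).act j ψ x = 0 := by
      rw [integral_const_mul, integral_finsetSum _ fun j _ => (hq j).1,
        Finset.sum_eq_zero fun j _ => (hq j).2, mul_zero]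
    have j1 := (hY.integrable_mul i1 n).const_mul (2 * μ.im ^ 2)
    have j2 := (hY.integrable_fderiv_mul i2 n).const_mul |μ.im|
    have := integral_le_of_norm_add_le hD hD0 j1 j2 (by
      filter_upwards [ae_ne_zero hd0, heq] with x hx hxe
      have hx0 : ‖x‖ ≠ 0 := norm_ne_zero_iff.2 hx
      set u := (ψ : SpinorL2 d) x with hu
      have huu : inner ℂ u u = (‖u‖ : ℂ) ^ 2 := inner_self_eq_norm_sq_to_K u
      have s1 : inner ℂ u (diracGrad α A ψ x) = Complex.I * (μ - v x) * (‖u‖ : ℂ) ^ 2 := by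
        rw [hxe, inner_smul_right, huu]
      have s2 : inner ℂ (diracGrad α A ψ x) u
          = -Complex.I * (starRingEnd ℂ μ - v x) * (‖u‖ : ℂ) ^ 2 := by
        rw [hxe, inner_smul_left, huu]
        simp
      have s3 : ∑ j, productDensity A (outerCutoff d n) (α j).act j ψ x
          = inner ℂ u (cliffordAct α (fun j => partialDeriv j (outerCutoff d n) x) u)
            + outerCutoff d n x * inner ℂ (diracGrad α A ψ x) u
            + outerCutoff d n x * inner ℂ u (diracGrad α A ψ x) := by
        rw [← sum_inner_cliffordAct, diracGrad, sum_inner, inner_sum, Finset.mul_sum,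
          Finset.mul_sum, ← Finset.sum_add_distrib, ← Finset.sum_add_distrib]
        refine Finset.sum_congr rfl fun j _ => ?_
        rw [h.inner_act]
        rfl
      have hconj : μ - starRingEnd ℂ μ = 2 * μ.im * Complex.I := by
        rw [Complex.sub_conj]
        push_cast
        ring
      have s4 : (μ.im : ℂ) * ∑ j, productDensity A (outerCutoff d n) (α j).act j ψ x
          + ((2 * μ.im ^ 2 * (outerCutoff d n x * ‖u‖ ^ 2) : ℝ) : ℂ)
          = (μ.im : ℂ)
            * inner ℂ u (cliffordAct α (fun j => partialDeriv j (outerCutoff d n) x) u) := by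
        rw [s3, s1, s2]
        push_cast
        linear_combination (μ.im : ℂ) * outerCutoff d n x * Complex.I * (‖u‖ : ℂ) ^ 2 * hconj
          + 2 * (μ.im : ℂ) ^ 2 * outerCutoff d n x * (‖u‖ : ℂ) ^ 2 * Complex.I_sq
      rw [s4]
      refine (norm_ofReal_mul_inner_le _ _ _).trans (le_of_eq ?_)
      rw [h.norm_cliffordAct, sum_partialDeriv_sq]
      simp only [Pi.mul_apply, ← hu]
      field_simp)
    rwa [integral_const_mul, integral_const_mul] at this
  have hlim := le_of_tendsto_of_tendsto' ((hY.tendsto_integral_mul hd0 i1).const_mul _)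
    ((hY.tendsto_integral_fderiv_mul hd0 i2).const_mul _) hn
  rw [mul_zero] at hlim
  have hpos : 0 < ∫ x, ‖(ψ : SpinorL2 d) x‖ ^ 2 := by
    have e := L2.inner_def (𝕜 := ℂ) (ψ : SpinorL2 d) (ψ : SpinorL2 d)
    have e2 : ∫ x, inner ℂ ((ψ : SpinorL2 d) x) ((ψ : SpinorL2 d) x)
        = ((∫ x, ‖(ψ : SpinorL2 d) x‖ ^ 2 : ℝ) : ℂ) := by
      rw [← integral_complex_ofReal]
      refine integral_congr_ae (ae_of_all _ fun x => ?_)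
      push_cast
      exact inner_self_eq_norm_sq_to_K _
    rw [e2, inner_self_eq_norm_sq_to_K] at e
    have e3 : ‖(ψ : SpinorL2 d)‖ ^ 2 = ∫ x, ‖(ψ : SpinorL2 d) x‖ ^ 2 := by
      apply Complex.ofReal_injective
      push_cast
      exact e
    rw [← e3]
    have := norm_pos_iff.2 hψ
    positivity
  by_contra hne
  have : 0 < μ.im ^ 2 := by positivity
  nlinarith [mul_pos this hpos]

end IntegralInequalities

/-! ### Absence of eigenvalues -/

section AbsenceOfEigenvalues

variable {d : ℕ} {A : Space d → Space d} {α : Fin d → SpinMatrix d} {β : SpinMatrix d}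

theorem diracExpr_massless (V : Space d → SpinMatrix d) (ψ : sobolevH1 d) (x : Space d) :
    diracExpr α β 0 A V ψ x
      = (-Complex.I) • diracGrad α A ψ x + (V x).act ((ψ : SpinorL2 d) x) := by
  simp [diracExpr, diracGrad]

/-- If `-i α · ∇_A` maps `H¹` into `L²`, then so does the multiplication with `A_j`. -/
theorem IsDiracMatrices.memLp_mul_potential (h : IsDiracMatrices α β)
    (hA : MemLpLoc A 2) (hdom : (diracOperator α β 0 A 0).domain = sobolevH1 d) (j : Fin d)
    (ψ : sobolevH1 d) : MemLp (fun x => A x j • (ψ : SpinorL2 d) x) 2 volume := by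
  have hmem : (ψ : SpinorL2 d) ∈ (diracOperator α β 0 A 0).domain := by
    rw [hdom]
    exact ψ.2
  obtain ⟨h1, hexpr⟩ := hmem
  have hAm := aestronglyMeasurable_of_memLpLoc hA
  -- The free and the magnetic expressions are both in L², and their difference is α·A ψ, of norm
  -- |A||ψ|. This controls each component of A separately.
  have hs : MemLp (fun x => (-Complex.I) • ∑ k, (α k).act (weakPartial k ψ x)
      - diracExpr α β 0 A 0 ψ x) 2 volume :=
    ((memLp_finsetSum Finset.univ fun k _ =>
      (α k).act.comp_memLp' (Lp.memLp (weakPartial k ψ))).const_smul (-Complex.I)).sub hexpr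
  have e : ∀ x, (-Complex.I) • ∑ k, (α k).act (weakPartial k ψ x) - diracExpr α β 0 A 0 ψ x
      = cliffordAct α (fun k => A x k) ((ψ : SpinorL2 d) x) := fun x => by
    rw [diracExpr_massless]
    simp only [diracGrad, magneticPartial, map_sub, map_smul, Finset.sum_sub_distrib, smul_sub,
      cliffordAct, Pi.zero_apply, SpinMatrix.act, map_zero, zero_apply,
      add_zero, sub_sub_cancel, Finset.smul_sum, smul_smul]
    refine Finset.sum_congr rfl fun k _ => ?_
    congr 1
    linear_combination (-(A x k : ℂ)) * Complex.I_sq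
  simp only [e] at hs
  have hAj : AEStronglyMeasurable (fun x => A x j) volume :=
    (EuclideanSpace.proj j : Space d →L[ℝ] ℝ).continuous.comp_aestronglyMeasurable hAm
  refine hs.of_le (hAj.smul (Lp.memLp (ψ : SpinorL2 d)).1) (ae_of_all _ fun x => ?_)
  rw [h.norm_cliffordAct, norm_smul]
  gcongr
  rw [Real.norm_eq_abs, ← Real.sqrt_sq_eq_abs]
  exact Real.sqrt_le_sqrt (Finset.single_le_sum (f := fun k => A x k ^ 2)
    (fun _ _ => sq_nonneg _) (Finset.mem_univ j))

theorem aestronglyMeasurable_matrixOpNorm {B : Space d → Matrix (Fin d) (Fin d) ℝ}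
    (hB : ∀ j k, AEStronglyMeasurable (fun x => B x j k) volume) :
    AEStronglyMeasurable (fun x => matrixOpNorm (B x)) volume := by
  have hc : Continuous fun M : Fin d → Fin d → ℝ => matrixOpNorm (Matrix.of M) := by
    let T : (Fin d → Fin d → ℝ) →ₗ[ℝ] (Space d →L[ℝ] Space d) :=
      { toFun := fun M => Matrix.toEuclideanCLM (𝕜 := ℝ) (Matrix.of M)
        map_add' := fun M N => map_add (Matrix.toEuclideanCLM (𝕜 := ℝ)) (Matrix.of M) (Matrix.of N)
        map_smul' := fun c M => map_smul (Matrix.toEuclideanCLM (𝕜 := ℝ)) c (Matrix.of M) }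
    exact (LinearMap.continuous_of_finiteDimensional T).norm
  have hBm : AEMeasurable (fun x j k => B x j k) volume :=
    aemeasurable_pi_iff.2 fun j => aemeasurable_pi_iff.2 fun k => (hB j k).aemeasurable
  exact (hc.measurable.comp_aemeasurable hBm).aestronglyMeasurable

theorem norm_gradient (v : Space d → ℝ) (x : Space d) : ‖gradient v x‖ = ‖fderiv ℝ v x‖ :=
  LinearIsometryEquiv.norm_map _ _

/-- The elementary contradiction between the virial and the Lichnerowicz inequalities. -/
theorem eq_zero_of_virial_of_lichnerowicz {δ N G ε₁ ε₂ : ℝ} (hδ : 3 ≤ δ) (hN : 0 ≤ N) (hG : 0 ≤ G)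
    (hε₁ : 0 ≤ ε₁) (hε₂ : 0 ≤ ε₂)
    (hε : ((4 * δ - 7) / (δ - 2)) * ε₁ + 2 * ε₂ + ε₂ ^ 2 < 1)
    (hvir : N ^ 2 ≤ ε₂ * G * N + ε₁ * G * N + ε₂ * G * G)
    (hlic : G ^ 2 ≤ N ^ 2 + δ / 2 * ((ε₁ * G) * (2 / (δ - 2) * G))) : G = 0 := by
  have hs : 0 < δ - 2 := by linarith
  set κ := ε₁ / (δ - 2) with hκ
  have hκ0 : 0 ≤ κ := by positivity
  have hε₁' : ε₁ = κ * (δ - 2) := by rw [hκ, div_mul_cancel₀ _ hs.ne']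
  have e1 : (4 * δ - 7) / (δ - 2) * ε₁ = (4 * δ - 7) * κ := by rw [hκ]; ring
  have e2 : δ / 2 * ((ε₁ * G) * (2 / (δ - 2) * G)) = δ * κ * G ^ 2 := by rw [hκ]; ring
  rw [e1] at hε
  rw [e2] at hlic
  -- With δ in the role of d and ε₁ = (δ-2)κ, the coefficient of κ is 2δ - 2, which is at most 4δ -
  -- 7 because 2δ ≥ 5.
  have hsmall : δ * κ + ε₁ + 2 * ε₂ < 1 := by
    rw [hε₁']
    nlinarith [sq_nonneg ε₂, mul_nonneg hκ0 (by linarith : 0 ≤ 2 * δ - 5)]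
  have hδκ : 0 ≤ δ * κ := by positivity
  by_contra hne
  have hGpos : 0 < G := lt_of_le_of_ne hG (Ne.symm hne)
  -- If G ≤ N, the virial inequality alone gives N² ≤ (ε₁ + 2ε₂)N². If N ≤ G, it gives N² ≤ (ε₁ +
  -- 2ε₂)G², which is inserted into the Lichnerowicz inequality.
  rcases le_total G N with hGN | hNG
  · have h1 : G * N ≤ N ^ 2 := by nlinarith
    have h2 : G * G ≤ N ^ 2 := by nlinarith
    have h3 : N ^ 2 ≤ (ε₁ + 2 * ε₂) * N ^ 2 := by
      nlinarith [mul_le_mul_of_nonneg_left h1 hε₁, mul_le_mul_of_nonneg_left h1 hε₂,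
        mul_le_mul_of_nonneg_left h2 hε₂]
    have hN2 : 0 < N ^ 2 := pow_pos (hGpos.trans_le hGN) 2
    nlinarith
  · have h1 : G * N ≤ G ^ 2 := by nlinarith
    have h3 : N ^ 2 ≤ (ε₁ + 2 * ε₂) * G ^ 2 := by
      nlinarith [mul_le_mul_of_nonneg_left h1 hε₁, mul_le_mul_of_nonneg_left h1 hε₂]
    have hG2 : 0 < G ^ 2 := pow_pos hGpos 2
    nlinarith

end AbsenceOfEigenvalues

theorem theorem1p8 (d : ℕ) (hd : 3 ≤ d)
    (α : Fin d → SpinMatrix d) (β : SpinMatrix d) (hαβ : IsDiracMatrices α β)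
    (A : Space d → Space d) (B : Space d → Matrix (Fin d) (Fin d) ℝ)
    (hA : MemLpLoc A 2) (hB : ∀ j k, MemLpLoc (fun x => B x j k) 2) (hAB : IsMagneticField A B)
    (hdom : (diracOperator α β 0 A 0).domain = sobolevH1 d)
    (hsa : IsSelfAdjoint (diracOperator α β 0 A 0))
    (v : Space d → ℝ) (hv : LocallyIntegrable v volume)
    (hvs : ContDiffOn ℝ ∞ v {0}ᶜ)
    (hvb : ∀ r : ℝ, 0 < r → ∃ C : ℝ, ∀ x : Space d, r ≤ ‖x‖ → |v x| ≤ C)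
    (hVH : IsDiracBounded α β 0 A (electricPotential v))
    (ε₁ ε₂ : ℝ) (hε₁ : 0 ≤ ε₁) (hε₂ : 0 ≤ ε₂)
    (hε : ((4 * (d : ℝ) - 7) / ((d : ℝ) - 2)) * ε₁ + 2 * ε₂ + ε₂ ^ 2 < 1)
    (hBε : HardyBound A (fun x => matrixOpNorm (B x)) ε₁)
    (hvε : HardyBound A (fun x => ‖gradient v x‖) ε₂) :
    pointSpectrum (diracOperator α β 0 A (electricPotential v)) = ∅ := by
  have hd0 : 0 < d := by omega
  have hd3 : (3 : ℝ) ≤ d := by exact_mod_cast hd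
  have ha := hαβ.memLp_mul_potential hA hdom
  have hp := fun j ψ => memLp_magneticPartial (ha j) ψ
  have hAl : ∀ j, LocallyIntegrable fun x => A x j := fun j K => by
    have := (locallyIntegrable_of_memLpLoc hA) K
    exact (EuclideanSpace.proj j : Space d →L[ℝ] ℝ).integrableAtFilter_comp this
  have hBl : ∀ j k, LocallyIntegrable fun x => B x j k := fun j k =>
    locallyIntegrable_of_memLpLoc (hB j k)
  have hBa : ∀ j k, AEStronglyMeasurable (fun x => B x j k) volume := fun j k =>
    aestronglyMeasurable_of_memLpLoc (hB j k)
  have hBm := hBε.memLp (aestronglyMeasurable_matrixOpNorm hBa) hp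
  have hb : ∀ j k (ψ : sobolevH1 d),
      MemLp (fun x => (‖x‖ * B x j k) • (ψ : SpinorL2 d) x) 2 volume := fun j k ψ => by
    refine (hBm ψ).1.of_le ((continuous_norm.aestronglyMeasurable.mul (hBa j k)).smul
      (Lp.memLp (ψ : SpinorL2 d)).1) (ae_of_all _ fun x => ?_)
    rw [norm_smul, norm_mul, norm_norm, Real.norm_eq_abs (B x j k),
      Real.norm_of_nonneg (mul_nonneg (mul_nonneg (norm_nonneg _) (matrixOpNorm_nonneg _)) (norm_nonneg _))]
    gcongr
    exact abs_entry_le _ _ _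
  have hvm := hvε.memLp (by
    simp only [norm_gradient]
    exact (measurable_fderiv ℝ v).norm.aestronglyMeasurable) hp
  rw [Set.eq_empty_iff_forall_notMem]
  rintro μ ⟨⟨ψ₀, hψ₀⟩, hne, hTψ⟩
  set ψ : sobolevH1 d := ⟨ψ₀, hψ₀.choose⟩ with hψ
  have hev : ∀ᵐ x, diracExpr α β 0 A (electricPotential v) ψ x = μ • (ψ : SpinorL2 d) x := by
    have h1 := hψ₀.choose_spec.coeFn_toLp
    have h2 : MemLp.toLp (diracExpr α β 0 A (electricPotential v) ψ) hψ₀.choose_spec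
      = μ • (ψ : SpinorL2 d) := hTψ
    filter_upwards [h1, Lp.coeFn_smul μ (ψ : SpinorL2 d)] with x e1 e2
    rw [← e1, h2, e2]
    rfl
  have heqμ : ∀ᵐ x, diracGrad α A ψ x = (Complex.I * (μ - v x)) • (ψ : SpinorL2 d) x := by
    filter_upwards [hev] with x hx
    have hact : (electricPotential v x).act ((ψ : SpinorL2 d) x)
        = (v x : ℂ) • (ψ : SpinorL2 d) x := by
      rw [electricPotential, SpinMatrix.act, map_smul, map_one]
      rfl
    rw [diracExpr_massless, hact] at hx
    have h1 : (-Complex.I) • diracGrad α A ψ x = (μ - v x) • (ψ : SpinorL2 d) x := by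
      rw [sub_smul, ← hx]
      abel
    rw [mul_smul, ← h1, smul_smul]
    simp
  have him := hαβ.eigenvalue_im_eq_zero hd ha ψ heqμ hne
  set f : Space d → ℝ := fun x => μ.re - v x with hf
  have heq : ∀ᵐ x, diracGrad α A ψ x = (Complex.I * f x) • (ψ : SpinorL2 d) x := by
    filter_upwards [heqμ] with x hx
    have : (f x : ℂ) = μ - v x := by
      apply Complex.ext <;> simp [hf, him]
    rw [hx, this]
  have hnorm : ∀ᵐ x, ‖diracGrad α A ψ x‖ = |f x| * ‖(ψ : SpinorL2 d) x‖ := by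
    filter_upwards [heq] with x hx
    rw [hx, norm_smul, norm_mul, Complex.norm_I, one_mul, Complex.norm_real, Real.norm_eq_abs]
  have hfs : ContDiffOn ℝ ∞ f {0}ᶜ := contDiffOn_const.sub hvs
  have hfd : ∀ x, fderiv ℝ f x = -fderiv ℝ v x := fun x => fderiv_const_sub _
  have hPm : MemLp (diracGrad α A ψ) 2 volume :=
    memLp_finsetSum Finset.univ fun j _ => (α j).act.comp_memLp' (hp j ψ)
  -- Square integrability of fψ is read off from the equation, since α·∇_Aψ has the same pointwise
  -- norm.
  have hfm : MemLp (fun x => |f x| * ‖(ψ : SpinorL2 d) x‖) 2 volume := hPm.norm.ae_eq hnorm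
  have hvm' : MemLp (fun x => ‖x‖ * ‖fderiv ℝ f x‖ * ‖(ψ : SpinorL2 d) x‖) 2 volume ∧
      ∫ x, (‖x‖ * ‖fderiv ℝ f x‖ * ‖(ψ : SpinorL2 d) x‖) ^ 2
        ≤ ε₂ ^ 2 * ∫ x, magneticGradNorm A ψ x ^ 2 := by
    simpa only [hfd, norm_neg, norm_gradient] using hvm ψ
  have hg := (memLp_magneticGradNorm hp ψ).1
  have hH := magnetic_hardy hd ha ψ
  have hvir := hαβ.virial hd0 ha hAB hAl hBl hb (fun ψ => (hBm ψ).1) ψ hfs heq hfm hvm'.1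
  have hlic := hαβ.lichnerowicz hd ha hAB hAl hBl hb (fun ψ => (hBm ψ).1) ψ
  have hPf : ∫ x, ‖diracGrad α A ψ x‖ ^ 2 = ∫ x, (|f x| * ‖(ψ : SpinorL2 d) x‖) ^ 2 := by
    refine integral_congr_ae ?_
    filter_upwards [hnorm] with x hx
    rw [hx]
  have c1 := integral_mul_le_sqrt_mul_sqrt hvm'.1 hfm (fun x => by positivity)
    fun x => by positivity
  have hB0 : ∀ x, 0 ≤ ‖x‖ * matrixOpNorm (B x) * ‖(ψ : SpinorL2 d) x‖ := fun x =>
    mul_nonneg (mul_nonneg (norm_nonneg _) (matrixOpNorm_nonneg _)) (norm_nonneg _)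
  have c2 := integral_mul_le_sqrt_mul_sqrt (hBm ψ).1 hfm hB0 fun x => by positivity
  have c3 := integral_mul_le_sqrt_mul_sqrt hvm'.1 hg (fun x => by positivity)
    fun x => Real.sqrt_nonneg _
  have c4 := integral_mul_le_sqrt_mul_sqrt (hBm ψ).1 hH.1 hB0 fun x => by positivity
  have sV := Real.sqrt_le_sqrt hvm'.2
  have sB := Real.sqrt_le_sqrt (hBm ψ).2
  have sH := Real.sqrt_le_sqrt hH.2
  have hdiv : (4 : ℝ) / ((d : ℝ) - 2) ^ 2 = (2 / ((d : ℝ) - 2)) ^ 2 := by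
    rw [div_pow]
    norm_num
  rw [Real.sqrt_mul (sq_nonneg _), Real.sqrt_sq hε₂] at sV
  rw [Real.sqrt_mul (sq_nonneg _), Real.sqrt_sq hε₁] at sB
  rw [hdiv, Real.sqrt_mul (sq_nonneg _),
    Real.sqrt_sq (div_nonneg zero_le_two (by linarith))] at sH
  have hN := sq_sqrt_integral_sq fun x => |f x| * ‖(ψ : SpinorL2 d) x‖
  have hG := sq_sqrt_integral_sq (magneticGradNorm A ψ)
  rw [hPf, ← hG, ← hN] at hlic
  rw [← hN] at hvir
  set G := √(∫ x, magneticGradNorm A ψ x ^ 2) with hGdef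
  set N := √(∫ x, (|f x| * ‖(ψ : SpinorL2 d) x‖) ^ 2)
  have hG0 : 0 ≤ G := Real.sqrt_nonneg _
  have hN0 : 0 ≤ N := Real.sqrt_nonneg _
  have hGz : G = 0 := by
    refine eq_zero_of_virial_of_lichnerowicz hd3 hN0 hG0 hε₁ hε₂ hε ?_ ?_
    · exact hvir.trans (add_le_add (add_le_add
        (c1.trans (mul_le_mul_of_nonneg_right sV hN0))
        (c2.trans (mul_le_mul_of_nonneg_right sB hN0)))
        (c3.trans (mul_le_mul_of_nonneg_right sV hG0)))
    · refine hlic.trans (add_le_add_right (mul_le_mul_of_nonneg_left (c4.trans ?_)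
        (by positivity)) _)
      exact mul_le_mul sB sH (Real.sqrt_nonneg _) (mul_nonneg hε₁ hG0)
  -- With ∇_Aψ = 0, the Hardy inequality forces |x|⁻¹ψ = 0, hence ψ = 0 almost everywhere.
  have hint : ∫ x, (‖x‖⁻¹ * ‖(ψ : SpinorL2 d) x‖) ^ 2 ≤ 0 := by
    have := hH.2
    rwa [← hG, hGz, zero_pow two_ne_zero, mul_zero] at this
  have hz := (integral_eq_zero_iff_of_nonneg (fun x => sq_nonneg _)
    ((memLp_two_iff_integrable_sq hH.1.1).1 hH.1)).1
    (le_antisymm hint (integral_nonneg fun x => sq_nonneg _))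
  refine hne (Lp.ext ?_)
  filter_upwards [hz, ae_ne_zero hd0, Lp.coeFn_zero (Spinor d) 2 (volume : Measure (Space d))]
    with x hx hx0 hzero
  rw [hzero]
  have h1 : ‖x‖⁻¹ * ‖(ψ : SpinorL2 d) x‖ = 0 := pow_eq_zero_iff two_ne_zero |>.1 hx
  rcases mul_eq_zero.1 h1 with h2 | h2
  · exact absurd (inv_eq_zero.1 h2) (norm_ne_zero_iff.2 hx0)
  · exact norm_eq_zero.1 h2
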